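/- Let $M$ be a closed oriented smooth surface with a smooth Riemannian metric $g$, let $\kappa\in C^\infty(M,\mathbb R)$, and let $S_gM$ be the unit tangent bundle of $(M,g)$. Write $i$ for the rotation of the tangent planes by $\pi/2$ according to the orientation. On $S_gM$ let $X$ be the geodesic vector field, $V$ the vertical vector field (the generator of $(x,v)\mapsto(x,e^{it}v)$), and $X^\perp$ the horizontal vector field (the generator of $(x,v)\mapsto(\gamma(t),Z(t))$, where $\gamma$ is the geodesic with $\dot\gamma(0)=iv$ and $Z$ is the parallel transport of $v$ along $\gamma$). Let $F=X+\kappa V$ be the generator of the magnetic flow of $(g,\kappa)$ and let $$\mathbb K=K-X^\perp(\kappa)+\kappa^2\in C^\infty(S_gM,\mathbb R)$$ be its magnetic curvature, where $K$ is the Gaussian curvature of $g$ and functions on $M$ are viewed as functions on $S_gM$. Let $\mu$ be the Liouville measure on $S_gM$ (locally, the Riemannian area of $M$ times the arc length on the unit circles), and put $(u,w)=\int_{S_gM}u\,\overline{w}\,d\mu$ and $\|u\|^2=(u,u)$. Assume that $\mathbb K<0$ everywhere on $S_gM$, and let $u\in C^\infty(S_gM,\mathbb C)$. Then for every $r\in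 C^\infty(S_gM,\mathbb R)$ that solves the magnetic Riccati equation $Fr+r^2+\mathbb K=0$ on $S_gM$, $$\|Fu\|^2-(\mathbb K u,u)=\|Fu-ru\|^2 .$$ Moreover (without reference to any $r$), $$\|Fu\|^2-(\mathbb K u,u)\ge 0,$$ with equality if and only if $u\equiv 0$. -/

import Mathlib

open Bundle Manifold MeasureTheory
open scoped ContDiff ComplexOrder ComplexConjugate

noncomputable section

/-- The model plane `ℝ²`. -/
abbrev Plane : Type := EuclideanSpace ℝ (Fin 2)

namespace MagneticSurface

/-! ### Riemannian metrics on open subsets of the plane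

A metric in coordinates is a function `G` from the plane to the bilinear forms on the plane. -/

section Coordinates

/-- The coordinate vector `∂ᵢ`. -/
def basisVec (i : Fin 2) : Plane := EuclideanSpace.single i 1

/-- The partial derivative `∂ᵢ f` at `y`. -/
def partialDeriv (i : Fin 2) (f : Plane → ℝ) (y : Plane) : ℝ := fderiv ℝ f y (basisVec i)

/-- The matrix `(g_ij)` of a bilinear form. -/
def gram (B : Plane →L[ℝ] Plane →L[ℝ] ℝ) : Matrix (Fin 2) (Fin 2) ℝ :=
  Matrix.of fun i j => B (basisVec i) (basisVec j)

/-- Rotation by `+π/2` with respect to an inner product `B` and the standard orientation of the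
plane: the vector `J v` with `B (J v) v = 0`, `B (J v) (J v) = B v v` and `(v, J v)` positively
oriented, namely `J v = (det g)^(-1/2) (-B(v, ∂₁), B(v, ∂₀))`. -/
def rot (B : Plane →L[ℝ] Plane →L[ℝ] ℝ) (v : Plane) : Plane :=
  (Real.sqrt (gram B).det)⁻¹ • !₂[-(B v (basisVec 1)), B v (basisVec 0)]

/-- The Christoffel symbol
`Γᵏᵢⱼ = (1/2) ∑ₗ gᵏˡ (∂ᵢ g_jl + ∂ⱼ g_il - ∂ₗ g_ij)` at `y`. -/
def christoffel (G : Plane → Plane →L[ℝ] Plane →L[ℝ] ℝ) (k i j : Fin 2) (y : Plane) : ℝ :=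
  (1 / 2) * ∑ l, (gram (G y))⁻¹ k l *
    (partialDeriv i (fun z => gram (G z) j l) y + partialDeriv j (fun z => gram (G z) i l) y
      - partialDeriv l (fun z => gram (G z) i j) y)

/-- The vector `Γ(a, b) = ∑ₖ ∑ᵢⱼ Γᵏᵢⱼ aⁱ bʲ ∂ₖ`, so that the Levi-Civita connection is
`∇ₐ b = D b (a) + Γ(a, b)`. -/
def christoffelVec (G : Plane → Plane →L[ℝ] Plane →L[ℝ] ℝ) (y a b : Plane) : Plane :=
  WithLp.toLp 2 fun k => ∑ i, ∑ j, christoffel G k i j y * a i * b j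

/-- The component `Rˡ` of `R(∂ᵢ, ∂ⱼ)∂ₖ = ∇ᵢ∇ⱼ∂ₖ - ∇ⱼ∇ᵢ∂ₖ = ∑ₗ Rˡ ∂ₗ`. -/
def riemannTensor (G : Plane → Plane →L[ℝ] Plane →L[ℝ] ℝ) (l k i j : Fin 2) (y : Plane) : ℝ :=
  partialDeriv i (christoffel G l j k) y - partialDeriv j (christoffel G l i k) y
    + ∑ m, (christoffel G l i m y * christoffel G m j k y
      - christoffel G l j m y * christoffel G m i k y)

/-- The Gaussian curvature `g(R(∂₀, ∂₁)∂₁, ∂₀) / det g` at `y`. -/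
def coordGaussCurvature (G : Plane → Plane →L[ℝ] Plane →L[ℝ] ℝ) (y : Plane) : ℝ :=
  (∑ l, riemannTensor G l 1 0 1 y * gram (G y) l 0) / (gram (G y)).det

end Coordinates

/-! ### Oriented Riemannian surfaces and their unit tangent bundle -/

/-- The atlas of the surface is oriented: all its transition maps have positive Jacobian
determinant. -/
def IsOrientedAtlas (M : Type*) [TopologicalSpace M] [ChartedSpace Plane M] : Prop :=
  ∀ e ∈ atlas Plane M, ∀ e' ∈ atlas Plane M, ∀ y ∈ (e.symm ≫ₕ e').source,
    0 < (fderiv ℝ (e.symm ≫ₕ e') y).det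

variable {M : Type*} [TopologicalSpace M] [ChartedSpace Plane M] [IsManifold (𝓡 2) ∞ M]

variable (M) in
/-- Smooth Riemannian metrics on the surface. -/
abbrev Metric : Type _ :=
  ContMDiffRiemannianMetric (𝓡 2) ∞ Plane (fun x : M => TangentSpace (𝓡 2) x)

/-- The metric in the chart `e`, i.e. its pullback under `e.symm`. -/
def coordMetric (g : Metric M) (e : OpenPartialHomeomorph M Plane) (y : Plane) :
    Plane →L[ℝ] Plane →L[ℝ] ℝ :=
  let D : Plane →L[ℝ] TangentSpace (𝓡 2) (e.symm y) := mfderiv 𝓘(ℝ, Plane) (𝓡 2) e.symm y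
  (ContinuousLinearMap.precomp ℝ D).comp ((g.inner (e.symm y)).comp D)

/-- The unit tangent bundle `S_g M`. -/
def UnitTangentBundle (g : Metric M) : Type _ :=
  {p : TangentBundle (𝓡 2) M // g.inner p.proj p.snd p.snd = 1}

instance (g : Metric M) : TopologicalSpace (UnitTangentBundle g) :=
  inferInstanceAs
    (TopologicalSpace {p : TangentBundle (𝓡 2) M // g.inner p.proj p.snd p.snd = 1})

instance (g : Metric M) : MeasurableSpace (UnitTangentBundle g) := borel _

instance (g : Metric M) : BorelSpace (UnitTangentBundle g) := ⟨rfl⟩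

instance : MeasurableSpace (TangentBundle (𝓡 2) M) := borel _

instance : BorelSpace (TangentBundle (𝓡 2) M) := ⟨rfl⟩

theorem inner_normalize (g : Metric M) (x : M) (v : TangentSpace (𝓡 2) x) (hv : v ≠ 0) :
    g.inner x ((Real.sqrt (g.inner x v v))⁻¹ • v) ((Real.sqrt (g.inner x v v))⁻¹ • v) = 1 := by
  have h := g.pos x v hv
  have hs := Real.mul_self_sqrt h.le
  have hne : Real.sqrt (g.inner x v v) ≠ 0 := (Real.sqrt_pos.2 h).ne'
  rw [map_smul, map_smul]
  change _ * (_ * g.inner x v v) = 1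
  generalize Real.sqrt (g.inner x v v) = c at hs hne
  rw [← hs]
  field_simp

open Classical in
/-- The extension of a function `u` on `S_g M` to nonzero tangent vectors that is constant along
rays, `(x, v) ↦ u (x, v / |v|_g)`; it is given the irrelevant value `0` on zero vectors. -/
def radialExt {W : Type*} [Zero W] (g : Metric M) (u : UnitTangentBundle g → W)
    (p : TangentBundle (𝓡 2) M) : W :=
  if h : p.snd ≠ 0 then
    u ⟨⟨p.proj, (Real.sqrt (g.inner p.proj p.snd p.snd))⁻¹ • p.snd⟩,
      inner_normalize g p.proj p.snd h⟩
  else 0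

/-- `u ∈ C^∞(S_g M, W)`. As normalization is a smooth retraction of the nonzero tangent vectors onto
the hypersurface `S_g M`, this is smoothness of the extension constant along rays. -/
def IsSmooth {W : Type*} [NormedAddCommGroup W] [NormedSpace ℝ W] (g : Metric M)
    (u : UnitTangentBundle g → W) : Prop :=
  ContMDiffOn (𝓡 2).tangent 𝓘(ℝ, W) ∞ (radialExt g u) {p | p.snd ≠ 0}

/-- The derivative `Y u` on `S_g M` of a function `u` on `S_g M` along a vector field `Y` on `T M`
(to be used for vector fields tangent to `S_g M`, for which the choice of the extension of `u` does
not matter). -/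
def lieDeriv {W : Type*} [NormedAddCommGroup W] [NormedSpace ℝ W] (g : Metric M)
    (Y : ∀ p : TangentBundle (𝓡 2) M, TangentSpace (𝓡 2).tangent p)
    (u : UnitTangentBundle g → W) (p : UnitTangentBundle g) : W :=
  mfderiv (𝓡 2).tangent 𝓘(ℝ, W) (radialExt g u) p.1 (Y p.1)

/-! ### Cartan's moving frame

In Mathlib the tangent space `T_x M` is the plane, a tangent vector being given by its coordinates
in the preferred chart `chartAt Plane x`. Likewise `T_(x,v) (T M)` is the product of two planes, with
the coordinates given by the chart of `T M` induced by `chartAt Plane x`: the velocity of a curve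
`t ↦ (x(t), v(t))` in `T M` has the coordinates `(x'(0), v'(0))`. All of the following objects are
therefore written at `x` in the coordinates `chartAt Plane x`. -/

/-- The metric in the preferred chart at `x`. -/
def metricAt (g : Metric M) (x : M) : Plane → Plane →L[ℝ] Plane →L[ℝ] ℝ :=
  coordMetric g (chartAt Plane x)

/-- The almost complex structure `i` on `T_x M`, rotation by `π/2` according to the orientation. -/
def complexStructure (g : Metric M) (x : M) (v : TangentSpace (𝓡 2) x) : TangentSpace (𝓡 2) x :=
  rot (metricAt g x (chartAt Plane x x)) v

/-- The geodesic vector field `X`: the velocity at `t = 0` of `(γ, γ')`, where `γ` is the geodesic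
with `γ' = v` at `t = 0`, so `γ'' = -Γ(v, v)`. -/
def geodesicField (g : Metric M) (p : TangentBundle (𝓡 2) M) : TangentSpace (𝓡 2).tangent p :=
  let v : Plane := p.snd
  ((v, -christoffelVec (metricAt g p.proj) (chartAt Plane p.proj p.proj) v v) : Plane × Plane)

/-- The horizontal vector field `X^⊥`: the velocity at `t = 0` of `(γ, Z)`, where `γ` is the geodesic
with `γ' = i v` at `t = 0` and `Z` is the parallel transport of `v` along `γ`, so
`Z' = -Γ(i v, v)`. -/
def horizontalField (g : Metric M) (p : TangentBundle (𝓡 2) M) : TangentSpace (𝓡 2).tangent p :=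
  let v : Plane := p.snd
  let iv : Plane := complexStructure g p.proj p.snd
  ((iv, -christoffelVec (metricAt g p.proj) (chartAt Plane p.proj p.proj) iv v) : Plane × Plane)

/-- The vertical vector field `V`: the velocity at `t = 0` of `(x, e^{it} v)`. -/
def verticalField (g : Metric M) (p : TangentBundle (𝓡 2) M) : TangentSpace (𝓡 2).tangent p :=
  let iv : Plane := complexStructure g p.proj p.snd
  ((0, iv) : Plane × Plane)

/-- The generator `F = X + κ V` of the magnetic flow of `(g, κ)`. -/
def magneticField (g : Metric M) (κ : M → ℝ) (p : TangentBundle (𝓡 2) M) :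
    TangentSpace (𝓡 2).tangent p :=
  geodesicField g p + κ p.proj • verticalField g p

/-- The Gaussian curvature `K` of `(M, g)`. -/
def gaussCurvature (g : Metric M) (x : M) : ℝ :=
  coordGaussCurvature (metricAt g x) (chartAt Plane x x)

/-- The magnetic curvature `𝕂 = K - X^⊥(κ) + κ²`, a function on `S_g M`; functions on `M` are
viewed as functions on `S_g M`. -/
def magneticCurvature (g : Metric M) (κ : M → ℝ) (p : UnitTangentBundle g) : ℝ :=
  gaussCurvature g p.1.proj
    - lieDeriv g (horizontalField g) (fun q : UnitTangentBundle g => κ q.1.proj) p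
    + κ p.1.proj ^ 2

/-! ### The Liouville measure -/

/-- For a chart `e`, the parametrization of `S_g M` over the source of `e` by a point `y` of the
plane and an angle `θ`: it sends `(y, θ)` to the vector `cos θ E + sin θ i E` at `e.symm y`, where
`E = ∂₀ / |∂₀|_g`. -/
def coordParam (g : Metric M) (e : OpenPartialHomeomorph M Plane) (q : Plane × ℝ) :
    TangentBundle (𝓡 2) M :=
  let B := coordMetric g e q.1
  let E : Plane := (Real.sqrt (B (basisVec 0) (basisVec 0)))⁻¹ • basisVec 0
  ⟨e.symm q.1, (mfderiv 𝓘(ℝ, Plane) (𝓡 2) e.symm q.1 : Plane →L[ℝ] TangentSpace (𝓡 2) (e.symm q.1))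
    (Real.cos q.2 • E + Real.sin q.2 • rot B E)⟩

/-- The Liouville measure over the source of a chart `e`: in the coordinates `(y, θ)` above, the
volume form `α ∧ β ∧ ψ` has the density `√(det g(y))` with respect to `dy dθ`. -/
def coordLiouville (g : Metric M) (e : OpenPartialHomeomorph M Plane) :
    Measure (TangentBundle (𝓡 2) M) :=
  ((((volume : Measure Plane).prod (volume : Measure ℝ)).restrict
      (e.target ×ˢ Set.Ioc 0 (2 * Real.pi))).withDensity
    fun q => ENNReal.ofReal (Real.sqrt (gram (coordMetric g e q.1)).det)).map (coordParam g e)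

/-- The Liouville measure `μ` of `S_g M`. The measures given by the various charts agree over the
intersections of their sources and vanish off these sources, so that their supremum is the measure
obtained by gluing them together. -/
def liouville (g : Metric M) : Measure (UnitTangentBundle g) :=
  (⨆ e ∈ atlas Plane M, coordLiouville g e).comap Subtype.val

/-- The sesquilinear form `(u, w) = ∫ u w̄ dμ`. -/
def l2Form (g : Metric M) (u w : UnitTangentBundle g → ℂ) : ℂ :=
  ∫ p, u p * conj (w p) ∂(liouville g)

/-- The square `‖u‖² = ∫ |u|² dμ` of the `L²` norm. -/
def l2NormSq (g : Metric M) (u : UnitTangentBundle g → ℂ) : ℝ :=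
  ∫ p, ‖u p‖ ^ 2 ∂(liouville g)

end MagneticSurface

end

namespace MagneticSurface

/-! ### Riemannian metrics on open subsets of the plane -/

/-! The identity is a completed square. By the Leibniz rule F(r|u|²) = 2r Re⟨u, Fu⟩ + |u|² Fr, and
the Riccati equation replaces Fr by -r² - 𝕂. Hence, pointwise, |Fu - ru|² = |Fu|² - 𝕂|u|² -
F(r|u|²). The magnetic flow preserves μ, so the last term integrates to zero
(`IsSmooth.integral_lieDeriv_eq_zero`). For the second statement no r is needed: 𝕂 < 0 makes |Fu|²
and -𝕂|u|² nonnegative, and equality forces the continuous function 𝕂|u|² to vanish, because μ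
charges every nonempty open set.

The work lies in obtaining ∫ Fw dμ = 0 from the coordinate definitions. A vector field on TM is
given at each point in that point's own preferred chart, and μ is a supremum of measures attached to
charts. The Christoffel transformation law, together with the invariance of `rot` under
orientation-preserving isometries, shows that the magnetic and horizontal fields have the expected
expression in every chart of the atlas. Invariance of the Gaussian curvature likewise makes 𝕂
continuous, hence integrable on the compact space S_gM.

The integral is computed without angular coordinates. A function w on S_gM is extended to nonzero
vectors by homogeneity of degree 0 and read in the coordinates (y, v). Up to the finite positive
constant `radialMass`, the Liouville measure over a chart is the image, under normalization of v, of
det g(y) · √s b(s) dy dv, where s = g(v, v) and b is a bump around 1. In these coordinates det g ·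
(v, -Γ(v, v) + κ|v| Jv) has zero divergence and preserves s. For w supported over a compact subset
of the chart, the divergence theorem for the compactly supported function b(s)w gives the claim; the
factor √s appears because this field differentiates w with |v| times the speed at the unit vector. A
partition of unity removes the support condition.

The description by (y, v) also gives the agreement of the chart measures on overlaps and the
positivity of μ on open sets. -/

theorem eq_sum_basisVec (v : Plane) : v = v 0 • basisVec 0 + v 1 • basisVec 1 := by
  ext i; fin_cases i <;> simp [basisVec]

@[simp] theorem basisVec_apply (i j : Fin 2) : basisVec i j = if j = i then 1 else 0 := by
  simp [basisVec, PiLp.single_apply]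

theorem bilin_expand (B : Plane →L[ℝ] Plane →L[ℝ] ℝ) (v w : Plane) :
    B v w = v 0 * w 0 * gram B 0 0 + v 0 * w 1 * gram B 0 1 + v 1 * w 0 * gram B 1 0
      + v 1 * w 1 * gram B 1 1 := by
  conv_lhs => rw [eq_sum_basisVec v, eq_sum_basisVec w]
  simp only [map_add, map_smul, add_apply, smul_apply,
    smul_eq_mul, gram, Matrix.of_apply]
  ring

/-- `B` is an inner product on the plane. -/
structure IsInner (B : Plane →L[ℝ] Plane →L[ℝ] ℝ) : Prop where
  symm : ∀ v w, B v w = B w v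
  pos : ∀ v, v ≠ 0 → 0 < B v v

namespace IsInner

variable {B : Plane →L[ℝ] Plane →L[ℝ] ℝ}

theorem gram_symm (h : IsInner B) (i j : Fin 2) : gram B i j = gram B j i := h.symm _ _

theorem det_eq (h : IsInner B) :
    (gram B).det = gram B 0 0 * gram B 1 1 - gram B 0 1 ^ 2 := by
  rw [Matrix.det_fin_two, h.gram_symm 1 0]; ring

theorem gram_zero_pos (h : IsInner B) : 0 < gram B 0 0 := by
  refine h.pos _ fun h0 => ?_
  have := congrArg (fun v : Plane => v 0) h0
  simp at this

theorem det_pos (h : IsInner B) : 0 < (gram B).det := by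
  have h0 := h.gram_zero_pos
  have h1 := h.pos (!₂[-gram B 0 1, gram B 0 0]) fun h' => by
    have := congrArg (fun v : Plane => v 1) h'
    simp at this
    exact h0.ne' this
  rw [bilin_expand, h.gram_symm 1 0] at h1
  simp at h1
  rw [h.det_eq]
  refine pos_of_mul_pos_right (a := gram B 0 0) ?_ h0.le
  nlinarith

theorem ext_right (h : IsInner B) {v w : Plane} (hvw : ∀ c, B v c = B w c) : v = w := by
  by_contra hne
  have := h.pos (v - w) (sub_ne_zero.2 hne)
  rw [map_sub, map_sub, sub_apply, sub_apply, hvw v, hvw w, sub_self, sub_self, sub_zero] at this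
  exact this.false

theorem sqrt_det_sq (h : IsInner B) : Real.sqrt (gram B).det ^ 2 = (gram B).det :=
  Real.sq_sqrt h.det_pos.le

theorem sqrt_det_pos (h : IsInner B) : 0 < Real.sqrt (gram B).det := Real.sqrt_pos.2 h.det_pos

/-- Pairing with `rot B v` is contraction of the Riemannian area form with v. This characterizes the
rotation without reference to its components and yields its invariance under isometries. -/
theorem inner_rot_left (h : IsInner B) (v w : Plane) :
    B (rot B v) w = Real.sqrt (gram B).det * (v 0 * w 1 - v 1 * w 0) := by
  have hs := h.sqrt_det_sq
  have hp := h.sqrt_det_pos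
  have hd := h.det_eq
  rw [rot, map_smul, smul_apply, smul_eq_mul, bilin_expand]
  rw [bilin_expand B v (basisVec 1), bilin_expand B v (basisVec 0)]
  simp only [h.gram_symm 1 0]
  simp
  rw [inv_mul_eq_iff_eq_mul₀ hp.ne', ← mul_assoc, ← pow_two, hs, hd]
  ring

theorem inner_rot_self (h : IsInner B) (v : Plane) : B (rot B v) v = 0 := by
  rw [h.inner_rot_left]; ring

theorem inner_rot_rot (h : IsInner B) (v : Plane) : B (rot B v) (rot B v) = B v v := by
  have hs := h.sqrt_det_sq
  have hp := h.sqrt_det_pos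
  rw [h.inner_rot_left, rot]
  simp
  rw [bilin_expand B v (basisVec 1), bilin_expand B v (basisVec 0), bilin_expand B v v]
  simp only [h.gram_symm 1 0]
  simp
  field_simp
  ring

end IsInner

/-- The determinant of a linear map of the plane in the standard basis. -/
theorem det_plane (L : Plane →L[ℝ] Plane) :
    L.det = L (basisVec 0) 0 * L (basisVec 1) 1 - L (basisVec 1) 0 * L (basisVec 0) 1 := by
  rw [ContinuousLinearMap.det,
    ← LinearMap.det_toMatrix (EuclideanSpace.basisFun (Fin 2) ℝ).toBasis, Matrix.det_fin_two]
  simp [LinearMap.toMatrix_apply, basisVec]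

/-- The oriented area of the image of a pair of vectors. -/
theorem area_map (L : Plane →L[ℝ] Plane) (v w : Plane) :
    L v 0 * L w 1 - L v 1 * L w 0 = L.det * (v 0 * w 1 - v 1 * w 0) := by
  rw [det_plane]
  conv_lhs => rw [eq_sum_basisVec v, eq_sum_basisVec w]
  simp only [map_add, map_smul, PiLp.add_apply, PiLp.smul_apply, smul_eq_mul]
  ring

theorem gram_det_pullback {B B' : Plane →L[ℝ] Plane →L[ℝ] ℝ} {L : Plane →L[ℝ] Plane}
    (hL : ∀ v w, B v w = B' (L v) (L w)) : (gram B).det = (gram B').det * L.det ^ 2 := by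
  have key : ∀ i j, gram B i j = B' (L (basisVec i)) (L (basisVec j)) := fun i j => hL _ _
  rw [Matrix.det_fin_two, key, key, key, key, det_plane, Matrix.det_fin_two]
  simp only [bilin_expand B' (L _)]
  ring

/-- Both sides have the same pairing with every vector, since L multiplies the coordinate area by
its determinant and √det of the Gram matrix changes by the same factor. Positivity of the
determinant is what removes the absolute value from √(det²). -/
theorem rot_pullback {B B' : Plane →L[ℝ] Plane →L[ℝ] ℝ} {L : Plane →L[ℝ] Plane}
    (hB : IsInner B) (hB' : IsInner B')
    (hL : ∀ v w, B v w = B' (L v) (L w)) (hdet : 0 < L.det) (v : Plane) :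
    L (rot B v) = rot B' (L v) := by
  have hs : Real.sqrt (gram B).det = Real.sqrt (gram B').det * L.det := by
    rw [gram_det_pullback hL, Real.sqrt_mul hB'.det_pos.le, Real.sqrt_sq hdet.le]
  have hsurj : Function.Surjective L := by
    have : IsUnit (LinearMap.det (L : Plane →ₗ[ℝ] Plane)) := hdet.ne'.isUnit
    exact (LinearEquiv.ofIsUnitDet (v := (EuclideanSpace.basisFun (Fin 2) ℝ).toBasis)
      (v' := (EuclideanSpace.basisFun (Fin 2) ℝ).toBasis)
      (by rwa [LinearMap.det_toMatrix])).surjective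
  refine hB'.ext_right fun c => ?_
  obtain ⟨w, rfl⟩ := hsurj c
  rw [← hL, hB.inner_rot_left, hB'.inner_rot_left, hs, area_map]
  ring

/-- `G` is a smooth Riemannian metric on the open subset `U` of the plane. -/
structure IsMetricOn (G : Plane → Plane →L[ℝ] Plane →L[ℝ] ℝ) (U : Set Plane) : Prop where
  isOpen : IsOpen U
  smooth : ContDiffOn ℝ ∞ G U
  inner : ∀ y ∈ U, IsInner (G y)

/-- The Christoffel symbols as a bilinear map. -/
noncomputable def christoffelCLM (G : Plane → Plane →L[ℝ] Plane →L[ℝ] ℝ) (y : Plane) :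
    Plane →L[ℝ] Plane →L[ℝ] Plane :=
  ∑ k, ∑ i, ∑ j, christoffel G k i j y •
    (EuclideanSpace.proj i : Plane →L[ℝ] ℝ).smulRight
      ((EuclideanSpace.proj j : Plane →L[ℝ] ℝ).smulRight (basisVec k))

theorem christoffelCLM_apply (G : Plane → Plane →L[ℝ] Plane →L[ℝ] ℝ) (y a b : Plane) :
    christoffelCLM G y a b = christoffelVec G y a b := by
  ext k
  fin_cases k <;> simp [christoffelCLM, christoffelVec, Fin.sum_univ_two] <;> ring

theorem christoffelCLM_basisVec (G : Plane → Plane →L[ℝ] Plane →L[ℝ] ℝ) (y : Plane)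
    (k i j : Fin 2) : christoffelCLM G y (basisVec i) (basisVec j) k = christoffel G k i j y := by
  rw [christoffelCLM_apply]
  fin_cases i <;> fin_cases j <;> simp [christoffelVec]

/-! ### The Levi-Civita connection of a planar metric -/

namespace IsMetricOn

variable {G : Plane → Plane →L[ℝ] Plane →L[ℝ] ℝ} {U : Set Plane}

theorem contDiffAt (h : IsMetricOn G U) {y : Plane} (hy : y ∈ U) : ContDiffAt ℝ ∞ G y :=
  h.smooth.contDiffAt (h.isOpen.mem_nhds hy)

theorem differentiableAt (h : IsMetricOn G U) {y : Plane} (hy : y ∈ U) :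
    DifferentiableAt ℝ G y := (h.contDiffAt hy).differentiableAt (by simp)

theorem fderiv_apply₂ (h : IsMetricOn G U) {y : Plane} (hy : y ∈ U) (v w a : Plane) :
    fderiv ℝ (fun z => G z v w) y a = fderiv ℝ G y a v w := by
  have h1 := (h.differentiableAt hy).hasFDerivAt
  have h2 := (h1.clm_apply (hasFDerivAt_const v y)).clm_apply (hasFDerivAt_const w y)
  rw [h2.fderiv]; simp

theorem partialDeriv_gram (h : IsMetricOn G U) {y : Plane} (hy : y ∈ U) (i j l : Fin 2) :
    partialDeriv i (fun z => gram (G z) j l) y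
      = fderiv ℝ G y (basisVec i) (basisVec j) (basisVec l) :=
  h.fderiv_apply₂ hy _ _ _

theorem fderiv_symm (h : IsMetricOn G U) {y : Plane} (hy : y ∈ U) (a v w : Plane) :
    fderiv ℝ G y a v w = fderiv ℝ G y a w v := by
  rw [← h.fderiv_apply₂ hy, ← h.fderiv_apply₂ hy]
  congr 1
  refine Filter.EventuallyEq.fderiv_eq ?_
  filter_upwards [h.isOpen.mem_nhds hy] with z hz using (h.inner z hz).symm _ _

-- On coordinate vectors this is the definition of the Christoffel symbols with the inverse Gram
-- matrix cleared; trilinearity does the rest. Symmetry, metric compatibility and the transformation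
-- law all follow from this formula by nondegeneracy or linear algebra, without indices.
set_option synthInstance.maxHeartbeats 200000 in
theorem koszul (h : IsMetricOn G U) {y : Plane} (hy : y ∈ U) (a b c : Plane) :
    2 * G y (christoffelCLM G y a b) c
      = fderiv ℝ G y a b c + fderiv ℝ G y b a c - fderiv ℝ G y c a b := by
  have hI := h.inner y hy
  have hd := hI.det_pos.ne'
  have key : ∀ i j d : Fin 2, 2 * G y (christoffelCLM G y (basisVec i) (basisVec j)) (basisVec d)
      = fderiv ℝ G y (basisVec i) (basisVec j) (basisVec d)
        + fderiv ℝ G y (basisVec j) (basisVec i) (basisVec d)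
        - fderiv ℝ G y (basisVec d) (basisVec i) (basisVec j) := by
    intro i j d
    rw [bilin_expand, christoffelCLM_basisVec, christoffelCLM_basisVec]
    simp only [christoffel, h.partialDeriv_gram hy, Fin.sum_univ_two, Matrix.inv_def,
      Ring.inverse_eq_inv', Matrix.adjugate_fin_two, Matrix.smul_apply, smul_eq_mul,
      Matrix.of_apply, Matrix.cons_val', Matrix.cons_val_zero, Matrix.cons_val_one,
      Matrix.cons_val_fin_one, basisVec_apply, hI.gram_symm 1 0]
    have hdd := hI.det_eq
    generalize (gram (G y)).det = D at *
    fin_cases d <;> simp <;> field_simp <;> rw [hdd] <;> ring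
  rw [eq_sum_basisVec a, eq_sum_basisVec b, eq_sum_basisVec c]
  simp only [map_add, map_smul, add_apply, smul_apply,
    smul_eq_mul]
  have := key
  linear_combination (a 0 * b 0 * c 0) * key 0 0 0 + (a 0 * b 0 * c 1) * key 0 0 1
    + (a 0 * b 1 * c 0) * key 0 1 0 + (a 0 * b 1 * c 1) * key 0 1 1
    + (a 1 * b 0 * c 0) * key 1 0 0 + (a 1 * b 0 * c 1) * key 1 0 1
    + (a 1 * b 1 * c 0) * key 1 1 0 + (a 1 * b 1 * c 1) * key 1 1 1

theorem christoffelCLM_symm (h : IsMetricOn G U) {y : Plane} (hy : y ∈ U) (a b : Plane) :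
    christoffelCLM G y a b = christoffelCLM G y b a := by
  refine (h.inner y hy).ext_right fun c => ?_
  have h1 := h.koszul hy a b c
  have h2 := h.koszul hy b a c
  rw [h.fderiv_symm hy c b a] at h2
  linarith

/-- Compatibility of the Levi-Civita connection with the metric. -/
theorem fderiv_metric (h : IsMetricOn G U) {y : Plane} (hy : y ∈ U) (a v w : Plane) :
    fderiv ℝ G y a v w
      = G y (christoffelCLM G y a v) w + G y v (christoffelCLM G y a w) := by
  have h1 := h.koszul hy a v w
  have h2 := h.koszul hy a w v
  rw [(h.inner y hy).symm v]
  rw [h.fderiv_symm hy a w v] at h2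
  linarith

theorem contDiffOn_gram (h : IsMetricOn G U) (i j : Fin 2) :
    ContDiffOn ℝ ∞ (fun y => gram (G y) i j) U :=
  (h.smooth.clm_apply contDiffOn_const).clm_apply contDiffOn_const

theorem contDiffOn_det (h : IsMetricOn G U) : ContDiffOn ℝ ∞ (fun y => (gram (G y)).det) U := by
  simp only [Matrix.det_fin_two]
  exact ((h.contDiffOn_gram 0 0).mul (h.contDiffOn_gram 1 1)).sub
    ((h.contDiffOn_gram 0 1).mul (h.contDiffOn_gram 1 0))

theorem contDiffOn_partialDeriv {f : Plane → ℝ} (hU : IsOpen U) (hf : ContDiffOn ℝ ∞ f U)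
    (i : Fin 2) : ContDiffOn ℝ ∞ (partialDeriv i f) U :=
  (hf.fderiv_of_isOpen hU (m := ∞) (by simp)).clm_apply contDiffOn_const

theorem contDiffOn_gram_inv (h : IsMetricOn G U) (i j : Fin 2) :
    ContDiffOn ℝ ∞ (fun y => (gram (G y))⁻¹ i j) U := by
  simp only [Matrix.inv_def, Ring.inverse_eq_inv', Matrix.smul_apply, smul_eq_mul,
    Matrix.adjugate_fin_two]
  refine (h.contDiffOn_det.inv fun y hy => (h.inner y hy).det_pos.ne').mul ?_
  fin_cases i <;> fin_cases j <;> simp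
  · exact h.contDiffOn_gram 1 1
  · exact (h.contDiffOn_gram 0 1).neg
  · exact (h.contDiffOn_gram 1 0).neg
  · exact h.contDiffOn_gram 0 0

theorem contDiffOn_christoffel (h : IsMetricOn G U) (k i j : Fin 2) :
    ContDiffOn ℝ ∞ (christoffel G k i j) U := by
  refine contDiffOn_const.mul (ContDiffOn.sum fun l _ => (h.contDiffOn_gram_inv k l).mul ?_)
  have hp : ∀ i j l : Fin 2, ContDiffOn ℝ ∞ (partialDeriv i (fun z => gram (G z) j l)) U :=
    fun i j l => contDiffOn_partialDeriv h.isOpen (h.contDiffOn_gram j l) i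
  exact ((hp i j l).add (hp j i l)).sub (hp l i j)

set_option synthInstance.maxHeartbeats 200000 in
theorem contDiffOn_christoffelCLM (h : IsMetricOn G U) :
    ContDiffOn ℝ ∞ (christoffelCLM G) U := by
  refine contDiffOn_clm_apply.2 fun a => contDiffOn_clm_apply.2 fun b => ?_
  simp only [christoffelCLM_apply]
  refine contDiffOn_euclidean.2 fun k => ?_
  change ContDiffOn ℝ ∞ (fun y => ∑ i, ∑ j, christoffel G k i j y * a i * b j) U
  exact ContDiffOn.sum fun i _ => ContDiffOn.sum fun j _ =>
    ((h.contDiffOn_christoffel k i j).mul contDiffOn_const).mul contDiffOn_const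

theorem contDiffOn_coordGaussCurvature (h : IsMetricOn G U) :
    ContDiffOn ℝ ∞ (coordGaussCurvature G) U := by
  refine ContDiffOn.div (ContDiffOn.sum fun l _ => ?_) h.contDiffOn_det
    fun y hy => (h.inner y hy).det_pos.ne'
  have hc := h.contDiffOn_christoffel
  refine ContDiffOn.mul ?_ (h.contDiffOn_gram l 0)
  exact ((contDiffOn_partialDeriv h.isOpen (hc l 1 1) 0).sub
    (contDiffOn_partialDeriv h.isOpen (hc l 0 1) 1)).add
    (ContDiffOn.sum fun m _ => ((hc l 0 m).mul (hc m 1 1)).sub ((hc l 1 m).mul (hc m 0 1)))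

end IsMetricOn

end MagneticSurface

set_option synthInstance.maxHeartbeats 400000
set_option maxHeartbeats 1000000

namespace MagneticSurface

theorem minSmoothness_two_le_infty : minSmoothness ℝ 2 ≤ (∞ : WithTop ℕ∞) := by
  rw [minSmoothness_of_isRCLikeNormedField]
  exact WithTop.coe_le_coe.2 le_top

theorem hasFDerivAt_bilin_comp {E F W : Type*} [NormedAddCommGroup E] [NormedSpace ℝ E]
    [NormedAddCommGroup F] [NormedSpace ℝ F] [NormedAddCommGroup W] [NormedSpace ℝ W]
    {A : E → F →L[ℝ] F →L[ℝ] W} {A' : E →L[ℝ] F →L[ℝ] F →L[ℝ] W} {φ : E → E}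
    {φ' : E →L[ℝ] E} {v w : E → F} {v' w' : E →L[ℝ] F} {y : E} (hA : HasFDerivAt A A' (φ y))
    (hφ : HasFDerivAt φ φ' y) (hv : HasFDerivAt v v' y) (hw : HasFDerivAt w w' y) :
    HasFDerivAt (fun z => A (φ z) (v z) (w z))
      (((A'.flip (v y)).flip (w y)).comp φ' + ((A (φ y)).flip (w y)).comp v'
        + (A (φ y) (v y)).comp w') y := by
  have h1 : HasFDerivAt (fun z => A (φ z)) (A'.comp φ') y :=
    HasFDerivAt.comp (G := F →L[ℝ] F →L[ℝ] W) (g := A) y hA hφ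
  have h2 : HasFDerivAt (fun z => A (φ z) (v z)) _ y :=
    HasFDerivAt.clm_apply (H := F →L[ℝ] W) h1 hv
  convert! h2.clm_apply hw using 1
  ext a
  simp
  abel

/-! ### Behaviour under local isometries -/

/-- `φ` is a smooth map from `U` to `U'` that pulls the metric `G'` back to the metric `G`. -/
structure IsIsometryOn (φ : Plane → Plane) (G G' : Plane → Plane →L[ℝ] Plane →L[ℝ] ℝ)
    (U U' : Set Plane) : Prop where
  source : IsMetricOn G U
  target : IsMetricOn G' U'
  contDiffOn : ContDiffOn ℝ ∞ φ U
  mapsTo : Set.MapsTo φ U U'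
  pullback : ∀ y ∈ U, ∀ v w, G y v w = G' (φ y) (fderiv ℝ φ y v) (fderiv ℝ φ y w)

/-- The curvature `R(a, b)c`. -/
noncomputable def curvatureVec (G : Plane → Plane →L[ℝ] Plane →L[ℝ] ℝ) (y a b c : Plane) :
    Plane :=
  fderiv ℝ (christoffelCLM G) y a b c - fderiv ℝ (christoffelCLM G) y b a c
    + christoffelCLM G y a (christoffelCLM G y b c)
    - christoffelCLM G y b (christoffelCLM G y a c)

/-! ### Symmetries of the curvature -/

namespace IsMetricOn

variable {G : Plane → Plane →L[ℝ] Plane →L[ℝ] ℝ} {U : Set Plane}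

theorem hasFDerivAt_christoffelCLM (h : IsMetricOn G U) {y : Plane} (hy : y ∈ U) :
    HasFDerivAt (christoffelCLM G) (fderiv ℝ (christoffelCLM G) y) y :=
  ((h.contDiffOn_christoffelCLM.contDiffAt (h.isOpen.mem_nhds hy)).differentiableAt
    (by simp)).hasFDerivAt

theorem hasFDerivAt_christoffelCLM_apply (h : IsMetricOn G U) {y : Plane} (hy : y ∈ U)
    (b c : Plane) :
    HasFDerivAt (fun z => christoffelCLM G z b c)
      (((fderiv ℝ (christoffelCLM G) y).flip b).flip c) y := by
  have h1 := ((h.hasFDerivAt_christoffelCLM hy).clm_apply (hasFDerivAt_const b y)).clm_apply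
    (hasFDerivAt_const c y)
  convert! h1 using 1
  ext v i
  simp

theorem partialDeriv_christoffel (h : IsMetricOn G U) {y : Plane} (hy : y ∈ U)
    (l i j k : Fin 2) : partialDeriv i (christoffel G l j k) y
      = fderiv ℝ (christoffelCLM G) y (basisVec i) (basisVec j) (basisVec k) l := by
  have h1 := h.hasFDerivAt_christoffelCLM_apply hy (basisVec j) (basisVec k)
  have h2 := (EuclideanSpace.proj l : Plane →L[ℝ] ℝ).hasFDerivAt.comp y h1
  have h3 : (fun z => (EuclideanSpace.proj l : Plane →L[ℝ] ℝ)
      (christoffelCLM G z (basisVec j) (basisVec k))) = christoffel G l j k := by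
    ext z; simp [christoffelCLM_basisVec]
  rw [Function.comp_def, h3] at h2
  rw [partialDeriv, h2.fderiv]
  simp

theorem riemannTensor_eq (h : IsMetricOn G U) {y : Plane} (hy : y ∈ U) (l k i j : Fin 2) :
    riemannTensor G l k i j y = curvatureVec G y (basisVec i) (basisVec j) (basisVec k) l := by
  have key : ∀ i j k : Fin 2, christoffelCLM G y (basisVec i)
      (christoffelCLM G y (basisVec j) (basisVec k)) l
        = ∑ m, christoffel G l i m y * christoffel G m j k y := by
    intro i j k
    rw [eq_sum_basisVec (christoffelCLM G y (basisVec j) (basisVec k)), map_add, map_smul,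
      map_smul]
    simp only [PiLp.add_apply, PiLp.smul_apply, smul_eq_mul, christoffelCLM_basisVec,
      Fin.sum_univ_two]
    ring
  rw [riemannTensor, h.partialDeriv_christoffel hy, h.partialDeriv_christoffel hy, curvatureVec]
  simp only [PiLp.add_apply, PiLp.sub_apply, key, Finset.sum_sub_distrib]
  ring

theorem coordGaussCurvature_mul_det (h : IsMetricOn G U) {y : Plane} (hy : y ∈ U) :
    coordGaussCurvature G y * (gram (G y)).det
      = G y (curvatureVec G y (basisVec 0) (basisVec 1) (basisVec 1)) (basisVec 0) := by
  rw [coordGaussCurvature, div_mul_cancel₀ _ (h.inner y hy).det_pos.ne', Fin.sum_univ_two,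
    h.riemannTensor_eq hy, h.riemannTensor_eq hy, bilin_expand (G y) (curvatureVec _ _ _ _ _)]
  simp

/-- Metric compatibility expresses the second derivative of y ↦ G_y(c, c) through Γ and its
derivative. Symmetry of that second derivative in a and b is exactly the vanishing asserted. -/
theorem inner_curvatureVec_self (h : IsMetricOn G U) {y : Plane} (hy : y ∈ U) (a b c : Plane) :
    G y (curvatureVec G y a b c) c = 0 := by
  have hsymm := (h.inner y hy).symm
  have hf : ContDiffOn ℝ ∞ (fun z => G z c c) U :=
    (h.smooth.clm_apply contDiffOn_const).clm_apply contDiffOn_const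
  have hsnd := (hf.contDiffAt (h.isOpen.mem_nhds hy)).isSymmSndFDerivAt minSmoothness_two_le_infty
  have key : ∀ a b : Plane, fderiv ℝ (fderiv ℝ (fun z => G z c c)) y a b
      = 2 * (G y (christoffelCLM G y a (christoffelCLM G y b c)) c
        + G y (christoffelCLM G y b c) (christoffelCLM G y a c)
        + G y (fderiv ℝ (christoffelCLM G) y a b c) c) := by
    intro a b
    have h1 : (fun z => fderiv ℝ (fun z => G z c c) z b)
        =ᶠ[nhds y] fun z => 2 * G z (christoffelCLM G z b c) c := by
      filter_upwards [h.isOpen.mem_nhds hy] with z hz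
      rw [h.fderiv_apply₂ hz, h.fderiv_metric hz, (h.inner z hz).symm c]
      ring
    have h2 := (((h.differentiableAt hy).hasFDerivAt.clm_apply
      (h.hasFDerivAt_christoffelCLM_apply hy b c)).clm_apply (hasFDerivAt_const c y)).const_mul 2
    have h3 : HasFDerivAt (fun z => fderiv ℝ (fun z => G z c c) z b)
        ((fderiv ℝ (fderiv ℝ (fun z => G z c c)) y).flip b) y := by
      have h4 : DifferentiableAt ℝ (fderiv ℝ (fun z => G z c c)) y :=
        ((hf.fderiv_of_isOpen h.isOpen (m := ∞) (by simp)).contDiffAt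
          (h.isOpen.mem_nhds hy)).differentiableAt (by simp)
      convert! h4.hasFDerivAt.clm_apply (hasFDerivAt_const b y) using 1
      ext v; simp
    have h5 := congrArg (fun L : Plane →L[ℝ] ℝ => L a)
      ((h3.congr_of_eventuallyEq h1.symm).unique h2)
    simp [h.fderiv_metric hy] at h5
    rw [h5]
    ring
  have h1 := key a b
  have h2 := key b a
  rw [hsnd.eq] at h1
  rw [hsymm (christoffelCLM G y b c)] at h1
  simp only [curvatureVec, map_add, map_sub, add_apply, sub_apply]
  linarith

theorem curvatureVec_area (G : Plane → Plane →L[ℝ] Plane →L[ℝ] ℝ) (y a b c : Plane) :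
    curvatureVec G y a b c
      = (a 0 * b 1 - a 1 * b 0) • curvatureVec G y (basisVec 0) (basisVec 1) c := by
  simp only [curvatureVec]
  generalize fderiv ℝ (christoffelCLM G) y = D
  conv_lhs => rw [eq_sum_basisVec a, eq_sum_basisVec b]
  simp only [map_add, map_smul, add_apply, smul_apply, smul_add, smul_sub, sub_smul, mul_smul]
  module

/-- In dimension two, alternation in the first pair and skewness in the second leave a single
component of the curvature, so each pair contributes one factor of the coordinate area. This form is
what can be compared under a change of coordinates that does not respect the basis. -/
theorem inner_curvatureVec (h : IsMetricOn G U) {y : Plane} (hy : y ∈ U) (a b : Plane) :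
    G y (curvatureVec G y a b b) a
      = coordGaussCurvature G y * (gram (G y)).det * (a 0 * b 1 - a 1 * b 0) ^ 2 := by
  have hadd : ∀ c d, curvatureVec G y (basisVec 0) (basisVec 1) (c + d)
      = curvatureVec G y (basisVec 0) (basisVec 1) c
        + curvatureVec G y (basisVec 0) (basisVec 1) d := by
    intro c d; simp only [curvatureVec, map_add]; abel
  have hsmul : ∀ (t : ℝ) c, curvatureVec G y (basisVec 0) (basisVec 1) (t • c)
      = t • curvatureVec G y (basisVec 0) (basisVec 1) c := by
    intro t c; simp only [curvatureVec, map_smul, smul_add, smul_sub]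
  have h0 := h.inner_curvatureVec_self hy (basisVec 0) (basisVec 1) (basisVec 0)
  have h1 := h.inner_curvatureVec_self hy (basisVec 0) (basisVec 1) (basisVec 1)
  -- Polarization: the two mixed components are opposite to each other.
  have h2 := h.inner_curvatureVec_self hy (basisVec 0) (basisVec 1) (basisVec 0 + basisVec 1)
  simp only [hadd, map_add, add_apply, h0, h1] at h2
  rw [h.coordGaussCurvature_mul_det hy, curvatureVec_area, map_smul, smul_apply]
  conv_lhs =>
    enter [2]
    rw [eq_sum_basisVec a, eq_sum_basisVec b]
  simp only [hadd, hsmul, map_add, map_smul, add_apply, smul_apply, smul_eq_mul, h0, h1]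
  simp
  linear_combination (a 0 * b 1 - a 1 * b 0) * (b 0 * a 1) * h2

end IsMetricOn

/-! ### Transformation of the connection and the curvature under isometries -/

namespace IsIsometryOn

variable {φ : Plane → Plane} {G G' : Plane → Plane →L[ℝ] Plane →L[ℝ] ℝ} {U U' : Set Plane}

theorem contDiffOn_fderiv (h : IsIsometryOn φ G G' U U') : ContDiffOn ℝ ∞ (fderiv ℝ φ) U :=
  h.contDiffOn.fderiv_of_isOpen h.source.isOpen (by simp)

theorem hasFDerivAt (h : IsIsometryOn φ G G' U U') {y : Plane} (hy : y ∈ U) :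
    HasFDerivAt φ (fderiv ℝ φ y) y :=
  ((h.contDiffOn.contDiffAt (h.source.isOpen.mem_nhds hy)).differentiableAt
    (by simp)).hasFDerivAt

theorem hasFDerivAt_fderiv (h : IsIsometryOn φ G G' U U') {y : Plane} (hy : y ∈ U) :
    HasFDerivAt (fderiv ℝ φ) (fderiv ℝ (fderiv ℝ φ) y) y :=
  ((h.contDiffOn_fderiv.contDiffAt (h.source.isOpen.mem_nhds hy)).differentiableAt
    (by simp)).hasFDerivAt

theorem hasFDerivAt_fderiv_apply (h : IsIsometryOn φ G G' U U') {y : Plane} (hy : y ∈ U)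
    (v : Plane) : HasFDerivAt (fun z => fderiv ℝ φ z v) ((fderiv ℝ (fderiv ℝ φ) y).flip v) y := by
  convert! (h.hasFDerivAt_fderiv hy).clm_apply (hasFDerivAt_const v y) using 1
  ext w; simp

theorem fderiv_fderiv_symm (h : IsIsometryOn φ G G' U U') {y : Plane} (hy : y ∈ U)
    (a b : Plane) : fderiv ℝ (fderiv ℝ φ) y a b = fderiv ℝ (fderiv ℝ φ) y b a :=
  ((h.contDiffOn.contDiffAt (h.source.isOpen.mem_nhds hy)).isSymmSndFDerivAt minSmoothness_two_le_infty).eq a b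

theorem det_ne_zero (h : IsIsometryOn φ G G' U U') {y : Plane} (hy : y ∈ U) :
    (fderiv ℝ φ y).det ≠ 0 := by
  intro h0
  have := gram_det_pullback (h.pullback y hy)
  rw [h0] at this
  have h1 := (h.source.inner y hy).det_pos
  simp [this] at h1

theorem surjective (h : IsIsometryOn φ G G' U U') {y : Plane} (hy : y ∈ U) :
    Function.Surjective (fderiv ℝ φ y) :=
  (LinearEquiv.ofIsUnitDet (v := (EuclideanSpace.basisFun (Fin 2) ℝ).toBasis)
      (v' := (EuclideanSpace.basisFun (Fin 2) ℝ).toBasis)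
      (by rw [LinearMap.det_toMatrix]; exact (h.det_ne_zero hy).isUnit)).surjective

theorem fderiv_pullback (h : IsIsometryOn φ G G' U U') {y : Plane} (hy : y ∈ U)
    (a v w : Plane) :
    fderiv ℝ G y a v w
      = fderiv ℝ G' (φ y) (fderiv ℝ φ y a) (fderiv ℝ φ y v) (fderiv ℝ φ y w)
        + G' (φ y) (fderiv ℝ (fderiv ℝ φ) y a v) (fderiv ℝ φ y w)
        + G' (φ y) (fderiv ℝ φ y v) (fderiv ℝ (fderiv ℝ φ) y a w) := by
  have h1 : (fun z => G z v w)
      =ᶠ[nhds y] fun z => G' (φ z) (fderiv ℝ φ z v) (fderiv ℝ φ z w) := by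
    filter_upwards [h.source.isOpen.mem_nhds hy] with z hz using h.pullback z hz v w
  have h2 := hasFDerivAt_bilin_comp (E := Plane) (F := Plane) (W := ℝ)
    (h.target.differentiableAt (h.mapsTo hy)).hasFDerivAt
    (h.hasFDerivAt hy) (h.hasFDerivAt_fderiv_apply hy v) (h.hasFDerivAt_fderiv_apply hy w)
  rw [← h.source.fderiv_apply₂ hy, (h2.congr_of_eventuallyEq h1).fderiv]
  simp

/-- The transformation law of the Christoffel symbols. -/
theorem christoffelCLM_eq (h : IsIsometryOn φ G G' U U') {y : Plane} (hy : y ∈ U)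
    (a b : Plane) :
    fderiv ℝ φ y (christoffelCLM G y a b)
      = fderiv ℝ (fderiv ℝ φ) y a b
        + christoffelCLM G' (φ y) (fderiv ℝ φ y a) (fderiv ℝ φ y b) := by
  refine (h.target.inner _ (h.mapsTo hy)).ext_right fun c => ?_
  obtain ⟨w, rfl⟩ := h.surjective hy c
  have hsymm := (h.target.inner _ (h.mapsTo hy)).symm
  have h1 := h.source.koszul hy a b w
  have h2 := h.target.koszul (h.mapsTo hy) (fderiv ℝ φ y a) (fderiv ℝ φ y b) (fderiv ℝ φ y w)
  rw [h.pullback y hy, h.fderiv_pullback hy, h.fderiv_pullback hy, h.fderiv_pullback hy,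
    h.fderiv_fderiv_symm hy w a, h.fderiv_fderiv_symm hy b a, h.fderiv_fderiv_symm hy w b,
    hsymm (fderiv ℝ φ y b) (fderiv ℝ (fderiv ℝ φ) y a w)] at h1
  rw [map_add, add_apply]
  linarith

/-- The Christoffel transformation law for fixed b and c, differentiated in the direction a. -/
theorem fderiv_christoffelCLM_eq (h : IsIsometryOn φ G G' U U') {y : Plane} (hy : y ∈ U)
    (a b c : Plane) :
    fderiv ℝ (fderiv ℝ φ) y a (christoffelCLM G y b c)
        + fderiv ℝ φ y (fderiv ℝ (christoffelCLM G) y a b c)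
      = fderiv ℝ (fderiv ℝ (fun z => fderiv ℝ φ z c)) y a b
        + fderiv ℝ (christoffelCLM G') (φ y) (fderiv ℝ φ y a) (fderiv ℝ φ y b) (fderiv ℝ φ y c)
        + christoffelCLM G' (φ y) (fderiv ℝ (fderiv ℝ φ) y a b) (fderiv ℝ φ y c)
        + christoffelCLM G' (φ y) (fderiv ℝ φ y b) (fderiv ℝ (fderiv ℝ φ) y a c) := by
  have hc : ContDiffOn ℝ ∞ (fun z => fderiv ℝ φ z c) U :=
    h.contDiffOn_fderiv.clm_apply contDiffOn_const
  have hc' : DifferentiableAt ℝ (fderiv ℝ (fun z => fderiv ℝ φ z c)) y :=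
    ((hc.fderiv_of_isOpen h.source.isOpen (m := ∞) (by simp)).contDiffAt
      (h.source.isOpen.mem_nhds hy)).differentiableAt (by simp)
  have h0 : HasFDerivAt (fun z => fderiv ℝ (fun z => fderiv ℝ φ z c) z b)
      ((fderiv ℝ (fderiv ℝ (fun z => fderiv ℝ φ z c)) y).flip b) y := by
    convert! hc'.hasFDerivAt.clm_apply (hasFDerivAt_const b y) using 1
    ext w; simp
  have h1 : (fun z => fderiv ℝ φ z (christoffelCLM G z b c))
      =ᶠ[nhds y] fun z => fderiv ℝ (fun z => fderiv ℝ φ z c) z b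
        + christoffelCLM G' (φ z) (fderiv ℝ φ z b) (fderiv ℝ φ z c) := by
    filter_upwards [h.source.isOpen.mem_nhds hy] with z hz
    rw [h.christoffelCLM_eq hz, (h.hasFDerivAt_fderiv_apply hz c).fderiv]
    simp
  have h2 := h0.add (((((h.target.hasFDerivAt_christoffelCLM (h.mapsTo hy)).comp y
    (h.hasFDerivAt hy)).clm_apply (h.hasFDerivAt_fderiv_apply hy b)).clm_apply
      (h.hasFDerivAt_fderiv_apply hy c)))
  have h3 := (h.hasFDerivAt_fderiv hy).clm_apply
    (h.source.hasFDerivAt_christoffelCLM_apply hy b c)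
  have h4 := congrArg (fun L : Plane →L[ℝ] Plane => L a)
    (h3.unique (h2.congr_of_eventuallyEq h1))
  simp at h4
  rw [add_comm, h4]
  abel

/-- Antisymmetrize the differentiated transformation law in a and b. The third derivative of φ and
the term Γ'(D²φ(a, b), ·) are symmetric and drop out; the other second-derivative terms cancel
against those produced by the quadratic part Γ(a, Γ(b, c)) - Γ(b, Γ(a, c)). -/
theorem curvatureVec_eq (h : IsIsometryOn φ G G' U U') {y : Plane} (hy : y ∈ U)
    (a b c : Plane) :
    fderiv ℝ φ y (curvatureVec G y a b c)
      = curvatureVec G' (φ y) (fderiv ℝ φ y a) (fderiv ℝ φ y b) (fderiv ℝ φ y c) := by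
  have hc : ContDiffOn ℝ ∞ (fun z => fderiv ℝ φ z c) U :=
    h.contDiffOn_fderiv.clm_apply contDiffOn_const
  have h3 := ((hc.contDiffAt (h.source.isOpen.mem_nhds hy)).isSymmSndFDerivAt minSmoothness_two_le_infty).eq a b
  have h1 := eq_sub_of_add_eq' (h.fderiv_christoffelCLM_eq hy a b c)
  have h2 := eq_sub_of_add_eq' (h.fderiv_christoffelCLM_eq hy b a c)
  rw [curvatureVec, map_sub, map_add, map_sub, h1, h2, h.christoffelCLM_eq hy a,
    h.christoffelCLM_eq hy b (christoffelCLM G y a c), h.christoffelCLM_eq hy b c,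
    h.christoffelCLM_eq hy a c, h3, h.fderiv_fderiv_symm hy b a, curvatureVec, map_add, map_add]
  abel

/-- The Gaussian curvature is invariant under isometries. -/
theorem coordGaussCurvature_eq (h : IsIsometryOn φ G G' U U') {y : Plane} (hy : y ∈ U) :
    coordGaussCurvature G y = coordGaussCurvature G' (φ y) := by
  have h1 := h.source.coordGaussCurvature_mul_det hy
  rw [h.pullback y hy, h.curvatureVec_eq hy, h.target.inner_curvatureVec (h.mapsTo hy),
    area_map, mul_pow, gram_det_pullback (h.pullback y hy)] at h1
  have hd := (h.target.inner _ (h.mapsTo hy)).det_pos.ne'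
  have hd' := h.det_ne_zero hy
  simp at h1
  refine mul_right_cancel₀ (mul_ne_zero hd (pow_ne_zero 2 hd')) ?_
  linear_combination h1

end IsIsometryOn

end MagneticSurface

/-! ### Divergence-free vector fields -/

theorem integral_fderiv_apply_eq_zero_of_hasCompactSupport {E : Type*} [NormedAddCommGroup E]
    [NormedSpace ℝ E] [FiniteDimensional ℝ E] [MeasurableSpace E] [BorelSpace E]
    (μ : Measure E) [μ.IsAddHaarMeasure] {f : E → ℝ} (hf : ContDiff ℝ 1 f)
    (hc : HasCompactSupport f) (v : E) : ∫ q, fderiv ℝ f q v ∂μ = 0 := by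
  have hi : Integrable (fun q => fderiv ℝ f q v) μ :=
    ((hf.continuous_fderiv (by simp)).clm_apply continuous_const).integrable_of_hasCompactSupport
      (hc.fderiv_apply (𝕜 := ℝ) v)
  have h := integral_mul_fderiv_eq_neg_fderiv_mul_of_integrable (μ := μ) (v := v)
    (f := fun _ : E => (1 : ℝ)) (g := f) (by simp) (by simpa using hi)
    (by simpa using hf.continuous.integrable_of_hasCompactSupport hc)
    (fun _ _ => differentiableAt_const _) (fun x _ => hf.differentiable (by simp) x)
  simpa using h

/-- Since div A = 0 on U, dh(A) = div(hA). The components of hA extend by zero to C¹ functions of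
compact support, although A itself is only controlled on U, and the integral of each partial
derivative vanishes. -/
theorem integral_fderiv_apply_eq_zero_of_div_eq_zero {E : Type*} [NormedAddCommGroup E]
    [NormedSpace ℝ E] [FiniteDimensional ℝ E] [MeasurableSpace E] [BorelSpace E]
    (μ : Measure E) [μ.IsAddHaarMeasure] {ι : Type*} [Fintype ι] (b : Module.Basis ι ℝ E)
    {U : Set E} (hU : IsOpen U) {A : E → E} (hA : ContDiffOn ℝ 1 A U)
    (hdiv : ∀ q ∈ U, ∑ i, b.repr (fderiv ℝ A q (b i)) i = 0)
    {h : E → ℝ} (hh : ContDiff ℝ 1 h) (hc : HasCompactSupport h) (hsub : tsupport h ⊆ U) :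
    ∫ q, fderiv ℝ h q (A q) ∂μ = 0 := by
  let c : ι → E →L[ℝ] ℝ := fun i => LinearMap.toContinuousLinearMap (b.coord i)
  have hsumc : ∀ x, x = ∑ i, c i x • b i := fun x => (b.sum_repr x).symm
  let f : ι → E → ℝ := fun i q => h q * c i (A q)
  have hAt : ∀ q ∈ tsupport h, ContDiffAt ℝ 1 A q := fun q hq =>
    hA.contDiffAt (hU.mem_nhds (hsub hq))
  have hf : ∀ i, ContDiff ℝ 1 (f i) := by
    intro i
    refine contDiff_iff_contDiffAt.2 fun q => ?_
    by_cases hq : q ∈ tsupport h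
    · exact hh.contDiffAt.mul ((c i).contDiff.contDiffAt.comp q (hAt q hq))
    · have h0 := notMem_tsupport_iff_eventuallyEq.1 hq
      refine contDiffAt_const (c := (0 : ℝ)) |>.congr_of_eventuallyEq ?_
      filter_upwards [h0] with z hz
      simp [f, hz]
  have hfc : ∀ i, HasCompactSupport (f i) := fun i => hc.mul_right
  have hd : ∀ q, fderiv ℝ h q (A q) = ∑ i, fderiv ℝ (f i) q (b i) := by
    intro q
    by_cases hq : q ∈ tsupport h
    · have hA' := ((hAt q hq).differentiableAt (by simp)).hasFDerivAt
      have hh' := (hh.differentiable (by simp) q).hasFDerivAt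
      have hfd : ∀ i, fderiv ℝ (f i) q (b i)
          = h q * c i (fderiv ℝ A q (b i)) + c i (A q) * fderiv ℝ h q (b i) := by
        intro i
        have := hh'.mul ((c i).hasFDerivAt.comp q hA')
        rw [show f i = h * (⇑(c i) ∘ A) from rfl, this.fderiv]
        simp
      simp only [hfd, Finset.sum_add_distrib, ← Finset.mul_sum]
      rw [show ∑ i, c i (fderiv ℝ A q (b i)) = 0 from hdiv q (hsub hq), mul_zero, zero_add]
      conv_lhs => rw [hsumc (A q)]
      simp [map_sum]
    · have h0 := notMem_tsupport_iff_eventuallyEq.1 hq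
      have h1 : ∀ i, f i =ᶠ[nhds q] fun _ => 0 := by
        intro i
        filter_upwards [h0] with z hz
        simp [f, hz]
      have h2 : ∀ i, fderiv ℝ (f i) q = 0 := fun i => by rw [(h1 i).fderiv_eq]; simp
      rw [h0.fderiv_eq]
      simp [h2]
  simp only [hd]
  rw [integral_finsetSum]
  · exact Finset.sum_eq_zero fun i _ =>
      integral_fderiv_apply_eq_zero_of_hasCompactSupport μ (hf i) (hfc i) (b i)
  · exact fun i _ => (((hf i).continuous_fderiv (by simp)).clm_apply
      continuous_const).integrable_of_hasCompactSupport ((hfc i).fderiv_apply (𝕜 := ℝ) (b i))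

/-! ### The coordinate magnetic field: zero divergence and conservation of length -/

namespace MagneticSurface

/-- Rotation by `π/2` as a linear map. -/
noncomputable def rotCLM (B : Plane →L[ℝ] Plane →L[ℝ] ℝ) : Plane →L[ℝ] Plane :=
  (Real.sqrt (gram B).det)⁻¹ • ((B.flip (basisVec 0)).smulRight (basisVec 1)
    - (B.flip (basisVec 1)).smulRight (basisVec 0))

theorem rotCLM_apply (B : Plane →L[ℝ] Plane →L[ℝ] ℝ) (v : Plane) : rotCLM B v = rot B v := by
  ext i
  fin_cases i <;> simp [rotCLM, rot]

/-- The magnetic vector field in the coordinates `(y, v)`, times the density `det g`; the rotational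
part is scaled by `|v|` so as to be homogeneous. -/
noncomputable def densityField (G : Plane → Plane →L[ℝ] Plane →L[ℝ] ℝ) (k : Plane → ℝ)
    (q : Plane × Plane) : Plane × Plane :=
  (gram (G q.1)).det • (q.2, -christoffelCLM G q.1 q.2 q.2
    + (k q.1 * Real.sqrt (G q.1 q.2 q.2)) • rotCLM (G q.1) q.2)

namespace IsMetricOn

variable {G : Plane → Plane →L[ℝ] Plane →L[ℝ] ℝ} {U : Set Plane}

theorem contDiffOn_rotCLM (h : IsMetricOn G U) : ContDiffOn ℝ ∞ (fun y => rotCLM (G y)) U := by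
  refine contDiffOn_clm_apply.2 fun a => ?_
  have hs : ContDiffOn ℝ ∞ (fun y => (Real.sqrt (gram (G y)).det)⁻¹) U :=
    (h.contDiffOn_det.sqrt fun y hy => (h.inner y hy).det_pos.ne').inv
      fun y hy => (h.inner y hy).sqrt_det_pos.ne'
  have hG : ∀ w : Plane, ContDiffOn ℝ ∞ (fun y => G y a w) U := fun w =>
    (h.smooth.clm_apply contDiffOn_const).clm_apply contDiffOn_const
  exact hs.smul (((hG (basisVec 0)).smul contDiffOn_const).sub
    ((hG (basisVec 1)).smul contDiffOn_const))

theorem isOpen_prod (h : IsMetricOn G U) : IsOpen (U ×ˢ ({0}ᶜ : Set Plane)) :=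
  h.isOpen.prod isOpen_compl_singleton

theorem contDiffOn_normSq (h : IsMetricOn G U) :
    ContDiffOn ℝ ∞ (fun q : Plane × Plane => G q.1 q.2 q.2) (U ×ˢ ({0}ᶜ : Set Plane)) :=
  ((h.smooth.comp contDiffOn_fst fun _ hq => hq.1).clm_apply contDiffOn_snd).clm_apply
    contDiffOn_snd

theorem contDiffOn_norm (h : IsMetricOn G U) :
    ContDiffOn ℝ ∞ (fun q : Plane × Plane => Real.sqrt (G q.1 q.2 q.2))
      (U ×ˢ ({0}ᶜ : Set Plane)) :=
  h.contDiffOn_normSq.sqrt fun q hq => ((h.inner q.1 hq.1).pos q.2 hq.2).ne'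

theorem contDiffOn_densityField (h : IsMetricOn G U) {k : Plane → ℝ}
    (hk : ContDiffOn ℝ ∞ k U) :
    ContDiffOn ℝ ∞ (densityField G k) (U ×ˢ ({0}ᶜ : Set Plane)) := by
  have hm : Set.MapsTo Prod.fst (U ×ˢ ({0}ᶜ : Set Plane)) U := fun _ hq => hq.1
  refine (h.contDiffOn_det.comp contDiffOn_fst hm).smul (contDiffOn_snd.prodMk ?_)
  exact (((h.contDiffOn_christoffelCLM.comp contDiffOn_fst hm).clm_apply
    contDiffOn_snd).clm_apply contDiffOn_snd).neg.add
    (((hk.comp contDiffOn_fst hm).mul h.contDiffOn_norm).smul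
      ((h.contDiffOn_rotCLM.comp contDiffOn_fst hm).clm_apply contDiffOn_snd))

/-- Jacobi's formula d log det g = 2 tr Γ, with the derivatives of the Gram matrix given by metric
compatibility. -/
theorem fderiv_det (h : IsMetricOn G U) {y : Plane} (hy : y ∈ U) (v : Plane) :
    fderiv ℝ (fun z => (gram (G z)).det) y v
      = 2 * (gram (G y)).det * ∑ k, christoffelCLM G y (basisVec k) v k := by
  have hg : ∀ i j : Fin 2, HasFDerivAt (fun z => gram (G z) i j)
      (fderiv ℝ (fun z => gram (G z) i j) y) y := fun i j =>
    (((h.contDiffOn_gram i j).contDiffAt (h.isOpen.mem_nhds hy)).differentiableAt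
      (by simp)).hasFDerivAt
  have hg' : ∀ i j : Fin 2, fderiv ℝ (fun z => gram (G z) i j) y v
      = G y (christoffelCLM G y v (basisVec i)) (basisVec j)
        + G y (basisVec i) (christoffelCLM G y v (basisVec j)) := fun i j => by
    rw [← h.fderiv_metric hy, ← h.fderiv_apply₂ hy]; rfl
  have hd := ((hg 0 0).mul (hg 1 1)).sub ((hg 0 1).mul (hg 1 0))
  have he : (fun z => (gram (G z)).det) = fun z => gram (G z) 0 0 * gram (G z) 1 1
      - gram (G z) 0 1 * gram (G z) 1 0 := by
    ext z; rw [Matrix.det_fin_two]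
  rw [he]
  have hd' : fderiv ℝ (fun z => gram (G z) 0 0 * gram (G z) 1 1
      - gram (G z) 0 1 * gram (G z) 1 0) y = _ := hd.fderiv
  rw [hd']
  simp only [sub_apply, add_apply, smul_apply, smul_eq_mul, hg', Fin.sum_univ_two,
    h.christoffelCLM_symm hy _ v, Matrix.det_fin_two]
  simp only [bilin_expand (G y) (christoffelCLM _ _ _ _),
    bilin_expand (G y) (basisVec _) (christoffelCLM _ _ _ _)]
  simp only [(h.inner y hy).gram_symm 1 0]
  simp
  ring

theorem hasFDerivAt_norm (h : IsMetricOn G U) {y v : Plane} (hy : y ∈ U) (hv : v ≠ 0) :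
    HasFDerivAt (fun w => Real.sqrt (G y w w)) ((Real.sqrt (G y v v))⁻¹ • G y v) v := by
  have hp := (h.inner y hy).pos v hv
  have h1 := ((G y).hasFDerivAt (x := v)).clm_apply (hasFDerivAt_id v)
  have h2 : HasFDerivAt (fun w => Real.sqrt (G y w w)) _ v := h1.sqrt hp.ne'
  convert! h2 using 1
  ext a
  simp [(h.inner y hy).symm a v]
  field_simp
  ring

/-- The base divergence of det g · v is 2 det g · tr Γ(·, v), and it cancels the fibre divergence of
-det g · Γ(v, v). In the magnetic term, the differential of |v| vanishes on Jv because Jv ⟂ v, and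
the rotation J has trace zero. -/
theorem sum_fderiv_densityField (h : IsMetricOn G U) {k : Plane → ℝ} (hk : ContDiffOn ℝ ∞ k U)
    {q : Plane × Plane} (hq : q ∈ U ×ˢ ({0}ᶜ : Set Plane)) :
    ∑ i, (fderiv ℝ (densityField G k) q (basisVec i, 0)).1 i
      + ∑ i, (fderiv ℝ (densityField G k) q (0, basisVec i)).2 i = 0 := by
  obtain ⟨y, v⟩ := q
  obtain ⟨hy, hv⟩ := hq
  have hA := (((h.contDiffOn_densityField hk).contDiffAt
    (h.isOpen_prod.mem_nhds ⟨hy, hv⟩)).differentiableAt (by simp)).hasFDerivAt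
  have hl : HasFDerivAt (fun z => densityField G k (z, v)) _ y :=
    HasFDerivAt.comp (g := densityField G k) (f := fun z => (z, v)) y hA
      (hasFDerivAt_prodMk_left y v)
  have hr : HasFDerivAt (fun w => densityField G k (y, w)) _ v :=
    HasFDerivAt.comp (g := densityField G k) (f := fun w => (y, w)) v hA
      (hasFDerivAt_prodMk_right y v)
  have h1 : HasFDerivAt (fun z => (densityField G k (z, v)).1)
      ((ContinuousLinearMap.fst ℝ Plane Plane).comp ((fderiv ℝ (densityField G k) (y, v)).comp
        (ContinuousLinearMap.inl ℝ Plane Plane))) y :=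
    hl.fst
  have h2 : HasFDerivAt (fun w => (densityField G k (y, w)).2)
      ((ContinuousLinearMap.snd ℝ Plane Plane).comp ((fderiv ℝ (densityField G k) (y, v)).comp
        (ContinuousLinearMap.inr ℝ Plane Plane))) v :=
    hr.snd
  have hdet : HasFDerivAt (fun z => (gram (G z)).det) (fderiv ℝ (fun z => (gram (G z)).det) y) y :=
    ((h.contDiffOn_det.contDiffAt (h.isOpen.mem_nhds hy)).differentiableAt (by simp)).hasFDerivAt
  have h1' : HasFDerivAt (fun z => (densityField G k (z, v)).1) _ y := hdet.smul_const v
  have h3 := ((christoffelCLM G y).hasFDerivAt (x := v)).clm_apply (hasFDerivAt_id v)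
  have h4 := ((h.hasFDerivAt_norm hy hv).const_mul (k y)).smul
    ((rotCLM (G y)).hasFDerivAt (x := v))
  have h2' : HasFDerivAt (fun w => (densityField G k (y, w)).2) _ v :=
    (h3.neg.add h4).const_smul (gram (G y)).det
  have e1 : ∀ i, (fderiv ℝ (densityField G k) (y, v) (basisVec i, 0)).1 i
      = fderiv ℝ (fun z => (gram (G z)).det) y (basisVec i) * v i := by
    intro i
    have := congrArg (fun L : Plane →L[ℝ] Plane => L (basisVec i) i) (h1.unique h1')
    simpa using this
  have e2 : ∀ i, (fderiv ℝ (densityField G k) (y, v) (0, basisVec i)).2 i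
      = (gram (G y)).det * (-2 * christoffelCLM G y (basisVec i) v i
        + k y * ((Real.sqrt (G y v v))⁻¹ * G y v (basisVec i) * rotCLM (G y) v i
          + Real.sqrt (G y v v) * rotCLM (G y) (basisVec i) i)) := by
    intro i
    have := congrArg (fun L : Plane →L[ℝ] Plane => L (basisVec i) i) (h2.unique h2')
    simp [h.christoffelCLM_symm hy v] at this
    rw [this]
    ring
  have hdv : ∑ i, fderiv ℝ (fun z => (gram (G z)).det) y (basisVec i) * v i
      = fderiv ℝ (fun z => (gram (G z)).det) y v := by
    conv_rhs => rw [eq_sum_basisVec v]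
    simp only [map_add, map_smul, smul_eq_mul, Fin.sum_univ_two]
    ring
  have hrot : ∑ i, G y v (basisVec i) * rotCLM (G y) v i = 0 := by
    have := (h.inner y hy).inner_rot_self v
    rw [(h.inner y hy).symm, ← rotCLM_apply] at this
    rw [← this]
    conv_rhs => rw [eq_sum_basisVec (rotCLM (G y) v)]
    simp only [map_add, map_smul, smul_eq_mul, Fin.sum_univ_two]
    ring
  have htr : ∑ i, rotCLM (G y) (basisVec i) i = 0 := by
    simp only [rotCLM_apply, rot, Fin.sum_univ_two]
    simp
    rw [(h.inner y hy).symm (basisVec 1)]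
    ring
  simp only [e1, e2, hdv]
  rw [h.fderiv_det hy]
  simp only [Fin.sum_univ_two] at hrot htr ⊢
  linear_combination (gram (G y)).det * k y * (Real.sqrt (G y v v))⁻¹ * hrot
    + (gram (G y)).det * k y * Real.sqrt (G y v v) * htr

/-- The density field preserves the length of vectors. -/
theorem fderiv_normSq_densityField (h : IsMetricOn G U) (k : Plane → ℝ)
    {q : Plane × Plane} (hq : q ∈ U ×ˢ ({0}ᶜ : Set Plane)) :
    fderiv ℝ (fun q : Plane × Plane => G q.1 q.2 q.2) q (densityField G k q) = 0 := by
  obtain ⟨y, v⟩ := q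
  obtain ⟨hy, hv⟩ := hq
  have h0 : HasFDerivAt (fun q : Plane × Plane => G q.1)
      ((fderiv ℝ G y).comp (ContinuousLinearMap.fst ℝ Plane Plane)) (y, v) :=
    HasFDerivAt.comp (E := Plane × Plane) (F := Plane) (G := Plane →L[ℝ] Plane →L[ℝ] ℝ) (g := G)
      (f := Prod.fst) (f' := ContinuousLinearMap.fst ℝ Plane Plane) (y, v)
      (h.differentiableAt hy).hasFDerivAt hasFDerivAt_fst
  have h1 : HasFDerivAt (fun q : Plane × Plane => G q.1 q.2) _ (y, v) :=
    HasFDerivAt.clm_apply (H := Plane →L[ℝ] ℝ) h0 hasFDerivAt_snd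
  have h2 : HasFDerivAt (fun q : Plane × Plane => G q.1 q.2 q.2) _ (y, v) :=
    h1.clm_apply hasFDerivAt_snd
  rw [h2.fderiv]
  have hr := (h.inner y hy).inner_rot_self v
  have hs := (h.inner y hy).symm
  have hm := h.fderiv_metric hy v v v
  rw [hs v] at hm
  rw [← rotCLM_apply] at hr
  simp [densityField, hs v (rotCLM _ _), hs v (christoffelCLM _ _ _ _), hr, hm]
  ring

theorem integral_fderiv_densityField (h : IsMetricOn G U) {k : Plane → ℝ}
    (hk : ContDiffOn ℝ ∞ k U) {f : Plane × Plane → ℝ} (hf : ContDiff ℝ 1 f)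
    (hc : HasCompactSupport f) (hsub : tsupport f ⊆ U ×ˢ ({0}ᶜ : Set Plane)) :
    ∫ q, fderiv ℝ f q (densityField G k q) ∂((volume : Measure Plane).prod volume) = 0 := by
  let b := (EuclideanSpace.basisFun (Fin 2) ℝ).toBasis
  refine integral_fderiv_apply_eq_zero_of_div_eq_zero _ (b.prod b) h.isOpen_prod
    ((h.contDiffOn_densityField hk).of_le (by simp)) (fun q hq => ?_) hf hc hsub
  have := h.sum_fderiv_densityField hk hq
  have hb : ∀ i, b i = basisVec i := by intro i; simp [b, basisVec]
  have hr : ∀ (v : Plane) i, b.repr v i = v i := by intro v i; simp [b]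
  simpa [Fintype.sum_sum_type, hb, hr] using this

end IsMetricOn

end MagneticSurface

set_option linter.unusedSectionVars false

namespace MagneticSurface

/-! ### Coordinates on the tangent bundle -/

variable {M : Type*} [TopologicalSpace M] [ChartedSpace Plane M]

/-- The coordinates of a tangent vector in the preferred chart at its base point. -/
def fiberVec (p : TangentBundle (𝓡 2) M) : Plane := p.snd

/-- The coordinates `(y, v)` on the tangent bundle induced by a chart. -/
noncomputable def tangentParam (e : OpenPartialHomeomorph M Plane) (q : Plane × Plane) :
    TangentBundle (𝓡 2) M :=
  ⟨e.symm q.1, (mfderiv 𝓘(ℝ, Plane) (𝓡 2) e.symm q.1 :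
    Plane →L[ℝ] TangentSpace (𝓡 2) (e.symm q.1)) q.2⟩

/-- The coordinate change between two charts. -/
noncomputable def transition (e e' : OpenPartialHomeomorph M Plane) : Plane → Plane :=
  fun y => e' (e.symm y)

/-- The coordinate change between the coordinates on the tangent bundle induced by two charts. -/
noncomputable def tangentTransition (e e' : OpenPartialHomeomorph M Plane) (q : Plane × Plane) :
    Plane × Plane :=
  (transition e e' q.1, fderiv ℝ (transition e e') q.1 q.2)

theorem mem_transition_source {e e' : OpenPartialHomeomorph M Plane} {y : Plane} :
    y ∈ (e.symm ≫ₕ e').source ↔ y ∈ e.target ∧ e.symm y ∈ e'.source := by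
  simp

theorem transition_symm_apply {e e' : OpenPartialHomeomorph M Plane} {y : Plane}
    (hy : y ∈ (e.symm ≫ₕ e').source) : e'.symm (transition e e' y) = e.symm y :=
  e'.left_inv (mem_transition_source.1 hy).2

theorem mapsTo_transition (e e' : OpenPartialHomeomorph M Plane) :
    Set.MapsTo (transition e e') (e.symm ≫ₕ e').source e'.target :=
  fun _ hy => e'.map_source (mem_transition_source.1 hy).2

variable [IsManifold (𝓡 2) ∞ M]

theorem mem_maximalAtlas {e : OpenPartialHomeomorph M Plane} (he : e ∈ atlas Plane M) :
    e ∈ IsManifold.maximalAtlas (𝓡 2) ∞ M := IsManifold.subset_maximalAtlas he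

theorem contMDiffOn_chart_symm {e : OpenPartialHomeomorph M Plane} (he : e ∈ atlas Plane M) :
    ContMDiffOn 𝓘(ℝ, Plane) (𝓡 2) ∞ e.symm e.target :=
  contMDiffOn_symm_of_mem_maximalAtlas (mem_maximalAtlas he)

theorem mdifferentiableAt_chart_symm {e : OpenPartialHomeomorph M Plane} (he : e ∈ atlas Plane M)
    {y : Plane} (hy : y ∈ e.target) : MDifferentiableAt 𝓘(ℝ, Plane) (𝓡 2) e.symm y :=
  ((contMDiffOn_chart_symm he).contMDiffAt (e.open_target.mem_nhds hy)).mdifferentiableAt (by simp)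

theorem contDiffOn_transition {e e' : OpenPartialHomeomorph M Plane} (he : e ∈ atlas Plane M)
    (he' : e' ∈ atlas Plane M) : ContDiffOn ℝ ∞ (transition e e') (e.symm ≫ₕ e').source := by
  have h1 := (contMDiffOn_of_mem_maximalAtlas (mem_maximalAtlas he')).comp
    ((contMDiffOn_chart_symm he).mono (fun y hy => (mem_transition_source.1 hy).1))
    (fun y hy => (mem_transition_source.1 hy).2)
  exact h1.contDiffOn

/-- The tangent space at a point is read in the preferred chart there, so the manifold derivative of
an inverse chart is an ordinary Jacobian of a coordinate change. -/
theorem mfderiv_chart_symm {e : OpenPartialHomeomorph M Plane} (he : e ∈ atlas Plane M)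
    {y : Plane} (hy : y ∈ e.target) :
    (mfderiv 𝓘(ℝ, Plane) (𝓡 2) e.symm y : Plane →L[ℝ] Plane)
      = fderiv ℝ (transition e (chartAt Plane (e.symm y))) y := by
  refine (mdifferentiableAt_chart_symm he hy).mfderiv.trans ?_
  simp only [writtenInExtChartAt, mfld_simps]
  rw [fderivWithin_univ]
  rfl

/-- Every fibre is definitionally the same plane, so equality of tangent vectors over
propositionally equal base points can be checked componentwise, with no transport. -/
theorem tangentBundle_mk_eq {x x' : M} {v v' : Plane} (hx : x = x') (hv : v = v') :
    (⟨x, v⟩ : TangentBundle (𝓡 2) M) = ⟨x', v'⟩ := by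
  subst hx hv; rfl

theorem tangentParam_eq {e : OpenPartialHomeomorph M Plane} (he : e ∈ atlas Plane M)
    {y : Plane} (hy : y ∈ e.target) (v : Plane) :
    tangentParam e (y, v)
      = ⟨e.symm y, fderiv ℝ (transition e (chartAt Plane (e.symm y))) y v⟩ :=
  tangentBundle_mk_eq rfl (congrArg (fun L : Plane →L[ℝ] Plane => L v) (mfderiv_chart_symm he hy))

theorem extChartAt_tangent_self (p : TangentBundle (𝓡 2) M) :
    extChartAt (𝓡 2).tangent p p = (chartAt Plane p.proj p.proj, fiberVec p) := by
  have h : tangentCoordChange (𝓡 2) p.proj p.proj p.proj p.snd = p.snd :=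
    tangentCoordChange_self (mem_extChartAt_source p.proj)
  exact Prod.ext rfl h

theorem extChartAt_tangent_symm (p : TangentBundle (𝓡 2) M) {y : Plane}
    (hy : y ∈ (chartAt Plane p.proj).target) (v : Plane) :
    (extChartAt (𝓡 2).tangent p).symm (y, v) = tangentParam (chartAt Plane p.proj) (y, v) := by
  rw [tangentParam_eq (chart_mem_atlas _ _) hy]
  refine tangentBundle_mk_eq rfl ?_
  change tangentCoordChange (𝓡 2) p.proj ((chartAt Plane p.proj).symm y)
    ((chartAt Plane p.proj).symm y) v = _
  rw [tangentCoordChange_def]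
  simp only [mfld_simps]
  rw [fderivWithin_univ, (chartAt Plane p.proj).right_inv hy]
  rfl

theorem extChartAt_tangent_target (p : TangentBundle (𝓡 2) M) :
    (extChartAt (𝓡 2).tangent p).target = (chartAt Plane p.proj).target ×ˢ Set.univ := by
  ext q
  have := TangentBundle.mem_chart_target_iff (I := 𝓡 2) q p
  simp [extChartAt]
  exact this

/-- The chain rule for coordinate changes, applied with the preferred chart at the common base point
as the final chart. -/
theorem tangentParam_transition {e e' : OpenPartialHomeomorph M Plane} (he : e ∈ atlas Plane M)
    (he' : e' ∈ atlas Plane M) {y : Plane} (hy : y ∈ (e.symm ≫ₕ e').source) (v : Plane) :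
    tangentParam e' (tangentTransition e e' (y, v)) = tangentParam e (y, v) := by
  have hx := transition_symm_apply hy
  have hU := (e.symm ≫ₕ e').open_source.mem_nhds hy
  have hy1 := (mem_transition_source.1 hy).1
  have hy2 := mapsTo_transition e e' hy
  rw [tangentParam_eq he hy1, tangentTransition, tangentParam_eq he' hy2]
  refine tangentBundle_mk_eq hx ?_
  simp only
  rw [hx]
  set c := chartAt Plane (e.symm y)
  have hc : c ∈ atlas Plane M := chart_mem_atlas _ _
  have h1 : HasFDerivAt (transition e e') _ y :=
    (((contDiffOn_transition he he').contDiffAt hU).differentiableAt (by simp)).hasFDerivAt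
  have hz : transition e e' y ∈ (e'.symm ≫ₕ c).source :=
    mem_transition_source.2 ⟨hy2, by rw [hx]; exact mem_chart_source _ _⟩
  have h2 : HasFDerivAt (transition e' c) _ (transition e e' y) :=
    (((contDiffOn_transition he' hc).contDiffAt
      ((e'.symm ≫ₕ c).open_source.mem_nhds hz)).differentiableAt (by simp)).hasFDerivAt
  have h3 := h2.comp y h1
  have h4 : transition e c =ᶠ[nhds y] transition e' c ∘ transition e e' := by
    filter_upwards [hU] with z hz
    simp [transition, e'.left_inv (mem_transition_source.1 hz).2]
  rw [(h3.congr_of_eventuallyEq h4).fderiv]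
  rfl

theorem transition_chartAt_self {e : OpenPartialHomeomorph M Plane} {y : Plane}
    (hy : y ∈ e.target) : y ∈ (e.symm ≫ₕ chartAt Plane (e.symm y)).source :=
  mem_transition_source.2 ⟨hy, mem_chart_source _ _⟩

theorem tangentParam_chartAt (p : TangentBundle (𝓡 2) M) :
    tangentParam (chartAt Plane p.proj) (chartAt Plane p.proj p.proj, fiberVec p) = p := by
  rw [← extChartAt_tangent_symm p (mem_chart_target _ _), ← extChartAt_tangent_self]
  exact extChartAt_to_inv p

theorem exists_tangentParam_eq {e : OpenPartialHomeomorph M Plane} (he : e ∈ atlas Plane M)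
    (p : TangentBundle (𝓡 2) M) (hp : p.proj ∈ e.source) :
    ∃ v, tangentParam e (e p.proj, v) = p := by
  have hy : chartAt Plane p.proj p.proj ∈ ((chartAt Plane p.proj).symm ≫ₕ e).source :=
    mem_transition_source.2 ⟨mem_chart_target _ _, by simpa using hp⟩
  have h := tangentParam_transition (chart_mem_atlas _ _) he hy (fiberVec p)
  rw [tangentParam_chartAt] at h
  set q := tangentTransition (chartAt Plane p.proj) e
    (chartAt Plane p.proj p.proj, fiberVec p) with hq
  have h0 : (e p.proj, q.2) = q := Prod.ext (by simp [hq, tangentTransition, transition]) rfl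
  exact ⟨q.2, by rw [h0, h]⟩

theorem contMDiffOn_tangentParam {e : OpenPartialHomeomorph M Plane} (he : e ∈ atlas Plane M) :
    ContMDiffOn 𝓘(ℝ, Plane × Plane) (𝓡 2).tangent ∞ (tangentParam e) (e.target ×ˢ Set.univ) := by
  intro q hq
  refine ContMDiffAt.contMDiffWithinAt ?_
  obtain ⟨y, v⟩ := q
  have hy : y ∈ e.target := hq.1
  set c := chartAt Plane (e.symm y) with hc
  have hU := transition_chartAt_self hy
  set p := tangentParam e (y, v) with hp
  have hΦ : ContDiffOn ℝ ∞ (tangentTransition e c) ((e.symm ≫ₕ c).source ×ˢ Set.univ) := by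
    have h1 := contDiffOn_transition he (chart_mem_atlas Plane (e.symm y))
    have h2 : ContDiffOn ℝ ∞ (fderiv ℝ (transition e c)) (e.symm ≫ₕ c).source :=
      h1.fderiv_of_isOpen (e.symm ≫ₕ c).open_source (by simp)
    exact (h1.comp contDiffOn_fst (fun _ h => h.1)).prodMk
      ((h2.comp contDiffOn_fst (fun _ h => h.1)).clm_apply contDiffOn_snd)
  have hnhds : (e.symm ≫ₕ c).source ×ˢ (Set.univ : Set Plane) ∈ nhds (y, v) :=
    ((e.symm ≫ₕ c).open_source.prod isOpen_univ).mem_nhds ⟨hU, trivial⟩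
  have h1 : ContMDiffAt 𝓘(ℝ, Plane × Plane) 𝓘(ℝ, Plane × Plane) ∞ (tangentTransition e c) (y, v) :=
    (hΦ.contDiffAt hnhds).contMDiffAt
  have htgt : tangentTransition e c (y, v) ∈ (extChartAt (𝓡 2).tangent p).target := by
    rw [extChartAt_tangent_target]
    exact ⟨mapsTo_transition e c hU, trivial⟩
  have h2 : ContMDiffAt 𝓘(ℝ, Plane × Plane) (𝓡 2).tangent ∞ (extChartAt (𝓡 2).tangent p).symm
      (tangentTransition e c (y, v)) :=
    (contMDiffOn_extChartAt_symm p).contMDiffAt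
      ((isOpen_extChartAt_target p).mem_nhds htgt)
  refine (h2.comp (y, v) h1).congr_of_eventuallyEq ?_
  filter_upwards [hnhds] with z hz
  rw [Function.comp_apply]
  have := extChartAt_tangent_symm p (mapsTo_transition e c hz.1) (tangentTransition e c z).2
  exact (this.trans (tangentParam_transition he (chart_mem_atlas _ _) hz.1 z.2)).symm

end MagneticSurface

namespace MagneticSurface

/-! ### The metric and the frame in coordinates -/

variable {M : Type*} [TopologicalSpace M] [ChartedSpace Plane M] [IsManifold (𝓡 2) ∞ M]

/-- The function `(x, v) ↦ g(v, v)` on the tangent bundle. -/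
noncomputable def normSq (g : Metric M) (p : TangentBundle (𝓡 2) M) : ℝ :=
  g.inner p.proj p.snd p.snd

theorem contMDiff_normSq (g : Metric M) :
    ContMDiff (𝓡 2).tangent 𝓘(ℝ, ℝ) ∞ (normSq g) := by
  have hb : ContMDiff (𝓡 2).tangent (𝓡 2) ∞ (fun p : TangentBundle (𝓡 2) M => p.proj) :=
    contMDiff_proj _
  have hid : ContMDiff (𝓡 2).tangent (𝓡 2).tangent ∞
      (fun p : TangentBundle (𝓡 2) M => TotalSpace.mk' Plane p.proj p.snd) := contMDiff_id
  intro p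
  have : ContMDiffAt (𝓡 2).tangent ((𝓡 2).prod 𝓘(ℝ)) ∞
      (fun p : TangentBundle (𝓡 2) M =>
        TotalSpace.mk' ℝ (E := Bundle.Trivial M ℝ) p.proj (g.inner p.proj p.snd p.snd)) p := by
    apply ContMDiffAt.clm_bundle_apply₂ (F₁ := Plane) (F₂ := Plane)
    · exact ContMDiffAt.comp p g.contMDiff.contMDiffAt hb.contMDiffAt
    · exact hid.contMDiffAt
    · exact hid.contMDiffAt
  simp only [contMDiffAt_totalSpace] at this
  exact this.2

theorem continuous_normSq (g : Metric M) : Continuous (normSq g) := (contMDiff_normSq g).continuous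

theorem coordMetric_self (g : Metric M) (e : OpenPartialHomeomorph M Plane) (y v : Plane) :
    coordMetric g e y v v = normSq g (tangentParam e (y, v)) := rfl

theorem coordMetric_symm (g : Metric M) (e : OpenPartialHomeomorph M Plane) (y v w : Plane) :
    coordMetric g e y v w = coordMetric g e y w v := g.symm _ _ _

/-- Reduces the coordinate metric to the single function `normSq` on the total space. Smoothness in
a chart and compatibility between charts then follow from the corresponding properties of
`tangentParam`. -/
theorem coordMetric_polarization (g : Metric M) (e : OpenPartialHomeomorph M Plane)
    (y v w : Plane) : coordMetric g e y v w
      = (normSq g (tangentParam e (y, v + w)) - normSq g (tangentParam e (y, v))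
        - normSq g (tangentParam e (y, w))) / 2 := by
  rw [← coordMetric_self, ← coordMetric_self, ← coordMetric_self, map_add, map_add, add_apply,
    add_apply, coordMetric_symm g e y w v]
  ring

theorem contDiffOn_normSq_tangentParam (g : Metric M) {e : OpenPartialHomeomorph M Plane}
    (he : e ∈ atlas Plane M) :
    ContDiffOn ℝ ∞ (fun q => normSq g (tangentParam e q)) (e.target ×ˢ Set.univ) :=
  ((contMDiff_normSq g).comp_contMDiffOn (contMDiffOn_tangentParam he)).contDiffOn

theorem isMetricOn_coordMetric (g : Metric M) {e : OpenPartialHomeomorph M Plane}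
    (he : e ∈ atlas Plane M) : IsMetricOn (coordMetric g e) e.target where
  isOpen := e.open_target
  smooth := by
    refine contDiffOn_clm_apply.2 fun v => contDiffOn_clm_apply.2 fun w => ?_
    simp only [coordMetric_polarization]
    have h : ∀ v : Plane, ContDiffOn ℝ ∞ (fun y => normSq g (tangentParam e (y, v))) e.target :=
      fun v => (contDiffOn_normSq_tangentParam g he).comp (contDiffOn_id.prodMk contDiffOn_const)
        fun y hy => ⟨hy, trivial⟩
    exact (((h _).sub (h _)).sub (h _)).div_const 2
  inner := fun y hy => by
    refine ⟨coordMetric_symm g e y, fun v hv => g.pos _ _ fun h0 => hv ?_⟩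
    -- The derivative of the chart inverts that of its inverse, so a coordinate vector representing
    -- the zero tangent vector is zero.
    have h1 := (mdifferentiable_of_mem_atlas (I := 𝓡 2) he).comp_symm_deriv hy
    have h2 := congrArg (fun L : Plane →L[ℝ] Plane => L v) h1
    refine h2.symm.trans ?_
    refine (congrArg (mfderiv (𝓡 2) (𝓡 2) e (e.symm y)) h0).trans ?_
    exact map_zero _

theorem normSq_pos_iff (g : Metric M) (p : TangentBundle (𝓡 2) M) :
    0 < normSq g p ↔ p.snd ≠ 0 := by
  refine ⟨fun h h0 => ?_, g.pos _ _⟩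
  rw [normSq, h0] at h
  simp at h

theorem isOpen_snd_ne_zero (g : Metric M) : IsOpen {p : TangentBundle (𝓡 2) M | p.snd ≠ 0} := by
  simp only [← normSq_pos_iff g]
  exact isOpen_lt continuous_const (continuous_normSq g)

theorem tangentParam_snd_ne_zero (g : Metric M) {e : OpenPartialHomeomorph M Plane}
    (he : e ∈ atlas Plane M) {y v : Plane} (hy : y ∈ e.target) :
    (tangentParam e (y, v)).snd ≠ 0 ↔ v ≠ 0 := by
  rw [← normSq_pos_iff g, ← coordMetric_self]
  refine ⟨fun h h0 => ?_, ((isMetricOn_coordMetric g he).inner y hy).pos v⟩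
  simp [h0] at h

theorem isIsometryOn_transition (g : Metric M) {e e' : OpenPartialHomeomorph M Plane}
    (he : e ∈ atlas Plane M) (he' : e' ∈ atlas Plane M) :
    IsIsometryOn (transition e e') (coordMetric g e) (coordMetric g e')
      (e.symm ≫ₕ e').source e'.target where
  source :=
    ⟨(e.symm ≫ₕ e').open_source,
      (isMetricOn_coordMetric g he).smooth.mono fun _ hy => (mem_transition_source.1 hy).1,
      fun y hy => (isMetricOn_coordMetric g he).inner y (mem_transition_source.1 hy).1⟩
  target := isMetricOn_coordMetric g he'
  contDiffOn := contDiffOn_transition he he'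
  mapsTo := mapsTo_transition e e'
  pullback := fun y hy v w => by
    rw [coordMetric_polarization, coordMetric_polarization, ← map_add]
    have h := fun v => tangentParam_transition he he' hy v
    simp only [tangentTransition] at h
    simp only [h]

theorem det_fderiv_transition_pos (hM : IsOrientedAtlas M) {e e' : OpenPartialHomeomorph M Plane}
    (he : e ∈ atlas Plane M) (he' : e' ∈ atlas Plane M) {y : Plane}
    (hy : y ∈ (e.symm ≫ₕ e').source) : 0 < (fderiv ℝ (transition e e') y).det :=
  hM e he e' he' y hy

theorem hasFDerivAt_tangentTransition (g : Metric M) {e e' : OpenPartialHomeomorph M Plane}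
    (he : e ∈ atlas Plane M) (he' : e' ∈ atlas Plane M) {y : Plane}
    (hy : y ∈ (e.symm ≫ₕ e').source) (v : Plane) :
    HasFDerivAt (tangentTransition e e')
      (((fderiv ℝ (transition e e') y).comp (ContinuousLinearMap.fst ℝ Plane Plane)).prod
        (((fderiv ℝ (fderiv ℝ (transition e e')) y).flip v).comp
          (ContinuousLinearMap.fst ℝ Plane Plane)
          + (fderiv ℝ (transition e e') y).comp (ContinuousLinearMap.snd ℝ Plane Plane))) (y, v) := by
  have h := isIsometryOn_transition g he he'
  have h1 : HasFDerivAt (fun q : Plane × Plane => transition e e' q.1) _ (y, v) :=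
    HasFDerivAt.comp (E := Plane × Plane) (f := Prod.fst) (y, v) (h.hasFDerivAt hy)
      hasFDerivAt_fst
  have h2 : HasFDerivAt (fun q : Plane × Plane => fderiv ℝ (transition e e') q.1) _ (y, v) :=
    HasFDerivAt.comp (E := Plane × Plane) (F := Plane) (G := Plane →L[ℝ] Plane)
      (g := fderiv ℝ (transition e e')) (f := Prod.fst)
      (f' := ContinuousLinearMap.fst ℝ Plane Plane) (y, v) (h.hasFDerivAt_fderiv hy)
      hasFDerivAt_fst
  have h3 : HasFDerivAt (fun q : Plane × Plane => fderiv ℝ (transition e e') q.1 q.2) _ (y, v) :=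
    h2.clm_apply hasFDerivAt_snd
  convert! h1.prodMk h3 using 1
  ext a <;> simp

/-- The argument is a horizontal lift of a plus a vertical vector b. The second derivative of the
coordinate change is absorbed by the inhomogeneous term of the Christoffel law, so horizontal lifts
go to horizontal lifts and b transforms as a tangent vector. This handles the magnetic and the
horizontal field together. -/
theorem fderiv_tangentTransition_apply (g : Metric M) {e e' : OpenPartialHomeomorph M Plane}
    (he : e ∈ atlas Plane M) (he' : e' ∈ atlas Plane M) {y : Plane}
    (hy : y ∈ (e.symm ≫ₕ e').source) (v a b : Plane) :
    fderiv ℝ (tangentTransition e e') (y, v) (a, -christoffelCLM (coordMetric g e) y a v + b)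
      = (fderiv ℝ (transition e e') y a,
        -christoffelCLM (coordMetric g e') (transition e e' y) (fderiv ℝ (transition e e') y a)
          (fderiv ℝ (transition e e') y v) + fderiv ℝ (transition e e') y b) := by
  rw [(hasFDerivAt_tangentTransition g he he' hy v).fderiv]
  refine Prod.ext (by simp) ?_
  simp [(isIsometryOn_transition g he he').christoffelCLM_eq hy]
  abel

/-- The manifold derivative lives in the chart of TM attached to the preferred chart at the base
point; composing with the coordinate change into that chart passes to e. The name L lets it be used
as a map on a fixed product of planes. -/
theorem hasFDerivAt_comp_tangentParam (g : Metric M) {W : Type*} [NormedAddCommGroup W]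
    [NormedSpace ℝ W] {e : OpenPartialHomeomorph M Plane} (he : e ∈ atlas Plane M) {y v : Plane}
    (hy : y ∈ e.target) {f : TangentBundle (𝓡 2) M → W}
    (hf : MDifferentiableAt (𝓡 2).tangent 𝓘(ℝ, W) f (tangentParam e (y, v)))
    {L : Plane × Plane →L[ℝ] W}
    (hL : L = mfderiv (𝓡 2).tangent 𝓘(ℝ, W) f (tangentParam e (y, v))) :
    HasFDerivAt (fun q => f (tangentParam e q))
      (L.comp (fderiv ℝ (tangentTransition e (chartAt Plane (e.symm y))) (y, v))) (y, v) := by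
  set p := tangentParam e (y, v) with hp
  set c := chartAt Plane (e.symm y) with hc
  have hU := transition_chartAt_self hy
  have h1 : HasFDerivWithinAt (writtenInExtChartAt (𝓡 2).tangent 𝓘(ℝ, W) p f) L
      (Set.range (𝓡 2).tangent) (extChartAt (𝓡 2).tangent p p) := by
    subst hL; exact hf.hasMFDerivAt.2
  rw [ModelWithCorners.range_eq_univ, hasFDerivWithinAt_univ] at h1
  have h2 : extChartAt (𝓡 2).tangent p p = tangentTransition e c (y, v) := by
    rw [extChartAt_tangent_self, hp, tangentParam_eq he hy]
    rfl
  rw [h2] at h1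
  have h3 := (hasFDerivAt_tangentTransition g he (chart_mem_atlas Plane (e.symm y)) hU
    v).differentiableAt.hasFDerivAt
  refine (h1.comp (y, v) h3).congr_of_eventuallyEq ?_
  have hnhds : (e.symm ≫ₕ c).source ×ˢ (Set.univ : Set Plane) ∈ nhds (y, v) :=
    ((e.symm ≫ₕ c).open_source.prod isOpen_univ).mem_nhds ⟨hU, trivial⟩
  filter_upwards [hnhds] with z hz
  have h4 := extChartAt_tangent_symm p (mapsTo_transition e c hz.1) (tangentTransition e c z).2
  have h5 := h4.trans (tangentParam_transition he (chart_mem_atlas _ _) hz.1 z.2)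
  change f (tangentParam e z) = f ((extChartAt (𝓡 2).tangent p).symm (tangentTransition e c z))
  exact congrArg f h5.symm

theorem fiberVec_tangentParam {e : OpenPartialHomeomorph M Plane} (he : e ∈ atlas Plane M)
    {y : Plane} (hy : y ∈ e.target) (v : Plane) :
    fiberVec (tangentParam e (y, v)) = fderiv ℝ (transition e (chartAt Plane (e.symm y))) y v :=
  congrArg (fun L : Plane →L[ℝ] Plane => L v) (mfderiv_chart_symm he hy)

theorem fderiv_transition_rotCLM (hM : IsOrientedAtlas M) (g : Metric M)
    {e e' : OpenPartialHomeomorph M Plane} (he : e ∈ atlas Plane M) (he' : e' ∈ atlas Plane M)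
    {y : Plane} (hy : y ∈ (e.symm ≫ₕ e').source) (v : Plane) :
    fderiv ℝ (transition e e') y (rotCLM (coordMetric g e y) v)
      = rotCLM (coordMetric g e' (transition e e' y)) (fderiv ℝ (transition e e') y v) := by
  have h := isIsometryOn_transition g he he'
  rw [rotCLM_apply, rotCLM_apply, rot_pullback (h.source.inner y hy)
    (h.target.inner _ (h.mapsTo hy)) (h.pullback y hy) (det_fderiv_transition_pos hM he he' hy)]

/-- The magnetic vector field in the coordinates given by a chart. -/
noncomputable def coordMagneticField (g : Metric M) (κ : M → ℝ)
    (e : OpenPartialHomeomorph M Plane) (q : Plane × Plane) : Plane × Plane :=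
  (q.2, -christoffelCLM (coordMetric g e) q.1 q.2 q.2
    + κ (e.symm q.1) • rotCLM (coordMetric g e q.1) q.2)

/-- The horizontal vector field in the coordinates given by a chart. -/
noncomputable def coordHorizontalField (g : Metric M)
    (e : OpenPartialHomeomorph M Plane) (q : Plane × Plane) : Plane × Plane :=
  (rotCLM (coordMetric g e q.1) q.2,
    -christoffelCLM (coordMetric g e) q.1 (rotCLM (coordMetric g e q.1) q.2) q.2)

theorem magneticField_eq (g : Metric M) (κ : M → ℝ) (p : TangentBundle (𝓡 2) M) :
    (magneticField g κ p : Plane × Plane) = coordMagneticField g κ (chartAt Plane p.proj)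
      (chartAt Plane p.proj p.proj, fiberVec p) := by
  rw [coordMagneticField, christoffelCLM_apply, rotCLM_apply,
    (chartAt Plane p.proj).left_inv (mem_chart_source _ _)]
  refine Prod.ext ?_ rfl
  change fiberVec p + κ p.proj • (0 : Plane) = _
  rw [smul_zero, add_zero]

theorem horizontalField_eq (g : Metric M) (p : TangentBundle (𝓡 2) M) :
    (horizontalField g p : Plane × Plane) = coordHorizontalField g (chartAt Plane p.proj)
      (chartAt Plane p.proj p.proj, fiberVec p) := by
  rw [coordHorizontalField, christoffelCLM_apply, rotCLM_apply]
  rfl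

theorem magneticField_tangentParam (hM : IsOrientedAtlas M) (g : Metric M) (κ : M → ℝ)
    {e : OpenPartialHomeomorph M Plane} (he : e ∈ atlas Plane M) {y : Plane} (hy : y ∈ e.target)
    (v : Plane) :
    (magneticField g κ (tangentParam e (y, v)) : Plane × Plane)
      = fderiv ℝ (tangentTransition e (chartAt Plane (e.symm y))) (y, v)
        (coordMagneticField g κ e (y, v)) := by
  have hU := transition_chartAt_self hy
  have h2 := fderiv_tangentTransition_apply g he (chart_mem_atlas _ _) hU v v
    (κ (e.symm y) • rotCLM (coordMetric g e y) v)
  rw [map_smul, fderiv_transition_rotCLM hM g he (chart_mem_atlas _ _) hU] at h2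
  rw [magneticField_eq, fiberVec_tangentParam he hy]
  refine Eq.trans ?_ h2.symm
  rw [coordMagneticField, (chartAt Plane (tangentParam e (y, v)).proj).left_inv
    (mem_chart_source _ _)]
  rfl

theorem horizontalField_tangentParam (hM : IsOrientedAtlas M) (g : Metric M)
    {e : OpenPartialHomeomorph M Plane} (he : e ∈ atlas Plane M) {y : Plane} (hy : y ∈ e.target)
    (v : Plane) :
    (horizontalField g (tangentParam e (y, v)) : Plane × Plane)
      = fderiv ℝ (tangentTransition e (chartAt Plane (e.symm y))) (y, v)
        (coordHorizontalField g e (y, v)) := by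
  have hU := transition_chartAt_self hy
  have h2 := fderiv_tangentTransition_apply g he (chart_mem_atlas _ _) hU v
    (rotCLM (coordMetric g e y) v) 0
  rw [add_zero, map_zero, add_zero, fderiv_transition_rotCLM hM g he (chart_mem_atlas _ _) hU]
    at h2
  rw [horizontalField_eq, fiberVec_tangentParam he hy]
  exact h2.symm

theorem gaussCurvature_eq (g : Metric M)
    {e : OpenPartialHomeomorph M Plane} (he : e ∈ atlas Plane M) {y : Plane} (hy : y ∈ e.target) :
    gaussCurvature g (e.symm y) = coordGaussCurvature (coordMetric g e) y :=
  ((isIsometryOn_transition g he (chart_mem_atlas Plane (e.symm y))).coordGaussCurvature_eq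
    (transition_chartAt_self hy)).symm

/-- The definition uses a chart that varies with the point. Isometry invariance permits freezing one
chart near x, where the coordinate curvature is smooth. -/
theorem continuous_gaussCurvature (g : Metric M) : Continuous (gaussCurvature g) := by
  refine continuous_iff_continuousAt.2 fun x => ?_
  have he := chart_mem_atlas Plane x
  set e := chartAt Plane x
  have h1 : ContinuousAt (fun z => coordGaussCurvature (coordMetric g e) (e z)) x :=
    ContinuousAt.comp (f := e) (((isMetricOn_coordMetric g he).contDiffOn_coordGaussCurvature.contDiffAt
      (e.open_target.mem_nhds (mem_chart_target _ _))).continuousAt)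
      (e.continuousAt (mem_chart_source _ _))
  refine h1.congr ?_
  filter_upwards [e.open_source.mem_nhds (mem_chart_source _ _)] with z hz
  rw [← gaussCurvature_eq g he (e.map_source hz), e.left_inv hz]

end MagneticSurface

namespace MagneticSurface

/-! ### Functions on the unit tangent bundle -/

variable {M : Type*} [TopologicalSpace M] [ChartedSpace Plane M] [IsManifold (𝓡 2) ∞ M]
  {W : Type*} [NormedAddCommGroup W] [NormedSpace ℝ W] {g : Metric M}

theorem UnitTangentBundle.normSq_eq_one (p : UnitTangentBundle g) : normSq g p.1 = 1 := p.2

theorem UnitTangentBundle.snd_ne_zero (p : UnitTangentBundle g) : p.1.snd ≠ 0 := by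
  rw [← normSq_pos_iff g, p.normSq_eq_one]; exact one_pos

/-- The unit vector in the direction of a nonzero tangent vector. -/
noncomputable def normalize (g : Metric M) (p : TangentBundle (𝓡 2) M) : TangentBundle (𝓡 2) M :=
  ⟨p.proj, (Real.sqrt (g.inner p.proj p.snd p.snd))⁻¹ • p.snd⟩

theorem normSq_normalize {p : TangentBundle (𝓡 2) M} (hp : p.snd ≠ 0) :
    normSq g (normalize g p) = 1 := inner_normalize g p.proj p.snd hp

theorem radialExt_eq {Z : Type*} [Zero Z] (u : UnitTangentBundle g → Z)
    {p : TangentBundle (𝓡 2) M} (hp : p.snd ≠ 0) :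
    radialExt g u p = u ⟨normalize g p, normSq_normalize hp⟩ := by
  rw [radialExt, dif_pos hp]; rfl

theorem normalize_of_normSq_eq_one {p : TangentBundle (𝓡 2) M} (hp : normSq g p = 1) :
    normalize g p = p := by
  have h : Real.sqrt (g.inner p.proj p.snd p.snd) = 1 := by
    rw [show g.inner p.proj p.snd p.snd = 1 from hp, Real.sqrt_one]
  rw [normalize, h, inv_one, one_smul]

theorem radialExt_coe {Z : Type*} [Zero Z] (u : UnitTangentBundle g → Z)
    (p : UnitTangentBundle g) : radialExt g u p.1 = u p := by
  rw [radialExt_eq u p.snd_ne_zero]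
  exact congrArg u (Subtype.ext (normalize_of_normSq_eq_one p.normSq_eq_one))

/-- The unit vectors given by the coordinates `(y, v)` with `v ≠ 0`. -/
noncomputable def unitTangentParam (g : Metric M) (e : OpenPartialHomeomorph M Plane)
    (q : Plane × Plane) : TangentBundle (𝓡 2) M :=
  tangentParam e (q.1, (Real.sqrt (coordMetric g e q.1 q.2 q.2))⁻¹ • q.2)

theorem normalize_tangentParam (e : OpenPartialHomeomorph M Plane) (q : Plane × Plane) :
    normalize g (tangentParam e q) = unitTangentParam g e q := by
  rw [normalize, unitTangentParam, tangentParam, tangentParam]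
  refine tangentBundle_mk_eq rfl ?_
  exact (map_smul (mfderiv 𝓘(ℝ, Plane) (𝓡 2) e.symm q.1 : Plane →L[ℝ] Plane) _ q.2).symm

theorem unitTangentParam_smul (e : OpenPartialHomeomorph M Plane) (y v : Plane) {s : ℝ}
    (hs : 0 < s) : unitTangentParam g e (y, s • v) = unitTangentParam g e (y, v) := by
  have : Real.sqrt (coordMetric g e y (s • v) (s • v))
      = s * Real.sqrt (coordMetric g e y v v) := by
    simp only [map_smul, smul_apply, smul_eq_mul]
    rw [← mul_assoc, Real.sqrt_mul (mul_self_nonneg s), Real.sqrt_mul_self hs.le]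
  simp only [unitTangentParam]
  rw [this, mul_inv_rev, smul_smul, mul_assoc, inv_mul_cancel₀ hs.ne', mul_one]

theorem normSq_unitTangentParam {e : OpenPartialHomeomorph M Plane} (he : e ∈ atlas Plane M)
    {y v : Plane} (hy : y ∈ e.target) (hv : v ≠ 0) : normSq g (unitTangentParam g e (y, v)) = 1 := by
  rw [← normalize_tangentParam]
  exact normSq_normalize ((tangentParam_snd_ne_zero g he hy).2 hv)

theorem unitTangentParam_of_unit {e : OpenPartialHomeomorph M Plane} {y v : Plane}
    (h : coordMetric g e y v v = 1) : unitTangentParam g e (y, v) = tangentParam e (y, v) := by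
  simp [unitTangentParam, h]

theorem continuousOn_unitTangentParam {e : OpenPartialHomeomorph M Plane}
    (he : e ∈ atlas Plane M) :
    ContinuousOn (unitTangentParam g e) (e.target ×ˢ ({0}ᶜ : Set Plane)) := by
  have h := isMetricOn_coordMetric g he
  refine (contMDiffOn_tangentParam he).continuousOn.comp
    (continuousOn_fst.prodMk ((h.contDiffOn_norm.continuousOn.inv₀ fun q hq => ?_).smul
      continuousOn_snd)) fun q hq => ⟨hq.1, trivial⟩
  exact (Real.sqrt_pos.2 ((h.inner q.1 hq.1).pos q.2 hq.2)).ne'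

theorem radialExt_unitTangentParam {Z : Type*} [Zero Z] (u : UnitTangentBundle g → Z)
    {e : OpenPartialHomeomorph M Plane} (he : e ∈ atlas Plane M) {y v : Plane} (hy : y ∈ e.target)
    (hv : v ≠ 0) : radialExt g u (unitTangentParam g e (y, v)) = radialExt g u (tangentParam e (y, v)) := by
  rw [radialExt_eq u ((tangentParam_snd_ne_zero g he hy).2 hv)]
  have h := radialExt_coe u ⟨_, normSq_unitTangentParam he hy hv⟩
  refine h.trans (congrArg u (Subtype.ext (normalize_tangentParam e (y, v)).symm))

theorem IsSmooth.contDiffOn {u : UnitTangentBundle g → W} (hu : IsSmooth g u)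
    {e : OpenPartialHomeomorph M Plane} (he : e ∈ atlas Plane M) :
    ContDiffOn ℝ ∞ (fun q => radialExt g u (tangentParam e q))
      (e.target ×ˢ ({0}ᶜ : Set Plane)) := by
  have h1 : ContMDiffOn 𝓘(ℝ, Plane × Plane) (𝓡 2).tangent ∞ (tangentParam e)
      (e.target ×ˢ ({0}ᶜ : Set Plane)) :=
    (contMDiffOn_tangentParam he).mono fun q hq => ⟨hq.1, trivial⟩
  exact (ContMDiffOn.comp hu h1
    fun q hq => (tangentParam_snd_ne_zero g he hq.1).2 hq.2).contDiffOn

/-- Turns the intrinsic derivative into an ordinary Fréchet derivative in any chart of the atlas,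
once Y is known to have the coordinate expression a there. -/
theorem IsSmooth.lieDeriv_eq {u : UnitTangentBundle g → W} (hu : IsSmooth g u)
    {e : OpenPartialHomeomorph M Plane} (he : e ∈ atlas Plane M) {y v : Plane} (hy : y ∈ e.target)
    {Y : ∀ p : TangentBundle (𝓡 2) M, TangentSpace (𝓡 2).tangent p} {a : Plane × Plane}
    (hY : (Y (tangentParam e (y, v)) : Plane × Plane)
      = fderiv ℝ (tangentTransition e (chartAt Plane (e.symm y))) (y, v) a)
    {p : UnitTangentBundle g} (hp : p.1 = tangentParam e (y, v)) :
    lieDeriv g Y u p = fderiv ℝ (fun q => radialExt g u (tangentParam e q)) (y, v) a := by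
  have hd : MDifferentiableAt (𝓡 2).tangent 𝓘(ℝ, W) (radialExt g u) (tangentParam e (y, v)) :=
    (ContMDiffOn.contMDiffAt hu ((isOpen_snd_ne_zero g).mem_nhds
      (hp ▸ p.snd_ne_zero : (tangentParam e (y, v)).snd ≠ 0))).mdifferentiableAt (by simp)
  obtain ⟨p, hp'⟩ := p
  subst hp
  obtain ⟨L, hL⟩ : ∃ L : Plane × Plane →L[ℝ] W,
      L = mfderiv (𝓡 2).tangent 𝓘(ℝ, W) (radialExt g u) (tangentParam e (y, v)) := ⟨_, rfl⟩
  rw [(hasFDerivAt_comp_tangentParam g he hy hd hL).fderiv, ContinuousLinearMap.comp_apply, hL]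
  exact congrArg (mfderiv (𝓡 2).tangent 𝓘(ℝ, W) (radialExt g u) (tangentParam e (y, v))) hY

/-- A function on the unit tangent bundle is continuous if it is so in coordinates. -/
theorem continuous_of_coord {Z : Type*} [TopologicalSpace Z] {f : UnitTangentBundle g → Z}
    (h : ∀ e ∈ atlas Plane M, ∃ f' : Plane × Plane → Z,
      ContinuousOn f' (e.target ×ˢ ({0}ᶜ : Set Plane)) ∧
      ∀ y ∈ e.target, ∀ v, ∀ p : UnitTangentBundle g, p.1 = tangentParam e (y, v) →
        f p = f' (y, v)) : Continuous f := by
  refine continuous_iff_continuousAt.2 fun p₀ => ?_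
  have he := chart_mem_atlas Plane p₀.1.proj
  obtain ⟨f', hf', hff'⟩ := h _ he
  set e := chartAt Plane p₀.1.proj
  let ψ : UnitTangentBundle g → Plane × Plane := fun p => extChartAt (𝓡 2).tangent p₀.1 p.1
  have hval : Continuous (fun p : UnitTangentBundle g => p.1) := continuous_subtype_val
  have hψ : ContinuousAt ψ p₀ :=
    ContinuousAt.comp (f := fun p : UnitTangentBundle g => p.1)
      (continuousAt_extChartAt p₀.1) hval.continuousAt
  have hnhds : ∀ᶠ p in nhds p₀, p.1 ∈ (extChartAt (𝓡 2).tangent p₀.1).source :=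
    hval.continuousAt (extChartAt_source_mem_nhds p₀.1)
  have hT : ∀ p : UnitTangentBundle g, p.1 ∈ (extChartAt (𝓡 2).tangent p₀.1).source →
      (ψ p).1 ∈ e.target ∧ p.1 = tangentParam e (ψ p) := by
    intro p hp
    have h1 := (extChartAt (𝓡 2).tangent p₀.1).map_source hp
    rw [extChartAt_tangent_target] at h1
    exact ⟨h1.1, (((extChartAt_tangent_symm p₀.1 h1.1 (ψ p).2).symm.trans
      ((extChartAt (𝓡 2).tangent p₀.1).left_inv hp)).symm)⟩
  have h0 := hT p₀ (mem_extChartAt_source p₀.1)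
  have hne : (ψ p₀).2 ≠ 0 := by
    rw [← tangentParam_snd_ne_zero g he h0.1]
    have := p₀.snd_ne_zero
    rw [h0.2] at this
    exact this
  have h1 : ContinuousAt (fun p => f' (ψ p)) p₀ :=
    ContinuousAt.comp (hf'.continuousAt
      ((e.open_target.prod isOpen_compl_singleton).mem_nhds ⟨h0.1, hne⟩)) hψ
  refine h1.congr ?_
  filter_upwards [hnhds] with p hp
  exact (hff' _ (hT p hp).1 _ p (hT p hp).2).symm

theorem IsSmooth.continuous {u : UnitTangentBundle g → W} (hu : IsSmooth g u) :
    Continuous u :=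
  continuous_of_coord fun e he => ⟨_, (hu.contDiffOn he).continuousOn, fun y _ v p hp => by
    simp only [← hp, radialExt_coe]⟩

theorem IsSmooth.continuousOn_fderiv {u : UnitTangentBundle g → W} (hu : IsSmooth g u)
    {e : OpenPartialHomeomorph M Plane} (he : e ∈ atlas Plane M) :
    ContinuousOn (fderiv ℝ (fun q => radialExt g u (tangentParam e q)))
      (e.target ×ˢ ({0}ᶜ : Set Plane)) :=
  (hu.contDiffOn he).continuousOn_fderiv_of_isOpen
    (e.open_target.prod isOpen_compl_singleton) (by simp)

variable {κ : M → ℝ}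

theorem contDiffOn_comp_chart_symm (hκ : ContMDiff (𝓡 2) 𝓘(ℝ, ℝ) ∞ κ)
    {e : OpenPartialHomeomorph M Plane} (he : e ∈ atlas Plane M) :
    ContDiffOn ℝ ∞ (fun y => κ (e.symm y)) e.target :=
  (hκ.comp_contMDiffOn (contMDiffOn_chart_symm he)).contDiffOn

theorem continuousOn_coordMagneticField (hκ : ContMDiff (𝓡 2) 𝓘(ℝ, ℝ) ∞ κ)
    {e : OpenPartialHomeomorph M Plane} (he : e ∈ atlas Plane M) :
    ContinuousOn (coordMagneticField g κ e) (e.target ×ˢ ({0}ᶜ : Set Plane)) := by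
  have h := isMetricOn_coordMetric g he
  have hm : Set.MapsTo Prod.fst (e.target ×ˢ ({0}ᶜ : Set Plane)) e.target := fun _ hq => hq.1
  exact continuousOn_snd.prodMk
    ((((h.contDiffOn_christoffelCLM.continuousOn.comp continuousOn_fst hm).clm_apply
      continuousOn_snd).clm_apply continuousOn_snd).neg.add
    (((contDiffOn_comp_chart_symm hκ he).continuousOn.comp continuousOn_fst hm).smul
      ((h.contDiffOn_rotCLM.continuousOn.comp continuousOn_fst hm).clm_apply continuousOn_snd)))

theorem continuousOn_coordHorizontalField
    {e : OpenPartialHomeomorph M Plane} (he : e ∈ atlas Plane M) :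
    ContinuousOn (coordHorizontalField g e) (e.target ×ˢ ({0}ᶜ : Set Plane)) := by
  have h := isMetricOn_coordMetric g he
  have hm : Set.MapsTo Prod.fst (e.target ×ˢ ({0}ᶜ : Set Plane)) e.target := fun _ hq => hq.1
  have hr := (h.contDiffOn_rotCLM.continuousOn.comp continuousOn_fst hm).clm_apply
    (continuousOn_snd (s := e.target ×ˢ ({0}ᶜ : Set Plane)))
  exact hr.prodMk (((h.contDiffOn_christoffelCLM.continuousOn.comp continuousOn_fst hm).clm_apply
      hr).clm_apply continuousOn_snd).neg

theorem IsSmooth.lieDeriv_magneticField {u : UnitTangentBundle g → W} (hu : IsSmooth g u)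
    (hM : IsOrientedAtlas M) {e : OpenPartialHomeomorph M Plane} (he : e ∈ atlas Plane M)
    {y v : Plane} (hy : y ∈ e.target) {p : UnitTangentBundle g} (hp : p.1 = tangentParam e (y, v)) :
    lieDeriv g (magneticField g κ) u p
      = fderiv ℝ (fun q => radialExt g u (tangentParam e q)) (y, v)
        (coordMagneticField g κ e (y, v)) :=
  hu.lieDeriv_eq he hy (magneticField_tangentParam hM g κ he hy v) hp

theorem IsSmooth.continuous_lieDeriv_magneticField {u : UnitTangentBundle g → W}
    (hu : IsSmooth g u) (hM : IsOrientedAtlas M) (hκ : ContMDiff (𝓡 2) 𝓘(ℝ, ℝ) ∞ κ) :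
    Continuous (lieDeriv g (magneticField g κ) u) :=
  continuous_of_coord fun _ he => ⟨_, (hu.continuousOn_fderiv he).clm_apply
    (continuousOn_coordMagneticField hκ he), fun _ hy _ _ hp =>
      hu.lieDeriv_magneticField hM he hy hp⟩

theorem IsSmooth.continuous_lieDeriv_horizontalField {u : UnitTangentBundle g → W}
    (hu : IsSmooth g u) (hM : IsOrientedAtlas M) :
    Continuous (lieDeriv g (horizontalField g) u) :=
  continuous_of_coord fun _ he => ⟨_, (hu.continuousOn_fderiv he).clm_apply
    (continuousOn_coordHorizontalField he), fun _ hy v _ hp =>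
      hu.lieDeriv_eq he hy (horizontalField_tangentParam hM g he hy v) hp⟩

theorem isSmooth_comp_proj (hκ : ContMDiff (𝓡 2) 𝓘(ℝ, ℝ) ∞ κ) :
    IsSmooth g (fun p : UnitTangentBundle g => κ p.1.proj) := by
  have h : ContMDiff (𝓡 2).tangent 𝓘(ℝ, ℝ) ∞ (fun p : TangentBundle (𝓡 2) M => κ p.proj) :=
    hκ.comp (contMDiff_proj _)
  refine h.contMDiffOn.congr fun p hp => ?_
  rw [radialExt_eq _ hp]
  rfl

theorem continuous_proj : Continuous (fun p : UnitTangentBundle g => p.1.proj) :=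
  (FiberBundle.continuous_proj Plane (TangentSpace (𝓡 2) : M → Type _)).comp continuous_subtype_val

theorem continuous_magneticCurvature (hM : IsOrientedAtlas M)
    (hκ : ContMDiff (𝓡 2) 𝓘(ℝ, ℝ) ∞ κ) : Continuous (magneticCurvature g κ) :=
  (((continuous_gaussCurvature g).comp continuous_proj).sub
    ((isSmooth_comp_proj hκ).continuous_lieDeriv_horizontalField hM)).add
    ((hκ.continuous.comp continuous_proj).pow 2)

/-- Smooth functions of a smooth function. -/
theorem IsSmooth.comp {W' : Type*} [NormedAddCommGroup W'] [NormedSpace ℝ W']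
    {u : UnitTangentBundle g → W} (hu : IsSmooth g u) {φ : W → W'} (hφ : ContDiff ℝ ∞ φ) :
    IsSmooth g (fun p => φ (u p)) := by
  refine (hφ.contMDiff.comp_contMDiffOn hu).congr fun p hp => ?_
  rw [Function.comp_apply, radialExt_eq _ hp, radialExt_eq _ hp]

theorem IsSmooth.mul {u w : UnitTangentBundle g → ℝ} (hu : IsSmooth g u)
    (hw : IsSmooth g w) : IsSmooth g (fun p => u p * w p) := by
  have h : ContMDiffOn (𝓡 2).tangent 𝓘(ℝ, ℝ) ∞ (fun p => radialExt g u p * radialExt g w p)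
      {p | p.snd ≠ 0} := ContMDiffOn.mul hu hw
  refine h.congr fun p hp => ?_
  rw [radialExt_eq _ hp, radialExt_eq _ hp, radialExt_eq _ hp]

theorem IsSmooth.lieDeriv_mul {u w : UnitTangentBundle g → ℝ} (hu : IsSmooth g u)
    (hw : IsSmooth g w) (hM : IsOrientedAtlas M) (p : UnitTangentBundle g) :
    lieDeriv g (magneticField g κ) (fun p => u p * w p) p
      = u p * lieDeriv g (magneticField g κ) w p + w p * lieDeriv g (magneticField g κ) u p := by
  have he := chart_mem_atlas Plane p.1.proj
  have hy := mem_chart_target Plane p.1.proj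
  have hp := (tangentParam_chartAt p.1).symm
  set e := chartAt Plane p.1.proj
  set y := e p.1.proj
  set v := fiberVec p.1
  have hv : v ≠ 0 := by
    rw [← tangentParam_snd_ne_zero g he hy]
    have := p.snd_ne_zero
    rw [hp] at this
    exact this
  have hn := (e.open_target.prod (isOpen_compl_singleton (x := (0 : Plane)))).mem_nhds
    (Set.mk_mem_prod hy hv)
  have hu' := (((hu.contDiffOn he).contDiffAt hn).differentiableAt (by simp)).hasFDerivAt
  have hw' := (((hw.contDiffOn he).contDiffAt hn).differentiableAt (by simp)).hasFDerivAt
  have hE : (fun q => radialExt g (fun p => u p * w p) (tangentParam e q))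
      =ᶠ[nhds (y, v)] fun q => radialExt g u (tangentParam e q) * radialExt g w (tangentParam e q) := by
    filter_upwards [hn] with q hq
    have hq' := (tangentParam_snd_ne_zero g he hq.1).2 hq.2
    rw [radialExt_eq _ hq', radialExt_eq _ hq', radialExt_eq _ hq']
  have hc : HasFDerivAt (fun q => radialExt g u (tangentParam e q)
      * radialExt g w (tangentParam e q)) _ (y, v) := hu'.mul hw'
  rw [(hu.mul hw).lieDeriv_magneticField hM he hy hp, hu.lieDeriv_magneticField hM he hy hp,
    hw.lieDeriv_magneticField hM he hy hp, hE.fderiv_eq, hc.fderiv, ← hp,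
    radialExt_coe, radialExt_coe]
  simp

theorem IsSmooth.lieDeriv_comp {W' : Type*} [NormedAddCommGroup W'] [NormedSpace ℝ W']
    {u : UnitTangentBundle g → W} (hu : IsSmooth g u) {φ : W → W'} (hφ : ContDiff ℝ ∞ φ)
    (hM : IsOrientedAtlas M) (p : UnitTangentBundle g) :
    lieDeriv g (magneticField g κ) (fun p => φ (u p)) p
      = fderiv ℝ φ (u p) (lieDeriv g (magneticField g κ) u p) := by
  have he := chart_mem_atlas Plane p.1.proj
  have hy := mem_chart_target Plane p.1.proj
  have hp := (tangentParam_chartAt p.1).symm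
  set e := chartAt Plane p.1.proj
  set y := e p.1.proj
  set v := fiberVec p.1
  have hv : v ≠ 0 := by
    rw [← tangentParam_snd_ne_zero g he hy]
    have := p.snd_ne_zero
    rw [hp] at this
    exact this
  have hn := (e.open_target.prod (isOpen_compl_singleton (x := (0 : Plane)))).mem_nhds
    (Set.mk_mem_prod hy hv)
  have hu' := (((hu.contDiffOn he).contDiffAt hn).differentiableAt (by simp)).hasFDerivAt
  have hφ' := (hφ.differentiable (by simp) (radialExt g u (tangentParam e (y, v)))).hasFDerivAt
  have hE : (fun q => radialExt g (fun p => φ (u p)) (tangentParam e q))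
      =ᶠ[nhds (y, v)] fun q => φ (radialExt g u (tangentParam e q)) := by
    filter_upwards [hn] with q hq
    have hq' := (tangentParam_snd_ne_zero g he hq.1).2 hq.2
    rw [radialExt_eq _ hq', radialExt_eq _ hq']
  have hc : HasFDerivAt (fun q => φ (radialExt g u (tangentParam e q))) _ (y, v) :=
    HasFDerivAt.comp (g := φ) (y, v) hφ' hu'
  rw [(hu.comp hφ).lieDeriv_magneticField hM he hy hp, hu.lieDeriv_magneticField hM he hy hp,
    hE.fderiv_eq, hc.fderiv, ← hp, radialExt_coe]
  rfl

/-! ### Compactness of the unit tangent bundle -/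

theorem exists_isCompact_image_mem_nhds (x : M) :
    ∃ K ⊆ (chartAt Plane x).target, IsCompact K ∧ (chartAt Plane x).symm '' K ∈ nhds x := by
  set e := chartAt Plane x
  have hx := mem_chart_source Plane x
  obtain ⟨r, hr, hr'⟩ := Metric.nhds_basis_closedBall.mem_iff.1
    (e.open_target.mem_nhds (mem_chart_target Plane x))
  refine ⟨_, hr', isCompact_closedBall _ _, ?_⟩
  have h1 := e.symm.map_nhds_eq (e.map_source hx)
  rw [e.left_inv hx] at h1
  rw [← h1]
  exact Filter.image_mem_map (Metric.closedBall_mem_nhds _ hr)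

/-- Normalization parametrizes each fibre circle by the fixed Euclidean unit circle. Finitely many
compact coordinate sets cover M, so the unit tangent bundle is a finite union of continuous images
of compact products. -/
theorem isCompact_normSq_eq_one [CompactSpace M] (g : Metric M) :
    IsCompact {p : TangentBundle (𝓡 2) M | normSq g p = 1} := by
  choose K hKt hK hKn using fun x : M => exists_isCompact_image_mem_nhds x
  obtain ⟨t, ht⟩ := isCompact_univ.elim_nhds_subcover _ fun x _ => hKn x
  have hsub : ∀ x, K x ×ˢ Metric.sphere (0 : Plane) 1 ⊆
      (chartAt Plane x).target ×ˢ ({0}ᶜ : Set Plane) := fun x q hq =>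
    ⟨hKt x hq.1, fun h0 => by
      have := hq.2
      rw [Set.mem_singleton_iff.1 h0] at this
      simp at this⟩
  have hcomp : ∀ x, IsCompact
      (unitTangentParam g (chartAt Plane x) '' (K x ×ˢ Metric.sphere (0 : Plane) 1)) := fun x =>
    ((hK x).prod (isCompact_sphere 0 1)).image_of_continuousOn
      ((continuousOn_unitTangentParam (chart_mem_atlas _ _)).mono (hsub x))
  convert! t.isCompact_biUnion fun x _ => hcomp x
  ext p
  simp only [Set.mem_ofPred_eq, Set.mem_iUnion]
  constructor
  · intro hp
    obtain ⟨x, hxt, y, hyK, hy⟩ := Set.mem_iUnion₂.1 (ht.2 (Set.mem_univ p.proj))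
    have he := chart_mem_atlas Plane x
    have hyt := hKt x hyK
    obtain ⟨v, hv⟩ := exists_tangentParam_eq he p (by
      rw [← hy]; exact (chartAt Plane x).map_target hyt)
    rw [← hy, (chartAt Plane x).right_inv hyt] at hv
    have hv0 : v ≠ 0 := by
      rw [← tangentParam_snd_ne_zero g he hyt, hv, ← normSq_pos_iff g, hp]
      exact one_pos
    refine ⟨x, hxt, (y, ‖v‖⁻¹ • v), ⟨hyK, by simp [norm_smul, hv0]⟩, ?_⟩
    rw [unitTangentParam_smul _ _ _ (inv_pos.2 (norm_pos_iff.2 hv0)), unitTangentParam_of_unit, hv]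
    rw [coordMetric_self, hv, hp]
  · rintro ⟨x, -, q, hq, rfl⟩
    exact normSq_unitTangentParam (chart_mem_atlas _ _) (hsub x hq).1 (hsub x hq).2

instance [CompactSpace M] : CompactSpace (UnitTangentBundle g) :=
  isCompact_iff_compactSpace.1 (isCompact_normSq_eq_one g)

end MagneticSurface

/-! ### Polar coordinates of an inner product -/

open Real in
theorem lintegral_plane_polar (F : Plane → ENNReal) :
    ∫⁻ v, F v = ∫⁻ p in polarCoord.target,
      ENNReal.ofReal p.1 * F (!₂[p.1 * cos p.2, p.1 * sin p.2]) := by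
  have h1 := ((EuclideanSpace.volume_preserving_symm_measurableEquiv_toLp (Fin 2)).trans
    (volume_preserving_finTwoArrow ℝ)).symm
    ((MeasurableEquiv.toLp 2 (Fin 2 → ℝ)).symm.trans MeasurableEquiv.finTwoArrow)
  rw [← h1.lintegral_comp_emb (MeasurableEquiv.measurableEmbedding _) F,
    ← lintegral_comp_polarCoord_symm]
  rfl

theorem ContinuousLinearMap.lintegral_comp (L : Plane →L[ℝ] Plane) (hL : L.det ≠ 0)
    (F : Plane → ENNReal) : ∫⁻ v, F v = ENNReal.ofReal |L.det| * ∫⁻ v, F (L v) := by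
  have hu : IsUnit (LinearMap.det (L : Plane →ₗ[ℝ] Plane)) := isUnit_iff_ne_zero.2 hL
  have hb : Function.Bijective L := by
    have := (LinearEquiv.ofIsUnitDet (v := (EuclideanSpace.basisFun (Fin 2) ℝ).toBasis)
      (v' := (EuclideanSpace.basisFun (Fin 2) ℝ).toBasis) (f := (L : Plane →ₗ[ℝ] Plane))
      (by rwa [LinearMap.det_toMatrix])).bijective
    exact this
  have h := lintegral_image_eq_lintegral_abs_det_fderiv_mul (volume : Measure Plane)
    MeasurableSet.univ (fun x _ => L.hasFDerivAt.hasFDerivWithinAt) hb.1.injOn F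
  rw [Set.image_univ, hb.2.range_eq] at h
  simp only [Measure.restrict_univ] at h
  rw [h, lintegral_const_mul' _ _ ENNReal.ofReal_ne_top]

namespace MagneticSurface

namespace IsInner

variable {B : Plane →L[ℝ] Plane →L[ℝ] ℝ}

open Real in
-- Euclidean polar coordinates followed by the linear map taking the standard basis to the
-- B-orthonormal frame (E, JE).
theorem lintegral_polar (hB : IsInner B) {E : Plane} (hE : B E E = 1) (F : Plane → ENNReal) :
    ∫⁻ v, F v = ENNReal.ofReal (√(gram B).det)⁻¹ * ∫⁻ p in polarCoord.target,
      ENNReal.ofReal p.1 * F (p.1 • (cos p.2 • E + sin p.2 • rot B E)) := by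
  let L : Plane →L[ℝ] Plane := (EuclideanSpace.proj 0 : Plane →L[ℝ] ℝ).smulRight E
    + (EuclideanSpace.proj 1 : Plane →L[ℝ] ℝ).smulRight (rot B E)
  have hLa : ∀ v, L v = v 0 • E + v 1 • rot B E := fun v => rfl
  have hJ : B (rot B E) (rot B E) = 1 := (hB.inner_rot_rot E).trans hE
  have hJE : B (rot B E) E = 0 := hB.inner_rot_self E
  have hEJ : B E (rot B E) = 0 := (hB.symm _ _).trans hJE
  have hin : ∀ v w : Plane, (innerSL ℝ v : Plane →L[ℝ] ℝ) w = v 0 * w 0 + v 1 * w 1 := fun v w => by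
    rw [innerSL_apply_apply, PiLp.inner_apply, Fin.sum_univ_two]
    simp [mul_comm]
  -- L pulls B back to the Euclidean product, whose Gram determinant is 1; hence |det L| = (det
  -- B)^(-1/2).
  have hdet := gram_det_pullback (B := innerSL ℝ) (B' := B) (L := L) fun v w => by
    rw [hLa, hLa]
    simp only [map_add, map_smul, add_apply, smul_apply, smul_eq_mul, hE, hJ, hJE, hEJ]
    rw [hin]
    ring
  have h1 : (gram (innerSL ℝ : Plane →L[ℝ] Plane →L[ℝ] ℝ)).det = 1 := by
    simp [gram, Matrix.det_fin_two, hin]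
  rw [h1] at hdet
  have hs := hB.sqrt_det_pos
  have habs : |L.det| = (√(gram B).det)⁻¹ := by
    refine eq_inv_of_mul_eq_one_left ?_
    rw [← Real.sqrt_sq_eq_abs, ← Real.sqrt_mul (sq_nonneg _),
      mul_comm, ← hdet, Real.sqrt_one]
  have hne : L.det ≠ 0 := fun h => by simp [h] at hdet
  rw [L.lintegral_comp hne, habs, lintegral_plane_polar]
  congr 1
  refine lintegral_congr fun p => ?_
  rw [hLa]
  simp [smul_add, smul_smul]

theorem sq_apply_polar (hB : IsInner B) {E : Plane} (hE : B E E = 1) (θ : ℝ) :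
    B (Real.cos θ • E + Real.sin θ • rot B E) (Real.cos θ • E + Real.sin θ • rot B E) = 1 := by
  have hJ : B (rot B E) (rot B E) = 1 := (hB.inner_rot_rot E).trans hE
  have hJE : B (rot B E) E = 0 := hB.inner_rot_self E
  have hEJ : B E (rot B E) = 0 := (hB.symm _ _).trans hJE
  simp only [map_add, map_smul, add_apply, smul_apply, smul_eq_mul, hE, hJ, hJE, hEJ]
  nlinarith [Real.sin_sq_add_cos_sq θ]

end IsInner

/-- Reconciles the angular range of polar coordinates with the one used in the Liouville measure: up
to a null set both are fundamental domains for translation by 2π. -/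
theorem setLIntegral_angle_eq (H : ℝ → ENNReal) (hH : ∀ θ, H (θ + 2 * Real.pi) = H θ) :
    ∫⁻ θ in Set.Ioo (-Real.pi) Real.pi, H θ = ∫⁻ θ in Set.Ioc 0 (2 * Real.pi), H θ := by
  have h1 : ∫⁻ θ in Set.Ioo (-Real.pi) Real.pi, H θ = ∫⁻ θ in Set.Ioc (-Real.pi) Real.pi, H θ :=
    setLIntegral_congr Ioo_ae_eq_Ioc
  have h2 := (isAddFundamentalDomain_Ioc Real.two_pi_pos (-Real.pi)).setLIntegral_eq
    (isAddFundamentalDomain_Ioc Real.two_pi_pos 0) H (by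
      rintro ⟨_, n, rfl⟩ x
      change H (n • (2 * Real.pi) + x) = H x
      rw [add_comm]
      exact (show Function.Periodic H (2 * Real.pi) from hH).zsmul n x)
  rw [h1]
  rwa [show -Real.pi + 2 * Real.pi = Real.pi by ring, zero_add] at h2

/-- A weight on the radius whose product with `r` has a finite positive integral. -/
noncomputable def radialBump : ContDiffBump (1 : ℝ) where
  rIn := 1 / 4
  rOut := 1 / 2
  rIn_pos := by norm_num
  rIn_lt_rOut := by norm_num

/-- The weight of a vector of square length `s`, supported in `[1 / 2, 3 / 2]`. -/
noncomputable def radialWeight (s : ℝ) : ℝ := Real.sqrt s * radialBump s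

theorem continuous_radialWeight : Continuous radialWeight :=
  Real.continuous_sqrt.mul radialBump.continuous

theorem radialWeight_nonneg (s : ℝ) : 0 ≤ radialWeight s :=
  mul_nonneg (Real.sqrt_nonneg s) radialBump.nonneg

/-- The integral of the weight over the half-plane of polar coordinates, per unit angle. -/
noncomputable def radialMass : ENNReal :=
  ∫⁻ r in Set.Ioi (0 : ℝ), ENNReal.ofReal r * ENNReal.ofReal (radialWeight (r ^ 2))

theorem measurable_radial :
    Measurable fun r : ℝ => ENNReal.ofReal r * ENNReal.ofReal (radialWeight (r ^ 2)) :=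
  (ENNReal.measurable_ofReal).mul ((continuous_radialWeight.comp
    (continuous_pow 2)).measurable.ennreal_ofReal)

theorem radialMass_ne_zero : radialMass ≠ 0 := by
  rw [radialMass, Ne, setLIntegral_eq_zero_iff measurableSet_Ioi measurable_radial]
  intro h
  -- For 0.9 < r < 1 the value r² lies in (1/2, 3/2), where the bump is positive, so the integrand
  -- cannot vanish there.
  have h1 : volume (Set.Ioo (0.9 : ℝ) 1) = 0 := by
    refine measure_mono_null (fun r hr => ?_) h
    have h0 : (0 : ℝ) < r := lt_trans (by norm_num) hr.1
    refine fun hr0 => mul_ne_zero (ne_of_gt ?_) (ne_of_gt ?_) (hr0 h0)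
    · simpa using h0
    · rw [ENNReal.ofReal_pos, radialWeight, Real.sqrt_sq h0.le]
      refine mul_pos h0 (radialBump.pos_of_mem_ball ?_)
      rw [Real.ball_eq_Ioo]
      change 1 - 1 / 2 < r ^ 2 ∧ r ^ 2 < 1 + 1 / 2
      constructor <;> nlinarith [hr.1, hr.2]
  rw [Real.volume_Ioo, ENNReal.ofReal_eq_zero] at h1
  norm_num at h1

theorem radialBump_eq_zero {s : ℝ} (hs : s ∉ Set.Icc (1 / 2 : ℝ) (3 / 2)) : radialBump s = 0 := by
  refine radialBump.zero_of_le_dist ?_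
  change 1 / 2 ≤ dist s 1
  rw [Real.dist_eq]
  by_contra! h
  rw [abs_lt] at h
  exact hs ⟨by linarith, by linarith⟩

theorem radialMass_ne_top : radialMass ≠ ⊤ := by
  -- The integrand is r² times a bump bounded by 1, hence at most 4 for r ≤ 2; for r > 2 the bump
  -- vanishes because r² > 3/2.
  have h : radialMass ≤ ∫⁻ r in Set.Ioc (0 : ℝ) 2, ENNReal.ofReal 4 := by
    rw [radialMass, ← lintegral_indicator measurableSet_Ioi,
      ← lintegral_indicator measurableSet_Ioc]
    refine lintegral_mono fun r => ?_
    by_cases h0 : r ∈ Set.Ioi (0 : ℝ)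
    · rw [Set.indicator_of_mem h0]
      have h0' : 0 < r := h0
      by_cases h2 : r ≤ 2
      · rw [Set.indicator_of_mem (Set.mem_Ioc.2 ⟨h0, h2⟩), ← ENNReal.ofReal_mul h0'.le]
        refine ENNReal.ofReal_le_ofReal ?_
        rw [radialWeight, Real.sqrt_sq h0'.le]
        have := radialBump.le_one (x := r ^ 2)
        have := radialBump.nonneg (x := r ^ 2)
        nlinarith [mul_le_mul h2 h2 h0'.le (by norm_num), mul_pos h0' h0']
      · rw [radialWeight, radialBump_eq_zero]
        · simp
        · rintro ⟨-, h⟩; nlinarith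
    · rw [Set.indicator_of_notMem h0]; exact zero_le
  refine (h.trans_lt ?_).ne
  simp [ENNReal.mul_lt_top]

open Real in
-- In B-polar coordinates the weight depends only on the radius and H only on the angle, so the
-- integral factors. This trades the circle for the whole tangent plane, where linear changes of
-- variables are available.
theorem IsInner.lintegral_homogeneous {B : Plane →L[ℝ] Plane →L[ℝ] ℝ} (hB : IsInner B)
    {E : Plane} (hE : B E E = 1) (H : Plane → ENNReal)
    (hH : ∀ v, ∀ s : ℝ, 0 < s → H (s • v) = H v)
    (hm : AEMeasurable (fun θ : ℝ => H (cos θ • E + sin θ • rot B E))) :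
    ∫⁻ v, ENNReal.ofReal (radialWeight (B v v)) * H v
      = ENNReal.ofReal (√(gram B).det)⁻¹ *
        (radialMass * ∫⁻ θ in Set.Ioc 0 (2 * π), H (cos θ • E + sin θ • rot B E)) := by
  rw [hB.lintegral_polar hE, ← setLIntegral_angle_eq _ fun θ => by
    rw [cos_add_two_pi, sin_add_two_pi], radialMass, polarCoord_target]
  congr 1
  rw [← lintegral_prod_mul measurable_radial.aemeasurable hm.restrict, Measure.prod_restrict,
    ← Measure.volume_eq_prod]
  refine setLIntegral_congr_fun (measurableSet_Ioi.prod measurableSet_Ioo) fun p hp => ?_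
  have hp0 : 0 < p.1 := hp.1
  have hq : B (p.1 • (cos p.2 • E + sin p.2 • rot B E)) (p.1 • (cos p.2 • E + sin p.2 • rot B E))
      = p.1 ^ 2 := by
    rw [map_smul, map_smul, smul_apply, hB.sq_apply_polar hE]
    simp [sq]
  simp only [hq, hH _ _ hp0]
  rw [mul_assoc]

end MagneticSurface

namespace MagneticSurface

/-! ### The Liouville measure over a chart -/

variable {M : Type*} [TopologicalSpace M] [ChartedSpace Plane M] [IsManifold (𝓡 2) ∞ M]
  {g : Metric M} {e e' : OpenPartialHomeomorph M Plane}

/-- The unit vector in the direction of `∂₀`. -/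
noncomputable def coordFrame (g : Metric M) (e : OpenPartialHomeomorph M Plane) (y : Plane) :
    Plane :=
  (Real.sqrt (coordMetric g e y (basisVec 0) (basisVec 0)))⁻¹ • basisVec 0

theorem coordMetric_coordFrame (he : e ∈ atlas Plane M) {y : Plane} (hy : y ∈ e.target) :
    coordMetric g e y (coordFrame g e y) (coordFrame g e y) = 1 := by
  have h : 0 < coordMetric g e y (basisVec 0) (basisVec 0) :=
    ((isMetricOn_coordMetric g he).inner y hy).gram_zero_pos
  have hs := Real.mul_self_sqrt h.le
  have hne := (Real.sqrt_pos.2 h).ne'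
  simp only [coordFrame, map_smul, smul_apply, smul_eq_mul]
  generalize Real.sqrt (coordMetric g e y (basisVec 0) (basisVec 0)) = c at hs hne
  rw [← hs]
  field_simp

/-- The unit vector at the angle `θ` from `coordFrame`. -/
noncomputable def coordDirection (g : Metric M) (e : OpenPartialHomeomorph M Plane)
    (q : Plane × ℝ) : Plane :=
  Real.cos q.2 • coordFrame g e q.1 + Real.sin q.2 • rot (coordMetric g e q.1) (coordFrame g e q.1)

theorem coordParam_eq (q : Plane × ℝ) :
    coordParam g e q = tangentParam e (q.1, coordDirection g e q) := rfl

theorem coordMetric_coordDirection (he : e ∈ atlas Plane M) {q : Plane × ℝ}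
    (hq : q.1 ∈ e.target) :
    coordMetric g e q.1 (coordDirection g e q) (coordDirection g e q) = 1 :=
  ((isMetricOn_coordMetric g he).inner q.1 hq).sq_apply_polar (coordMetric_coordFrame he hq) q.2

theorem coordParam_eq_unitTangentParam (he : e ∈ atlas Plane M) {q : Plane × ℝ}
    (hq : q.1 ∈ e.target) :
    coordParam g e q = unitTangentParam g e (q.1, coordDirection g e q) := by
  rw [unitTangentParam_of_unit (coordMetric_coordDirection he hq), coordParam_eq]

theorem continuousOn_coordParam (he : e ∈ atlas Plane M) :
    ContinuousOn (coordParam g e) (e.target ×ˢ (Set.univ : Set ℝ)) := by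
  have h := isMetricOn_coordMetric g he
  have hm : Set.MapsTo Prod.fst (e.target ×ˢ (Set.univ : Set ℝ)) e.target := fun _ hq => hq.1
  have h0 : ContinuousOn (fun y => coordMetric g e y (basisVec 0) (basisVec 0)) e.target :=
    (h.smooth.continuousOn.clm_apply continuousOn_const).clm_apply continuousOn_const
  have hE : ContinuousOn (fun q : Plane × ℝ => coordFrame g e q.1)
      (e.target ×ˢ (Set.univ : Set ℝ)) :=
    ContinuousOn.comp (g := coordFrame g e) (((h0.sqrt).inv₀ fun y hy =>
      (Real.sqrt_pos.2 (h.inner y hy).gram_zero_pos).ne').smul continuousOn_const)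
      continuousOn_fst hm
  have hJ : ContinuousOn (fun q : Plane × ℝ => rotCLM (coordMetric g e q.1) (coordFrame g e q.1))
      (e.target ×ˢ (Set.univ : Set ℝ)) :=
    (h.contDiffOn_rotCLM.continuousOn.comp continuousOn_fst hm).clm_apply hE
  refine (contMDiffOn_tangentParam he).continuousOn.comp (continuousOn_fst.prodMk
    (((Real.continuous_cos.comp continuous_snd).continuousOn.smul hE).add
    ((Real.continuous_sin.comp continuous_snd).continuousOn.smul ?_))) fun q hq => ⟨hq.1, trivial⟩
  exact hJ.congr fun q _ => (rotCLM_apply _ _).symm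

theorem continuousOn_det (he : e ∈ atlas Plane M) :
    ContinuousOn (fun y => (gram (coordMetric g e y)).det) e.target :=
  (isMetricOn_coordMetric g he).contDiffOn_det.continuousOn

theorem aemeasurable_coordParam (he : e ∈ atlas Plane M) :
    AEMeasurable (coordParam g e) (((volume : Measure Plane).prod (volume : Measure ℝ)).restrict
      (e.target ×ˢ Set.Ioc 0 (2 * Real.pi))) :=
  ((continuousOn_coordParam he).mono (Set.prod_mono le_rfl (Set.subset_univ _))).aemeasurable
    (e.open_target.measurableSet.prod measurableSet_Ioc)

theorem aemeasurable_density (he : e ∈ atlas Plane M) :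
    AEMeasurable (fun q : Plane × ℝ =>
      ENNReal.ofReal (Real.sqrt (gram (coordMetric g e q.1)).det))
      (((volume : Measure Plane).prod (volume : Measure ℝ)).restrict
      (e.target ×ˢ Set.Ioc 0 (2 * Real.pi))) :=
  (((continuousOn_det he).sqrt.comp continuousOn_fst fun _ hq => hq.1).aemeasurable
    (e.open_target.measurableSet.prod measurableSet_Ioc)).ennreal_ofReal

theorem lintegral_coordLiouville (he : e ∈ atlas Plane M) {f : TangentBundle (𝓡 2) M → ENNReal}
    (hf : Measurable f) :
    ∫⁻ p, f p ∂coordLiouville g e = ∫⁻ y in e.target,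
      ENNReal.ofReal (Real.sqrt (gram (coordMetric g e y)).det) *
        ∫⁻ θ in Set.Ioc 0 (2 * Real.pi), f (coordParam g e (y, θ)) := by
  have h1 := aemeasurable_coordParam (g := g) he
  have h2 := aemeasurable_density (g := g) he
  rw [coordLiouville, lintegral_map' hf.aemeasurable (h1.mono_ac (withDensity_absolutelyContinuous _ _)),
    lintegral_withDensity_eq_lintegral_mul₀ h2 (g := fun q => f (coordParam g e q))
      (hf.comp_aemeasurable h1), ← Measure.prod_restrict,
    lintegral_prod]
  · refine lintegral_congr fun y => ?_
    simp only [Pi.mul_apply]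
    rw [lintegral_const_mul' _ _ ENNReal.ofReal_ne_top]
  · rw [Measure.prod_restrict]
    exact h2.mul (hf.comp_aemeasurable h1)

theorem ae_coordLiouville (he : e ∈ atlas Plane M) :
    ∀ᵐ p ∂coordLiouville g e, p.proj ∈ e.source ∧ normSq g p = 1 := by
  have hs : MeasurableSet {p : TangentBundle (𝓡 2) M | p.proj ∈ e.source ∧ normSq g p = 1} :=
    ((e.open_source.preimage (FiberBundle.continuous_proj Plane
      (TangentSpace (𝓡 2) : M → Type _))).measurableSet).inter
      ((isClosed_singleton (x := (1 : ℝ))).preimage (continuous_normSq g)).measurableSet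
  have h1 := aemeasurable_coordParam (g := g) he
  rw [coordLiouville, ae_map_iff (h1.mono_ac (withDensity_absolutelyContinuous _ _)) hs]
  refine (withDensity_absolutelyContinuous _ _).ae_le (ae_restrict_of_forall_mem
    (e.open_target.measurableSet.prod measurableSet_Ioc) fun q hq => ⟨e.map_target hq.1, ?_⟩)
  rw [coordParam_eq, ← coordMetric_self, coordMetric_coordDirection he hq.1]

/-- The Liouville measure as an integral over the tangent planes. -/
theorem radialMass_mul_lintegral (he : e ∈ atlas Plane M)
    {f : TangentBundle (𝓡 2) M → ENNReal} (hf : Measurable f) :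
    radialMass * ∫⁻ p, f p ∂coordLiouville g e = ∫⁻ y in e.target,
      ENNReal.ofReal (gram (coordMetric g e y)).det *
        ∫⁻ v, ENNReal.ofReal (radialWeight (coordMetric g e y v v)) *
          f (unitTangentParam g e (y, v)) := by
  rw [lintegral_coordLiouville he hf, ← lintegral_const_mul' _ _ radialMass_ne_top]
  refine setLIntegral_congr_fun e.open_target.measurableSet fun y hy => ?_
  have hB := (isMetricOn_coordMetric g he).inner y hy
  have h1 : ∀ θ, unitTangentParam g e (y, coordDirection g e (y, θ)) = coordParam g e (y, θ) :=
    fun θ => (coordParam_eq_unitTangentParam he (q := (y, θ)) hy).symm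
  have hc : Continuous fun θ : ℝ => coordParam g e (y, θ) :=
    (continuousOn_coordParam he).comp_continuous (by fun_prop) fun θ => ⟨hy, trivial⟩
  have h2 := hB.lintegral_homogeneous (coordMetric_coordFrame he hy)
    (fun v => f (unitTangentParam g e (y, v)))
    (fun v s hs => by rw [unitTangentParam_smul e y v hs])
    (by
      have : Measurable fun θ : ℝ => f (coordParam g e (y, θ)) := hf.comp hc.measurable
      simp only [← h1] at this
      exact this.aemeasurable)
  have h3 : ∀ θ : ℝ, f (unitTangentParam g e (y, Real.cos θ • coordFrame g e y
      + Real.sin θ • rot (coordMetric g e y) (coordFrame g e y))) = f (coordParam g e (y, θ)) :=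
    fun θ => congrArg f (h1 θ)
  simp only [h3] at h2
  simp only [h2]
  have hs := hB.sqrt_det_pos
  rw [← mul_assoc (ENNReal.ofReal _), ← ENNReal.ofReal_mul hB.det_pos.le]
  have h4 : (gram (coordMetric g e y)).det * (Real.sqrt (gram (coordMetric g e y)).det)⁻¹
      = Real.sqrt (gram (coordMetric g e y)).det := by
    rw [← div_eq_mul_inv, Real.div_sqrt]
  rw [h4]
  ring

theorem unitTangentParam_transition (he : e ∈ atlas Plane M) (he' : e' ∈ atlas Plane M)
    {y : Plane} (hy : y ∈ (e.symm ≫ₕ e').source) (v : Plane) :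
    unitTangentParam g e' (transition e e' y, fderiv ℝ (transition e e') y v)
      = unitTangentParam g e (y, v) := by
  rw [← normalize_tangentParam, ← normalize_tangentParam, ← tangentParam_transition he he' hy]
  rfl

theorem setLIntegral_eq_of_subset {α : Type*} [MeasurableSpace α] {μ : Measure α} {s t : Set α}
    (hs : MeasurableSet s) (ht : MeasurableSet t) (hst : s ⊆ t) {f : α → ENNReal}
    (hf : ∀ x ∈ t, x ∉ s → f x = 0) : ∫⁻ x in t, f x ∂μ = ∫⁻ x in s, f x ∂μ := by
  rw [← lintegral_indicator hs, ← lintegral_indicator ht]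
  refine lintegral_congr fun x => ?_
  by_cases hx : x ∈ s
  · rw [Set.indicator_of_mem hx, Set.indicator_of_mem (hst hx)]
  · rw [Set.indicator_of_notMem hx]
    by_cases hxt : x ∈ t
    · rw [Set.indicator_of_mem hxt, hf x hxt hx]
    · rw [Set.indicator_of_notMem hxt]

/-- After passing to tangent planes, the substitution in the base and the one in the fibre each
contribute |det L|. Their product is the factor by which the Gram determinant changes. The angular
frames of the two charts never have to be compared. -/
theorem lintegral_coordLiouville_eq (he : e ∈ atlas Plane M) (he' : e' ∈ atlas Plane M)
    {f : TangentBundle (𝓡 2) M → ENNReal} (hf : Measurable f)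
    (h0 : ∀ p : TangentBundle (𝓡 2) M, ¬ (p.proj ∈ e.source ∧ p.proj ∈ e'.source) → f p = 0) :
    ∫⁻ p, f p ∂coordLiouville g e = ∫⁻ p, f p ∂coordLiouville g e' := by
  have hi := isIsometryOn_transition g he he'
  rw [← ENNReal.mul_right_inj radialMass_ne_zero radialMass_ne_top,
    radialMass_mul_lintegral he hf, radialMass_mul_lintegral he' hf,
    setLIntegral_eq_of_subset (e.symm ≫ₕ e').open_source.measurableSet
      e.open_target.measurableSet (fun y hy => (mem_transition_source.1 hy).1) fun y hy hy' => ?_,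
    setLIntegral_eq_of_subset (e.symm ≫ₕ e').open_target.measurableSet
      e'.open_target.measurableSet (fun y hy => hy.1) fun y hy hy' => ?_]
  · have himg : (e.symm ≫ₕ e').target = transition e e' '' (e.symm ≫ₕ e').source :=
      ((e.symm ≫ₕ e').image_source_eq_target).symm
    rw [himg, lintegral_image_eq_lintegral_abs_det_fderiv_mul volume
      (e.symm ≫ₕ e').open_source.measurableSet (fun y hy => (hi.hasFDerivAt hy).hasFDerivWithinAt)
      (e.symm ≫ₕ e').injOn]
    refine setLIntegral_congr_fun (e.symm ≫ₕ e').open_source.measurableSet fun y hy => ?_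
    set L := fderiv ℝ (transition e e') y
    have hL : L.det ≠ 0 := hi.det_ne_zero hy
    have hdet : (gram (coordMetric g e y)).det
        = (gram (coordMetric g e' (transition e e' y))).det * L.det ^ 2 :=
      gram_det_pullback (hi.pullback y hy)
    have hp : 0 ≤ (gram (coordMetric g e' (transition e e' y))).det :=
      (hi.target.inner _ (hi.mapsTo hy)).det_pos.le
    rw [L.lintegral_comp hL (fun v => ENNReal.ofReal (radialWeight
      (coordMetric g e' (transition e e' y) v v)) *
        f (unitTangentParam g e' (transition e e' y, v))), hdet, ← mul_assoc, ← mul_assoc, ← ENNReal.ofReal_mul (abs_nonneg _),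
      ← ENNReal.ofReal_mul (mul_nonneg (abs_nonneg _) hp)]
    congr 2
    · rw [← sq_abs]; ring
    · ext v
      rw [unitTangentParam_transition he he' hy, ← hi.pullback y hy]
  · have : ∀ v, f (unitTangentParam g e' (y, v)) = 0 := fun v =>
      h0 _ fun h => hy' ⟨hy, h.1⟩
    simp only [this, mul_zero, lintegral_zero]
  · have : ∀ v, f (unitTangentParam g e (y, v)) = 0 := fun v =>
      h0 _ fun h => hy' (mem_transition_source.2 ⟨hy, h.2⟩)
    simp only [this, mul_zero, lintegral_zero]

/-- The tangent vectors over the source of a chart. -/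
def chartSet (e : OpenPartialHomeomorph M Plane) : Set (TangentBundle (𝓡 2) M) :=
  {p | p.proj ∈ e.source}

theorem isOpen_chartSet (e : OpenPartialHomeomorph M Plane) : IsOpen (chartSet e) :=
  e.open_source.preimage (FiberBundle.continuous_proj Plane (TangentSpace (𝓡 2) : M → Type _))

theorem coordLiouville_compl_chartSet (he : e ∈ atlas Plane M) :
    coordLiouville g e (chartSet e)ᶜ = 0 :=
  ae_iff.1 ((ae_coordLiouville he).mono fun _ h => h.1)

theorem restrict_coordLiouville_le (he : e ∈ atlas Plane M) (he' : e' ∈ atlas Plane M) :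
    (coordLiouville g e').restrict (chartSet e) ≤ coordLiouville g e := by
  refine Measure.le_iff.2 fun A hA => ?_
  have hS := (isOpen_chartSet e).measurableSet
  have hS' := (isOpen_chartSet e').measurableSet
  have hm := (hA.inter hS).inter hS'
  have h := lintegral_coordLiouville_eq (g := g) he he'
    (f := ((A ∩ chartSet e) ∩ chartSet e').indicator 1) (measurable_one.indicator hm)
    fun p hp => Set.indicator_of_notMem (fun h => hp ⟨h.1.2, h.2⟩) _
  rw [lintegral_indicator_one hm, lintegral_indicator_one hm] at h
  rw [Measure.restrict_apply hA]
  calc coordLiouville g e' (A ∩ chartSet e)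
      ≤ coordLiouville g e' ((A ∩ chartSet e) ∩ chartSet e')
        + coordLiouville g e' (chartSet e')ᶜ := by
        refine (measure_mono fun p hp => ?_).trans (measure_union_le _ _)
        by_cases h : p ∈ chartSet e'
        · exact Or.inl ⟨hp, h⟩
        · exact Or.inr h
    _ = coordLiouville g e ((A ∩ chartSet e) ∩ chartSet e') := by
        rw [coordLiouville_compl_chartSet he', add_zero, h]
    _ ≤ _ := measure_mono fun p hp => hp.1.1

/-- The gluing statement: over the source of a chart the supremum adds nothing to that chart's own
measure, since the other measures agree with it on overlaps. -/
theorem restrict_iSup_coordLiouville (he : e ∈ atlas Plane M) :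
    (⨆ e ∈ atlas Plane M, coordLiouville g e).restrict (chartSet e) = coordLiouville g e := by
  have hS := (isOpen_chartSet e).measurableSet
  have hr : (coordLiouville g e).restrict (chartSet e) = coordLiouville g e :=
    Measure.restrict_eq_self_of_ae_mem ((ae_coordLiouville he).mono fun p hp => hp.1)
  refine le_antisymm ?_ ?_
  · have h : (⨆ e ∈ atlas Plane M, coordLiouville g e)
        ≤ coordLiouville g e + (⊤ : Measure (TangentBundle (𝓡 2) M)).restrict (chartSet e)ᶜ := by
      refine iSup₂_le fun e' he' => ?_
      rw [← Measure.restrict_add_restrict_compl (μ := coordLiouville g e') hS]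
      exact add_le_add (restrict_coordLiouville_le he he') (Measure.restrict_mono le_rfl le_top)
    refine (Measure.restrict_mono le_rfl h).trans ?_
    rw [Measure.restrict_add, hr, Measure.restrict_restrict hS, Set.inter_compl_self,
      Measure.restrict_empty, add_zero]
  · conv_lhs => rw [← hr]
    exact Measure.restrict_mono le_rfl (le_iSup₂_of_le e he le_rfl)

/-! ### The Liouville measure -/

/-- The inclusion of the unit tangent bundle. -/
def UnitTangentBundle.val (p : UnitTangentBundle g) : TangentBundle (𝓡 2) M := p.1

theorem measurableEmbedding_val : MeasurableEmbedding (UnitTangentBundle.val (g := g)) := by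
  have h : IsClosed {p : TangentBundle (𝓡 2) M | g.inner p.proj p.snd p.snd = 1} :=
    (isClosed_singleton (x := (1 : ℝ))).preimage (continuous_normSq g)
  have h2 : Topology.IsClosedEmbedding (UnitTangentBundle.val (g := g)) :=
    h.isClosedEmbedding_subtypeVal
  exact h2.measurableEmbedding

/-- Pulling back to the unit tangent bundle and pushing forward again restricts to unit vectors,
which loses nothing because each chart measure is carried by them. -/
theorem restrict_map_val_liouville (he : e ∈ atlas Plane M) :
    ((liouville g).map UnitTangentBundle.val).restrict (chartSet e) = coordLiouville g e := by
  have h1 : (liouville g).map UnitTangentBundle.val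
      = (⨆ e ∈ atlas Plane M, coordLiouville g e).restrict (Set.range (UnitTangentBundle.val (g := g))) :=
    measurableEmbedding_val.map_comap _
  rw [h1, Measure.restrict_restrict (isOpen_chartSet e).measurableSet, Set.inter_comm,
    ← Measure.restrict_restrict measurableEmbedding_val.measurableSet_range, restrict_iSup_coordLiouville he]
  exact Measure.restrict_eq_self_of_ae_mem ((ae_coordLiouville he).mono fun p hp => ⟨⟨p, hp.2⟩, rfl⟩)

theorem liouville_preimage_val (he : e ∈ atlas Plane M) {A : Set (TangentBundle (𝓡 2) M)}
    (hA : MeasurableSet A) (hAe : A ⊆ chartSet e) :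
    liouville g (UnitTangentBundle.val ⁻¹' A) = coordLiouville g e A := by
  rw [← restrict_map_val_liouville he, Measure.restrict_apply hA,
    Set.inter_eq_self_of_subset_left hAe, Measure.map_apply measurableEmbedding_val.measurable hA]

theorem coordLiouville_preimage_lt_top (he : e ∈ atlas Plane M) {K : Set Plane} (hK : IsCompact K)
    (hKe : K ⊆ e.target) (hm : MeasurableSet {p : TangentBundle (𝓡 2) M | p.proj ∈ e.symm '' K}) :
    coordLiouville g e {p | p.proj ∈ e.symm '' K} < ⊤ := by
  obtain ⟨C, hC⟩ := hK.exists_bound_of_continuousOn ((continuousOn_det (g := g) he).sqrt.mono hKe)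
  rw [← lintegral_indicator_one hm, lintegral_coordLiouville he (measurable_one.indicator hm)]
  have hle : ∀ y ∈ e.target, ENNReal.ofReal (Real.sqrt (gram (coordMetric g e y)).det) *
        ∫⁻ θ in Set.Ioc 0 (2 * Real.pi), ({p : TangentBundle (𝓡 2) M | p.proj ∈ e.symm '' K}.indicator
          (1 : TangentBundle (𝓡 2) M → ENNReal)) (coordParam g e (y, θ))
      ≤ K.indicator (fun _ => ENNReal.ofReal C * ENNReal.ofReal (2 * Real.pi)) y := by
    intro y hy
    by_cases hyK : y ∈ K
    · rw [Set.indicator_of_mem hyK]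
      refine mul_le_mul' (ENNReal.ofReal_le_ofReal ((le_abs_self _).trans (hC y hyK))) ?_
      refine (lintegral_mono (g := fun _ => 1) fun θ =>
        Set.indicator_le_self' (f := (1 : TangentBundle (𝓡 2) M → ENNReal))
          (fun _ _ => zero_le) (coordParam g e (y, θ))).trans ?_
      simp
    · rw [Set.indicator_of_notMem hyK]
      have h0 : ∀ θ, ({p : TangentBundle (𝓡 2) M | p.proj ∈ e.symm '' K}.indicator
          (1 : TangentBundle (𝓡 2) M → ENNReal)) (coordParam g e (y, θ)) = 0 := fun θ => by
        refine Set.indicator_of_notMem ?_ _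
        rintro ⟨z, hz, hzy⟩
        exact hyK ((e.symm.injOn (hKe hz) hy hzy) ▸ hz)
      simp only [h0, lintegral_zero, mul_zero, le_refl]
  refine (setLIntegral_mono' e.open_target.measurableSet hle).trans_lt ?_
  refine (lintegral_mono' Measure.restrict_le_self le_rfl).trans_lt ?_
  rw [lintegral_indicator hK.measurableSet, setLIntegral_const]
  exact ENNReal.mul_lt_top (ENNReal.mul_lt_top ENNReal.ofReal_lt_top ENNReal.ofReal_lt_top)
    hK.measure_lt_top

instance isFiniteMeasure_liouville [T2Space M] [CompactSpace M] : IsFiniteMeasure (liouville g) := by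
  choose K hKt hK hKn using fun x : M => exists_isCompact_image_mem_nhds x
  obtain ⟨t, ht⟩ := isCompact_univ.elim_nhds_subcover _ fun x _ => hKn x
  refine ⟨?_⟩
  have hcov : (Set.univ : Set (UnitTangentBundle g)) ⊆ ⋃ x ∈ t, UnitTangentBundle.val ⁻¹'
      {p : TangentBundle (𝓡 2) M | p.proj ∈ (chartAt Plane x).symm '' K x} := fun p _ => by
    obtain ⟨x, hxt, hx⟩ := Set.mem_iUnion₂.1 (ht.2 (Set.mem_univ p.1.proj))
    exact Set.mem_iUnion₂.2 ⟨x, hxt, hx⟩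
  refine (measure_mono hcov).trans_lt ((measure_biUnion_finset_le _ _).trans_lt
    (ENNReal.sum_lt_top.2 fun x _ => ?_))
  have hm : MeasurableSet {p : TangentBundle (𝓡 2) M | p.proj ∈ (chartAt Plane x).symm '' K x} :=
    ((((hK x).image_of_continuousOn ((chartAt Plane x).symm.continuousOn.mono
      (hKt x))).isClosed).preimage (FiberBundle.continuous_proj Plane
        (TangentSpace (𝓡 2) : M → Type _))).measurableSet
  rw [liouville_preimage_val (chart_mem_atlas Plane x) hm]
  · exact coordLiouville_preimage_lt_top (chart_mem_atlas Plane x) (hK x) (hKt x) hm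
  · rintro p ⟨y, hy, hyp⟩
    have h := (chartAt Plane x).map_target (hKt x hy)
    rw [hyp] at h
    exact h

/-- The density over the nonzero coordinate vectors whose push-forward under normalization is a
multiple of the Liouville measure. -/
noncomputable def coordWeight (g : Metric M) (e : OpenPartialHomeomorph M Plane)
    (q : Plane × Plane) : ℝ :=
  (gram (coordMetric g e q.1)).det * radialWeight (coordMetric g e q.1 q.2 q.2)

theorem coordWeight_nonneg (he : e ∈ atlas Plane M) {q : Plane × Plane} (hq : q.1 ∈ e.target) :
    0 ≤ coordWeight g e q :=
  mul_nonneg ((isMetricOn_coordMetric g he).inner _ hq).det_pos.le (radialWeight_nonneg _)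

theorem continuousOn_coordWeight (he : e ∈ atlas Plane M) :
    ContinuousOn (coordWeight g e) (e.target ×ˢ ({0}ᶜ : Set Plane)) :=
  ((continuousOn_det he).comp continuousOn_fst fun _ hq => hq.1).mul
    (continuous_radialWeight.comp_continuousOn
      (isMetricOn_coordMetric g he).contDiffOn_normSq.continuousOn)

theorem measurableSet_target_prod (e : OpenPartialHomeomorph M Plane) :
    MeasurableSet (e.target ×ˢ ({0}ᶜ : Set Plane)) :=
  e.open_target.measurableSet.prod (measurableSet_singleton 0).compl

theorem radialMass_mul_lintegral_prod (he : e ∈ atlas Plane M)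
    {f : TangentBundle (𝓡 2) M → ENNReal} (hf : Measurable f) :
    radialMass * ∫⁻ p, f p ∂coordLiouville g e = ∫⁻ q in e.target ×ˢ ({0}ᶜ : Set Plane),
      ENNReal.ofReal (coordWeight g e q) * f (unitTangentParam g e q)
        ∂((volume : Measure Plane).prod volume) := by
  have hm := measurableSet_target_prod e
  rw [radialMass_mul_lintegral he hf, ← Measure.prod_restrict, lintegral_prod]
  · refine setLIntegral_congr_fun e.open_target.measurableSet fun y hy => ?_
    have hB := (isMetricOn_coordMetric g he).inner y hy
    simp only [coordWeight, ENNReal.ofReal_mul hB.det_pos.le, mul_assoc]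
    rw [lintegral_const_mul' _ _ ENNReal.ofReal_ne_top, show (volume : Measure Plane).restrict {0}ᶜ = volume from
      Measure.restrict_eq_self_of_ae_mem (Measure.ae_ne volume 0)]
  · rw [Measure.prod_restrict]
    exact ((continuousOn_coordWeight he).aemeasurable hm).ennreal_ofReal.mul
      (hf.comp_aemeasurable ((continuousOn_unitTangentParam he).aemeasurable hm))

/-- An equality of measures rather than of lower integrals, so that signed integrals can be
transferred as well. -/
theorem radialMass_smul_coordLiouville (he : e ∈ atlas Plane M) :
    radialMass • coordLiouville g e
      = ((((volume : Measure Plane).prod volume).restrict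
        (e.target ×ˢ ({0}ᶜ : Set Plane))).withDensity
          fun q => ENNReal.ofReal (coordWeight g e q)).map (unitTangentParam g e) := by
  have hm := measurableSet_target_prod e
  have h1 := ((continuousOn_coordWeight (g := g) he).aemeasurable hm
    (μ := (volume : Measure Plane).prod volume)).ennreal_ofReal
  have h2 := (continuousOn_unitTangentParam (g := g) he).aemeasurable hm
    (μ := (volume : Measure Plane).prod volume)
  refine Measure.ext_of_lintegral _ fun f hf => ?_
  rw [lintegral_smul_measure, smul_eq_mul, radialMass_mul_lintegral_prod he hf,
    lintegral_map' hf.aemeasurable (h2.mono_ac (withDensity_absolutelyContinuous _ _)),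
    lintegral_withDensity_eq_lintegral_mul₀ h1 (g := fun q => f (unitTangentParam g e q))
      (hf.comp_aemeasurable h2)]
  rfl

theorem integral_coordLiouville (he : e ∈ atlas Plane M) {f : TangentBundle (𝓡 2) M → ℝ}
    (hf : AEStronglyMeasurable f (coordLiouville g e)) :
    radialMass.toReal * ∫ p, f p ∂coordLiouville g e = ∫ q in e.target ×ˢ ({0}ᶜ : Set Plane),
      coordWeight g e q * f (unitTangentParam g e q) ∂((volume : Measure Plane).prod volume) := by
  have hm := measurableSet_target_prod e
  have h1 := ((continuousOn_coordWeight (g := g) he).aemeasurable hm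
    (μ := (volume : Measure Plane).prod volume))
  have h2 := (continuousOn_unitTangentParam (g := g) he).aemeasurable hm
    (μ := (volume : Measure Plane).prod volume)
  have h3 := integral_smul_measure f radialMass (μ := coordLiouville g e)
  rw [smul_eq_mul, radialMass_smul_coordLiouville he, integral_map
    (h2.mono_ac (withDensity_absolutelyContinuous _ _))
    (by rw [← radialMass_smul_coordLiouville he]; exact hf.smul_measure _)] at h3
  rw [← h3, integral_withDensity_eq_integral_toReal_smul₀ h1.ennreal_ofReal
    (Filter.Eventually.of_forall fun _ => ENNReal.ofReal_lt_top)]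
  refine setIntegral_congr_fun hm fun q hq => ?_
  simp only [ENNReal.toReal_ofReal (coordWeight_nonneg he hq.1), smul_eq_mul]

/-- The directions in a nonempty open set, taken with 1/2 < g(v, v) < 3/2, form a nonempty open set
of coordinates (y, v). The weight is strictly positive there, so its integral cannot vanish. -/
instance isOpenPosMeasure_liouville : (liouville g).IsOpenPosMeasure := by
  refine ⟨fun U hU ⟨p₀, hp₀⟩ hU0 => ?_⟩
  have he := chart_mem_atlas Plane p₀.1.proj
  have hy := mem_chart_target Plane p₀.1.proj
  have hp := (tangentParam_chartAt p₀.1).symm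
  set e := chartAt Plane p₀.1.proj
  set y := e p₀.1.proj
  set v := fiberVec p₀.1
  obtain ⟨A, hA, hAU⟩ := isOpen_induced_iff.1 hU
  have hAe : IsOpen (A ∩ chartSet e) := hA.inter (isOpen_chartSet e)
  have h0 : coordLiouville g e (A ∩ chartSet e) = 0 := by
    rw [← liouville_preimage_val he hAe.measurableSet Set.inter_subset_right]
    refine measure_mono_null (fun p hp => ?_) hU0
    exact hAU.le hp.1
  have h1 := radialMass_mul_lintegral_prod (g := g) he
    (measurable_one.indicator hAe.measurableSet)
  rw [lintegral_indicator_one hAe.measurableSet, h0, mul_zero] at h1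
  have hm := measurableSet_target_prod e
  have hopen := e.open_target.prod (isOpen_compl_singleton (x := (0 : Plane)))
  have hO := (((isMetricOn_coordMetric g he).contDiffOn_normSq.continuousOn.prodMk
    (continuousOn_unitTangentParam (g := g) he)).isOpen_inter_preimage hopen
      ((isOpen_Ioo (a := (1 / 2 : ℝ)) (b := 3 / 2)).prod hAe))
  have hq1 : coordMetric g e y v v = 1 := by
    rw [coordMetric_self, ← hp]; exact p₀.normSq_eq_one
  have hv : v ≠ 0 := by
    intro h; simp [h] at hq1
  refine hO.measure_ne_zero ((volume : Measure Plane).prod volume)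
    ⟨(y, v), ⟨hy, hv⟩, ?_, ?_⟩ ?_
  · simp only [hq1]; norm_num
  · change unitTangentParam g e (y, v) ∈ _
    rw [unitTangentParam_of_unit hq1, ← hp]
    refine ⟨?_, mem_chart_source Plane p₀.1.proj⟩
    have : U ⊆ UnitTangentBundle.val ⁻¹' A := hAU.ge
    exact this hp₀
  · have h2 := (lintegral_eq_zero_iff' ((((continuousOn_coordWeight he).aemeasurable
      hm).ennreal_ofReal.mul ((measurable_one.indicator hAe.measurableSet).comp_aemeasurable
        ((continuousOn_unitTangentParam he).aemeasurable hm))))).1 h1.symm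
    have h3 := (ae_restrict_iff' hm).1 h2
    refine measure_mono_null (fun q hq => fun hq' => ?_) (ae_iff.1 h3)
    have h4 := hq' hq.1
    have hB := (isMetricOn_coordMetric g he).inner q.1 hq.1.1
    have h5 : (A ∩ chartSet e).indicator (1 : TangentBundle (𝓡 2) M → ENNReal)
        (unitTangentParam g e q) = 1 := Set.indicator_of_mem hq.2.2 _
    change ENNReal.ofReal (coordWeight g e q) * _ = 0 at h4
    rw [Function.comp_apply, h5, mul_one, ENNReal.ofReal_eq_zero] at h4
    refine h4.not_gt (mul_pos hB.det_pos (mul_pos (Real.sqrt_pos.2 (hB.pos _ hq.1.2))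
      (radialBump.pos_of_mem_ball ?_)))
    rw [Real.ball_eq_Ioo]
    have h6 := hq.2.1
    change (1 : ℝ) - 1 / 2 < _ ∧ _ < (1 : ℝ) + 1 / 2
    exact ⟨by linarith [h6.1], by linarith [h6.2]⟩

end MagneticSurface

namespace MagneticSurface

/-! ### Invariance of the Liouville measure under the magnetic flow -/

variable {M : Type*} [TopologicalSpace M] [ChartedSpace Plane M] [IsManifold (𝓡 2) ∞ M]
  {g : Metric M} {e : OpenPartialHomeomorph M Plane} {κ : M → ℝ}

/-- The shell is the continuous image of K × Euclidean unit circle × [a, b]: a Euclidean unit vector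
is rescaled to have G-square length s in [a, b]. The bound a > 0 excludes the zero vector, where
normalization fails. -/
theorem IsMetricOn.isCompact_shell {G : Plane → Plane →L[ℝ] Plane →L[ℝ] ℝ} {U : Set Plane}
    (h : IsMetricOn G U) {K : Set Plane} (hK : IsCompact K) (hKU : K ⊆ U) {a b : ℝ} (ha : 0 < a) :
    IsCompact {q : Plane × Plane | q.1 ∈ K ∧ G q.1 q.2 q.2 ∈ Set.Icc a b} := by
  have hS : ∀ v ∈ Metric.sphere (0 : Plane) 1, v ≠ 0 := fun v hv h0 => by
    rw [h0] at hv; simp at hv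
  let ψ : (Plane × Plane) × ℝ → Plane × Plane :=
    fun z => (z.1.1, Real.sqrt (z.2 / G z.1.1 z.1.2 z.1.2) • z.1.2)
  have hψ : ContinuousOn ψ ((K ×ˢ Metric.sphere (0 : Plane) 1) ×ˢ Set.Icc a b) := by
    have h1 : ContinuousOn (fun z : (Plane × Plane) × ℝ => G z.1.1 z.1.2 z.1.2)
        ((K ×ˢ Metric.sphere (0 : Plane) 1) ×ˢ Set.Icc a b) :=
      ContinuousOn.comp (g := fun q : Plane × Plane => G q.1 q.2 q.2)
        h.contDiffOn_normSq.continuousOn continuousOn_fst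
        fun z hz => ⟨hKU hz.1.1, hS _ hz.1.2⟩
    refine (continuous_fst.comp continuous_fst).continuousOn.prodMk
      (((continuousOn_snd.div h1 fun z hz => ?_).sqrt).smul
        (continuous_snd.comp continuous_fst).continuousOn)
    exact ((h.inner _ (hKU hz.1.1)).pos _ (hS _ hz.1.2)).ne'
  convert! ((hK.prod (isCompact_sphere (0 : Plane) 1)).prod (isCompact_Icc (a := a)
    (b := b))).image_of_continuousOn hψ
  ext q
  constructor
  · rintro ⟨hq, hab⟩
    have hv : q.2 ≠ 0 := fun h0 => by
      rw [h0] at hab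
      simp only [map_zero] at hab
      exact hab.1.not_gt ha
    have hn := norm_pos_iff.2 hv
    refine ⟨((q.1, ‖q.2‖⁻¹ • q.2), G q.1 q.2 q.2), ⟨⟨hq, by simp [norm_smul, hv]⟩, hab⟩,
      Prod.ext rfl ?_⟩
    have hp := (h.inner _ (hKU hq)).pos _ hv
    have hsq : G q.1 q.2 q.2 / G q.1 (‖q.2‖⁻¹ • q.2) (‖q.2‖⁻¹ • q.2) = ‖q.2‖ ^ 2 := by
      simp only [map_smul, smul_apply, smul_eq_mul]
      field_simp
    change Real.sqrt (G q.1 q.2 q.2 / G q.1 (‖q.2‖⁻¹ • q.2) (‖q.2‖⁻¹ • q.2)) • ‖q.2‖⁻¹ • q.2 = q.2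
    rw [hsq, Real.sqrt_sq hn.le, smul_smul, mul_inv_cancel₀ hn.ne', one_smul]
  · rintro ⟨z, hz, rfl⟩
    refine ⟨hz.1.1, ?_⟩
    have hp := (h.inner _ (hKU hz.1.1)).pos _ (hS _ hz.1.2)
    have hz0 : 0 < z.2 := ha.trans_le hz.2.1
    have : G z.1.1 (Real.sqrt (z.2 / G z.1.1 z.1.2 z.1.2) • z.1.2)
        (Real.sqrt (z.2 / G z.1.1 z.1.2 z.1.2) • z.1.2) = z.2 := by
      simp only [map_smul, smul_apply, smul_eq_mul]
      rw [← mul_assoc, Real.mul_self_sqrt (by positivity), div_mul_cancel₀ _ hp.ne']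
    change G z.1.1 (Real.sqrt (z.2 / G z.1.1 z.1.2 z.1.2) • z.1.2)
        (Real.sqrt (z.2 / G z.1.1 z.1.2 z.1.2) • z.1.2) ∈ Set.Icc a b
    rw [this]
    exact hz.2

theorem radialExt_tangentParam_smul {Z : Type*} [Zero Z] (u : UnitTangentBundle g → Z)
    (he : e ∈ atlas Plane M) {y v : Plane} (hy : y ∈ e.target) (hv : v ≠ 0) {s : ℝ} (hs : 0 < s) :
    radialExt g u (tangentParam e (y, s • v)) = radialExt g u (tangentParam e (y, v)) := by
  rw [← radialExt_unitTangentParam u he hy hv,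
    ← radialExt_unitTangentParam u he hy (smul_ne_zero hs.ne' hv), unitTangentParam_smul e y v hs]

/-- The derivative of a function constant along rays is homogeneous. -/
theorem IsSmooth.fderiv_smul {w : UnitTangentBundle g → ℝ} (hw : IsSmooth g w)
    (he : e ∈ atlas Plane M) {y v : Plane} (hy : y ∈ e.target) (hv : v ≠ 0) {s : ℝ} (hs : 0 < s)
    (a b : Plane) :
    fderiv ℝ (fun q => radialExt g w (tangentParam e q)) (y, s • v) (a, s • b)
      = fderiv ℝ (fun q => radialExt g w (tangentParam e q)) (y, v) (a, b) := by
  have hopen := e.open_target.prod (isOpen_compl_singleton (x := (0 : Plane)))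
  have hd := (((hw.contDiffOn he).contDiffAt (hopen.mem_nhds
    (show (y, s • v) ∈ _ from ⟨hy, smul_ne_zero hs.ne' hv⟩))).differentiableAt
      (by simp)).hasFDerivAt
  let L : Plane × Plane →L[ℝ] Plane × Plane :=
    (ContinuousLinearMap.fst ℝ Plane Plane).prod (s • ContinuousLinearMap.snd ℝ Plane Plane)
  have h1 : HasFDerivAt (fun q => radialExt g w (tangentParam e (L q))) _ (y, v) :=
    HasFDerivAt.comp (g := fun q => radialExt g w (tangentParam e q)) (f := L) (y, v) hd
      L.hasFDerivAt
  have h2 : (fun q => radialExt g w (tangentParam e q))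
      =ᶠ[nhds (y, v)] fun q => radialExt g w (tangentParam e (L q)) := by
    filter_upwards [hopen.mem_nhds (show (y, v) ∈ _ from ⟨hy, hv⟩)] with q hq
    exact (radialExt_tangentParam_smul w he hq.1 hq.2 hs).symm
  rw [h2.fderiv_eq, h1.fderiv]
  rfl

/-- At v the field, apart from det g, is |v| times the magnetic field at v/|v| with its fibre
component scaled back to v. Homogeneity of the derivative of w then leaves the factor |v|, which is
the square root in `radialWeight`. -/
theorem IsSmooth.fderiv_densityField {w : UnitTangentBundle g → ℝ} (hw : IsSmooth g w)
    (hM : IsOrientedAtlas M) (he : e ∈ atlas Plane M) {q : Plane × Plane}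
    (hq : q ∈ e.target ×ˢ ({0}ᶜ : Set Plane)) :
    fderiv ℝ (fun q => radialExt g w (tangentParam e q)) q
        (densityField (coordMetric g e) (fun y => κ (e.symm y)) q)
      = (gram (coordMetric g e q.1)).det * (Real.sqrt (coordMetric g e q.1 q.2 q.2) *
        radialExt g (lieDeriv g (magneticField g κ) w) (unitTangentParam g e q)) := by
  obtain ⟨y, v⟩ := q
  have hy : y ∈ e.target := hq.1
  have hv : v ≠ 0 := hq.2
  have hs : 0 < Real.sqrt (coordMetric g e y v v) :=
    Real.sqrt_pos.2 (((isMetricOn_coordMetric g he).inner y hy).pos v hv)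
  set n := Real.sqrt (coordMetric g e y v v) with hn
  have h1 : radialExt g (lieDeriv g (magneticField g κ) w) (unitTangentParam g e (y, v))
      = fderiv ℝ (fun q => radialExt g w (tangentParam e q)) (y, n⁻¹ • v)
        (coordMagneticField g κ e (y, n⁻¹ • v)) :=
    (radialExt_coe _ ⟨_, normSq_unitTangentParam he hy hv⟩).trans
      (hw.lieDeriv_magneticField hM he hy rfl)
  rw [h1, densityField, map_smul, smul_eq_mul]
  congr 1
  rw [← hw.fderiv_smul he hy hv (inv_pos.2 hs)]
  refine Eq.trans (congrArg _ ?_) (ContinuousLinearMap.map_smul _ n _)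
  refine Prod.ext ?_ ?_
  · simp [coordMagneticField, smul_smul, mul_inv_cancel₀ hs.ne']
  · simp only [coordMagneticField, Prod.smul_mk, map_smul, smul_apply, smul_add, smul_neg,
      smul_smul, mul_inv_cancel₀ hs.ne', one_smul, ← hn]
    congr 2
    · field_simp
    · ring

/-- The support condition on w makes both w and Fw vanish off the chart, so the integral over the
bundle becomes one over coordinates (y, v), to which the divergence theorem applies. -/
theorem IsSmooth.integral_lieDeriv_eq_zero_of_chart {w : UnitTangentBundle g → ℝ}
    (hw : IsSmooth g w) (hM : IsOrientedAtlas M) (hκ : ContMDiff (𝓡 2) 𝓘(ℝ, ℝ) ∞ κ)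
    (he : e ∈ atlas Plane M) {C : Set M} (hC : IsCompact C) (hCc : IsClosed C)
    (hCe : C ⊆ e.source) (hwC : ∀ p : UnitTangentBundle g, p.1.proj ∉ C → w p = 0) :
    ∫ p, lieDeriv g (magneticField g κ) w p ∂liouville g = 0 := by
  have hG := isMetricOn_coordMetric g he
  have hopen := e.open_target.prod (isOpen_compl_singleton (x := (0 : Plane)))
  set Ω := e.target ×ˢ ({0}ᶜ : Set Plane) with hΩ
  set W : Plane × Plane → ℝ := fun q => radialExt g w (tangentParam e q) with hWdef
  have hW : ContDiffOn ℝ ∞ W Ω := hw.contDiffOn he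
  set Fw := lieDeriv g (magneticField g κ) w with hFw
  have hext0 : ∀ p : TangentBundle (𝓡 2) M, p.proj ∉ C → radialExt g w p = 0 := by
    intro p hp
    by_cases h0 : p.snd ≠ 0
    · rw [radialExt_eq _ h0]; exact hwC _ hp
    · exact dif_neg h0
  have hFw0 : ∀ p : UnitTangentBundle g, p.1.proj ∉ C → Fw p = 0 := by
    intro p hp
    have hnear : radialExt g w =ᶠ[nhds p.1] fun _ => (0 : ℝ) := by
      filter_upwards [(hCc.isOpen_compl.preimage (FiberBundle.continuous_proj Plane
        (TangentSpace (𝓡 2) : M → Type _))).mem_nhds hp] with z hz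
      exact hext0 z hz
    rw [hFw, lieDeriv, hnear.mfderiv_eq, mfderiv_const]
    rfl
  -- The test function: C gives compactness in the base, and the bump keeps v in a shell away from 0
  -- and infinity. Thus its support is compact inside Ω and extension by zero is smooth enough.
  let h : Plane × Plane → ℝ :=
    Ω.indicator fun q => radialBump (coordMetric g e q.1 q.2 q.2) * W q
  set K : Set (Plane × Plane) := {q | q.1 ∈ e '' C ∧
    coordMetric g e q.1 q.2 q.2 ∈ Set.Icc (1 / 2 : ℝ) (3 / 2)} with hKdef
  have heC : IsCompact (e '' C) := hC.image_of_continuousOn (e.continuousOn.mono hCe)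
  have heCt : e '' C ⊆ e.target := by
    rintro _ ⟨x, hx, rfl⟩; exact e.map_source (hCe hx)
  have hK : IsCompact K := hG.isCompact_shell heC heCt (by norm_num)
  have hKΩ : K ⊆ Ω := fun q hq => ⟨heCt hq.1, fun h0 => by
    have h1 := hq.2.1
    rw [Set.mem_singleton_iff.1 h0] at h1
    simp only [map_zero] at h1
    norm_num at h1⟩
  have hsupp : Function.support h ⊆ K := by
    intro q hq
    by_contra hqK
    refine hq ?_
    by_cases hqΩ : q ∈ Ω
    · simp only [h, Set.indicator_of_mem hqΩ]
      by_cases hqC : q.1 ∈ e '' C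
      · rw [radialBump_eq_zero fun h => hqK ⟨hqC, h⟩, zero_mul]
      · rw [hWdef]
        simp only
        rw [hext0, mul_zero]
        exact fun h1 => hqC ⟨_, h1, e.right_inv hqΩ.1⟩
    · exact Set.indicator_of_notMem hqΩ _
  have htsupp : tsupport h ⊆ K := closure_minimal hsupp hK.isClosed
  have hcs : HasCompactSupport h := HasCompactSupport.of_support_subset_isCompact hK hsupp
  have hb : ContDiffOn ℝ ∞ (fun q : Plane × Plane => radialBump (coordMetric g e q.1 q.2 q.2)) Ω :=
    radialBump.contDiff.comp_contDiffOn hG.contDiffOn_normSq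
  have hcd : ContDiff ℝ 1 h := by
    refine contDiff_iff_contDiffAt.2 fun q => ?_
    by_cases hqΩ : q ∈ Ω
    · have h1 : ContDiffAt ℝ 1 (fun q => radialBump (coordMetric g e q.1 q.2 q.2) * W q) q :=
        (((hb.mul hW).of_le (by simp)).contDiffAt (hopen.mem_nhds hqΩ))
      refine h1.congr_of_eventuallyEq ?_
      filter_upwards [hopen.mem_nhds hqΩ] with z hz
      exact Set.indicator_of_mem hz _
    · have h1 := notMem_tsupport_iff_eventuallyEq.1 fun hq => hqΩ (hKΩ (htsupp hq))
      exact contDiffAt_const.congr_of_eventuallyEq h1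
  have hint := hG.integral_fderiv_densityField (contDiffOn_comp_chart_symm hκ he) hcd hcs
    (htsupp.trans hKΩ)
  rw [← setIntegral_eq_integral_of_forall_compl_eq_zero (s := Ω) fun q hq => by
    rw [fderiv_of_notMem_tsupport ℝ fun h1 => hq (hKΩ (htsupp h1))]; rfl] at hint
  -- The bump behaves as a constant here because the field preserves g(v, v); only w is
  -- differentiated, and the result is exactly the Liouville density times Fw at the unit vector.
  have hderiv : ∀ q ∈ Ω, fderiv ℝ h q (densityField (coordMetric g e) (fun y => κ (e.symm y)) q)
      = coordWeight g e q * radialExt g Fw (unitTangentParam g e q) := by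
    intro q hq
    have hn := hopen.mem_nhds hq
    have h1 : h =ᶠ[nhds q] fun q => radialBump (coordMetric g e q.1 q.2 q.2) * W q := by
      filter_upwards [hn] with z hz
      exact Set.indicator_of_mem hz _
    have hN := ((hG.contDiffOn_normSq.contDiffAt hn).differentiableAt (by simp)).hasFDerivAt
    have hN0 := hG.fderiv_normSq_densityField (fun y => κ (e.symm y)) hq
    have hB : HasFDerivAt (fun q : Plane × Plane => radialBump (coordMetric g e q.1 q.2 q.2)) _ q :=
      HasDerivAt.comp_hasFDerivAt (h₂ := radialBump)
        (f := fun q : Plane × Plane => coordMetric g e q.1 q.2 q.2) q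
        ((radialBump.contDiff (n := 1)).differentiable (by simp) _).hasDerivAt hN
    have hWd := ((hW.contDiffAt hn).differentiableAt (by simp)).hasFDerivAt
    have hP : HasFDerivAt (fun q => radialBump (coordMetric g e q.1 q.2 q.2) * W q) _ q :=
      hB.mul hWd
    rw [h1.fderiv_eq, hP.fderiv, add_apply, smul_apply, smul_apply, smul_apply, hN0,
      hw.fderiv_densityField hM he hq, coordWeight, radialWeight]
    simp only [smul_eq_mul, mul_zero, add_zero]
    ring
  have hmΩ := measurableSet_target_prod e
  rw [setIntegral_congr_fun hmΩ hderiv] at hint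
  have hcont : Continuous Fw := hw.continuous_lieDeriv_magneticField hM hκ
  have hval : ∀ p : UnitTangentBundle g, radialExt g Fw p.val = Fw p := radialExt_coe Fw
  -- The extension of Fw is compared with Fw only under a measure carried by unit vectors, so
  -- continuity of Fw on the unit tangent bundle suffices.
  have hmeas : AEStronglyMeasurable (radialExt g Fw) ((liouville g).map UnitTangentBundle.val) := by
    rw [measurableEmbedding_val.aestronglyMeasurable_map_iff]
    refine hcont.aestronglyMeasurable.congr (Filter.Eventually.of_forall fun p => (hval p).symm)
  have hmeas' : AEStronglyMeasurable (radialExt g Fw) (coordLiouville g e) := by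
    rw [← restrict_map_val_liouville he]; exact hmeas.restrict
  have h0 : ∀ p ∉ chartSet e, radialExt g Fw p = 0 := by
    intro p hp
    by_cases hp0 : p.snd ≠ 0
    · rw [radialExt_eq _ hp0]
      exact hFw0 _ fun h => hp (hCe h)
    · exact dif_neg hp0
  have hfin := integral_coordLiouville he hmeas'
  rw [hint, mul_eq_zero] at hfin
  have hfin' := hfin.resolve_left (ENNReal.toReal_ne_zero.2 ⟨radialMass_ne_zero, radialMass_ne_top⟩)
  rw [← restrict_map_val_liouville he, setIntegral_eq_integral_of_forall_compl_eq_zero h0,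
    measurableEmbedding_val.integral_map] at hfin'
  simpa only [hval] using hfin'

theorem IsSmooth.lieDeriv_sum {ι : Type*} [Fintype ι] {w : UnitTangentBundle g → ℝ}
    {u : ι → UnitTangentBundle g → ℝ} (hw : IsSmooth g w) (hu : ∀ i, IsSmooth g (u i))
    (hM : IsOrientedAtlas M) (hsum : ∀ p, w p = ∑ i, u i p) (p : UnitTangentBundle g) :
    lieDeriv g (magneticField g κ) w p = ∑ i, lieDeriv g (magneticField g κ) (u i) p := by
  have he := chart_mem_atlas Plane p.1.proj
  have hy := mem_chart_target Plane p.1.proj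
  have hp := (tangentParam_chartAt p.1).symm
  set e := chartAt Plane p.1.proj
  set y := e p.1.proj
  set v := fiberVec p.1
  have hv : v ≠ 0 := by
    rw [← tangentParam_snd_ne_zero g he hy]
    have := p.snd_ne_zero
    rw [hp] at this
    exact this
  have hn := (e.open_target.prod (isOpen_compl_singleton (x := (0 : Plane)))).mem_nhds
    (Set.mk_mem_prod hy hv)
  have hE : (fun q => radialExt g w (tangentParam e q))
      =ᶠ[nhds (y, v)] fun q => ∑ i, radialExt g (u i) (tangentParam e q) := by
    filter_upwards [hn] with q hq
    have hq' := (tangentParam_snd_ne_zero g he hq.1).2 hq.2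
    refine (radialExt_eq _ hq').trans ((hsum _).trans ?_)
    exact Finset.sum_congr rfl fun i _ => (radialExt_eq _ hq').symm
  rw [hw.lieDeriv_magneticField hM he hy hp, hE.fderiv_eq, fderiv_fun_sum fun i _ =>
    (((hu i).contDiffOn he).contDiffAt hn).differentiableAt (by simp), sum_apply]
  exact Finset.sum_congr rfl fun i _ => ((hu i).lieDeriv_magneticField hM he hy hp).symm

/-- The magnetic flow preserves the Liouville measure. -/
theorem IsSmooth.integral_lieDeriv_eq_zero [T2Space M] [CompactSpace M]
    {w : UnitTangentBundle g → ℝ} (hw : IsSmooth g w) (hM : IsOrientedAtlas M)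
    (hκ : ContMDiff (𝓡 2) 𝓘(ℝ, ℝ) ∞ κ) :
    ∫ p, lieDeriv g (magneticField g κ) w p ∂liouville g = 0 := by
  -- A finite cover makes the partition of unity a finite family, so its sum can be exchanged with
  -- both the derivative and the integral.
  obtain ⟨t, ht⟩ := isCompact_univ.elim_nhds_subcover (fun x : M => (chartAt Plane x).source)
    fun x _ => chart_source_mem_nhds Plane x
  obtain ⟨ρ, hρ⟩ := SmoothPartitionOfUnity.exists_isSubordinate (𝓡 2) (isClosed_univ (X := M))
    (fun x : t => (chartAt Plane (x : M)).source) (fun x => (chartAt Plane (x : M)).open_source)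
    (fun z _ => by
      obtain ⟨x, hx, hz⟩ := Set.mem_iUnion₂.1 (ht.2 (Set.mem_univ z))
      exact Set.mem_iUnion.2 ⟨⟨x, hx⟩, hz⟩)
  have hu : ∀ i, IsSmooth g (fun p : UnitTangentBundle g => ρ i p.1.proj * w p) := fun i =>
    (isSmooth_comp_proj (ρ i).contMDiff).mul hw
  have hsum : ∀ p : UnitTangentBundle g, w p = ∑ i, ρ i p.1.proj * w p := fun p => by
    have h1 := ρ.sum_eq_one (Set.mem_univ p.1.proj)
    rw [finsum_eq_sum_of_fintype] at h1
    rw [← Finset.sum_mul, h1, one_mul]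
  simp only [hw.lieDeriv_sum hu hM hsum]
  rw [integral_finsetSum _ fun i _ => ((hu i).continuous_lieDeriv_magneticField hM
    hκ).integrable_of_hasCompactSupport (HasCompactSupport.of_compactSpace _)]
  refine Finset.sum_eq_zero fun i _ => (hu i).integral_lieDeriv_eq_zero_of_chart hM hκ
    (chart_mem_atlas Plane (i : M)) (isClosed_tsupport (ρ i)).isCompact (isClosed_tsupport (ρ i))
    (hρ i) fun p hp => ?_
  rw [image_eq_zero_of_notMem_tsupport hp, zero_mul]

/-! ### The energy identity -/

theorem l2Form_ofReal_mul (f : UnitTangentBundle g → ℝ) (u : UnitTangentBundle g → ℂ) :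
    l2Form g (fun p => (f p : ℂ) * u p) u = ((∫ p, f p * ‖u p‖ ^ 2 ∂liouville g : ℝ) : ℂ) := by
  rw [l2Form, ← integral_complex_ofReal]
  refine integral_congr_ae (Filter.Eventually.of_forall fun p => ?_)
  simp only
  rw [mul_assoc, Complex.mul_conj']
  push_cast
  rfl

theorem IsSmooth.lieDeriv_mul_norm_sq {u : UnitTangentBundle g → ℂ} (hu : IsSmooth g u)
    {r : UnitTangentBundle g → ℝ} (hr : IsSmooth g r) (hM : IsOrientedAtlas M)
    (p : UnitTangentBundle g) :
    lieDeriv g (magneticField g κ) (fun p => r p * ‖u p‖ ^ 2) p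
      = r p * (2 * inner ℝ (u p) (lieDeriv g (magneticField g κ) u p))
        + ‖u p‖ ^ 2 * lieDeriv g (magneticField g κ) r p := by
  have hφ : ContDiff ℝ ∞ (fun z : ℂ => ‖z‖ ^ 2) := contDiff_norm_sq ℝ
  rw [hr.lieDeriv_mul (hu.comp hφ) hM, hu.lieDeriv_comp hφ hM, fderiv_norm_sq_apply, smul_apply,
    innerSL_apply_apply, two_nsmul, two_mul]

theorem norm_sq_sub_real_mul (a z : ℂ) (r : ℝ) :
    ‖a - (r : ℂ) * z‖ ^ 2 = ‖a‖ ^ 2 - 2 * r * inner ℝ z a + r ^ 2 * ‖z‖ ^ 2 := by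
  rw [← Complex.real_smul, norm_sub_sq_real, inner_smul_right, norm_smul, mul_pow,
    Real.norm_eq_abs, sq_abs, real_inner_comm]
  ring

end MagneticSurface

/-! ### The energy identity, the inequality and the case of equality -/

theorem theorem2p5 {M : Type*} [TopologicalSpace M] [T2Space M] [CompactSpace M]
    [ChartedSpace Plane M] [IsManifold (𝓡 2) ∞ M] (hM : MagneticSurface.IsOrientedAtlas M)
    (g : MagneticSurface.Metric M) (κ : M → ℝ) (hκ : ContMDiff (𝓡 2) 𝓘(ℝ, ℝ) ∞ κ)
    (hK : ∀ p : MagneticSurface.UnitTangentBundle g,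
      MagneticSurface.magneticCurvature g κ p < 0)
    (u : MagneticSurface.UnitTangentBundle g → ℂ) (hu : MagneticSurface.IsSmooth g u) :
    let F := MagneticSurface.magneticField g κ
    let 𝕂 := MagneticSurface.magneticCurvature g κ
    let Fu := MagneticSurface.lieDeriv g F u
    (∀ r : MagneticSurface.UnitTangentBundle g → ℝ, MagneticSurface.IsSmooth g r →
      (∀ p, MagneticSurface.lieDeriv g F r p + r p ^ 2 + 𝕂 p = 0) →
      (MagneticSurface.l2NormSq g Fu : ℂ)
          - MagneticSurface.l2Form g (fun p => (𝕂 p : ℂ) * u p) u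
        = (MagneticSurface.l2NormSq g (fun p => Fu p - (r p : ℂ) * u p) : ℂ)) ∧
    0 ≤ (MagneticSurface.l2NormSq g Fu : ℂ)
          - MagneticSurface.l2Form g (fun p => (𝕂 p : ℂ) * u p) u ∧
    ((MagneticSurface.l2NormSq g Fu : ℂ)
          - MagneticSurface.l2Form g (fun p => (𝕂 p : ℂ) * u p) u = 0 ↔ ∀ p, u p = 0) := by

  intro F 𝕂 Fu
  have hcK : Continuous 𝕂 := MagneticSurface.continuous_magneticCurvature hM hκ
  have hcu : Continuous u := hu.continuous
  have hcFu : Continuous Fu := hu.continuous_lieDeriv_magneticField hM hκ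
  have hint : ∀ f : MagneticSurface.UnitTangentBundle g → ℝ, Continuous f →
      Integrable f (MagneticSurface.liouville g) := fun f hf =>
    hf.integrable_of_hasCompactSupport (HasCompactSupport.of_compactSpace _)
  have hi1 := hint (fun p => ‖Fu p‖ ^ 2) (hcFu.norm.pow 2)
  have hi2 := hint (fun p => 𝕂 p * ‖u p‖ ^ 2) (hcK.mul (hcu.norm.pow 2))
  have hKu : MagneticSurface.l2Form g (fun p => (𝕂 p : ℂ) * u p) u
      = ((∫ p, 𝕂 p * ‖u p‖ ^ 2 ∂MagneticSurface.liouville g : ℝ) : ℂ) :=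
    MagneticSurface.l2Form_ofReal_mul 𝕂 u
  have h1 : 0 ≤ ∫ p, ‖Fu p‖ ^ 2 ∂MagneticSurface.liouville g :=
    integral_nonneg fun p => sq_nonneg _
  have h2 : 0 ≤ ∫ p, -(𝕂 p * ‖u p‖ ^ 2) ∂MagneticSurface.liouville g :=
    integral_nonneg fun p => neg_nonneg.2
      (mul_nonpos_of_nonpos_of_nonneg (hK p).le (sq_nonneg _))
  rw [hKu, MagneticSurface.l2NormSq, ← Complex.ofReal_sub]
  refine ⟨fun r hr hric => ?_, ?_, ?_⟩
  · have hsm : MagneticSurface.IsSmooth g (fun p => r p * ‖u p‖ ^ 2) :=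
      hr.mul (hu.comp (contDiff_norm_sq ℝ))
    -- The function r|u|² is the primitive whose derivative F(r|u|²) is the pointwise difference of
    -- the two integrands; subtracting its zero integral reduces the identity to algebra.
    have h0 := hsm.integral_lieDeriv_eq_zero hM hκ
    have hi3 := hint _ (hsm.continuous_lieDeriv_magneticField hM hκ)
    rw [MagneticSurface.l2NormSq, ← integral_sub hi1 hi2]
    congr 1
    have h3 := integral_sub (hi1.sub hi2) hi3
    rw [h0, sub_zero] at h3
    refine h3.symm.trans (integral_congr_ae (Filter.Eventually.of_forall fun p => ?_))
    have h4 := hric p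
    have h5 := hu.lieDeriv_mul_norm_sq (κ := κ) hr hM p
    simp only [Pi.sub_apply]
    rw [h5, MagneticSurface.norm_sq_sub_real_mul]
    have h6 : MagneticSurface.lieDeriv g (MagneticSurface.magneticField g κ) r p
        = -r p ^ 2 - 𝕂 p := by
      change MagneticSurface.lieDeriv g F r p = _
      linarith
    rw [h6]
    change _ = ‖Fu p‖ ^ 2 - 2 * r p * inner ℝ (u p) (Fu p) + _
    change ‖Fu p‖ ^ 2 - 𝕂 p * ‖u p‖ ^ 2 - (r p * (2 * inner ℝ (u p) (Fu p)) + _) = _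
    ring
  · rw [Complex.zero_le_real]
    rw [integral_neg] at h2
    linarith
  · rw [Complex.ofReal_eq_zero]
    constructor
    · intro h
      have h3 : ∫ p, -(𝕂 p * ‖u p‖ ^ 2) ∂MagneticSurface.liouville g = 0 := by
        rw [integral_neg] at h2 ⊢
        linarith
      intro p
      by_contra hp
      -- If u(p) ≠ 0, then -𝕂|u|² is continuous, nonnegative and positive at p, so its integral is
      -- positive because μ charges open sets.
      refine (((hcK.mul (hcu.norm.pow 2)).neg).integral_pos_of_hasCompactSupport_nonneg_nonzero
        (HasCompactSupport.of_compactSpace _) (fun q => neg_nonneg.2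
          (mul_nonpos_of_nonpos_of_nonneg (hK q).le (sq_nonneg _))) (x := p) ?_).ne' h3
      exact neg_ne_zero.2 (mul_ne_zero (hK p).ne (pow_ne_zero 2 (norm_ne_zero_iff.2 hp)))
    · intro h
      have hFu0 : ∀ p, Fu p = 0 := fun p => by
        -- The derivative is that of the extension on the whole tangent bundle, so the extension
        -- must vanish everywhere, including on zero vectors, where it takes its default value 0.
        have h3 : MagneticSurface.radialExt g u = fun _ => (0 : ℂ) := by
          funext q
          by_cases hq : q.snd ≠ 0
          · exact (MagneticSurface.radialExt_eq _ hq).trans (h _)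
          · exact dif_neg hq
        change mfderiv _ _ (MagneticSurface.radialExt g u) p.1 _ = _
        rw [h3, mfderiv_const]
        rfl
      simp [hFu0, h]
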